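/- Let $\mathfrak g=\mathfrak{sl}(2,\mathbb C)$ with its standard basis $e,h,f$ and Killing form $\kappa$, let $A=\mathbb C[[a]]$ and $s=t-a$, and put $$\hat{\mathfrak g}_1=\mathbb C[t,t^{-1}]\otimes\mathfrak g\oplus\mathbb C\,C_1,\qquad \hat{\mathfrak g}_2=A[t]\big[\tfrac1{ts}\big]\otimes\mathfrak g\oplus A\,C_2,$$ where $C_1,C_2$ are central and $[fx,gy]=fg[x,y]+\kappa(x,y)\operatorname{Res}(g\,df)\,C$. Here $\operatorname{Res}$ is the residue at $t=0$ for $\hat{\mathfrak g}_1$ and the sum of the residues at $t=0$ and $t=a$ for $\hat{\mathfrak g}_2$. Let $$\hat U_1=\varprojlim_n U(\hat{\mathfrak g}_1)/(C_1+\tfrac12,\;t^n\mathbb C[t]\otimes\mathfrak g),\qquad \hat U_2=\varprojlim_n U(\hat{\mathfrak g}_2)/(C_2+\tfrac12,\;(ts)^nA[t]\otimes\mathfrak g)$$ (quotients by the left ideals generated) be the completed enveloping algebras at the critical level. The specialisation $\mathrm{Sp}$ ($a\mapsto0$; $t,s\mapsto t$; $C_2\mapsto C_1$) maps $\hat{\mathfrak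 g}_2$ onto $\hat{\mathfrak g}_1$ and identifies $\hat U_2/a\hat U_2$ with $\hat U_1$; in this way quotients of $\hat U_2$-modules that are killed by $a$ are $\hat U_1$-modules. Let $\lambda\ge\mu\ge0$ be integers, let $V^\nu$ be the irreducible $\mathfrak g$-module of highest weight $\nu$, and let $v_\lambda,v_\mu$ be highest weight vectors of $V^\lambda,V^\mu$. For a finite-dimensional $\mathfrak g$-module $V$ let $\operatorname{Ind}(V)$ be the $\hat{\mathfrak g}_1$-module induced from the $(\mathbb C[t]\otimes\mathfrak g\oplus\mathbb C C_1)$-module $V$ on which $f(t)x$ acts as $f(0)x$ and $C_1$ as $-\tfrac12$; put $\mathbb V_1^\nu=\operatorname{Ind}(V^\nu)$ and $\mathbb W_1^{\lambda,\mu}=\operatorname{Ind}(V^\lambda\otimes V^\mu)$. Let $\mathbb V_2^{\lambda,\mu}$ be the $\hat{\mathfrak g}_2$-module induced from the $(A[t]\otimes\mathfrak g\oplus AC_2)$-module $A\otimes V^\lambda\otimes V^\mu$ on which $f(t,s)x$ acts as $f(0,-a)\,x\otimes\mathrm{id}+f(a,0)\,\mathrm{id}\otimes x$ and $C_2$ as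 $-\tfrac12$. Let $\tilde{\mathbb V}$ be the $\hat U_2$-submodule of $\mathbb V_2^{\lambda,\mu}$ generated by $1\otimes v_\lambda\otimes v_\mu$, and $\mathcal F_i=\tilde{\mathbb V}\cap a^i\,\mathbb V_2^{\lambda,\mu}$ for $i\ge0$. Let $F^i=U(\mathfrak g)\cdot(\mathbb C\,\mathrm{id}\otimes\mathrm{id}+\mathrm{id}\otimes\mathfrak g)^i\cdot(v_\lambda\otimes v_\mu)\subset V^\lambda\otimes V^\mu$, put $G^0=F^0$, and for each $i\ge0$ let $G^{i+1}$ be a $\mathfrak g$-stable complement of $F^i$ in $F^{i+1}$. For $0\le i\le\mu$ let $u_i\in G^i$ be a highest weight vector (a nonzero vector with $e\,u_i=0$), regarded as the element $1\otimes u_i$ of $\mathbb V_2^{\lambda,\mu}$, and set $\tilde w_i=a^iu_i$. Then: a) For $0\le i\le\mu$ one has $\tilde w_i\in\tilde{\mathbb V}$ and $\tilde w_i\notin a\tilde{\mathbb V}$; for $1\le i\le\mu$ one has $a^{i-1}u_i\notin\tilde{\mathbb V}$. b) For every $i\ge0$ the elements $\tilde w_j$ with $i\le j\le\mu$ lie in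 $\mathcal F_i$, there is an isomorphism of $\hat U_1$-modules $$\frac{\mathcal F_i+a\tilde{\mathbb V}}{a\tilde{\mathbb V}}\;\simeq\;\bigoplus_{j=i}^{\mu}\mathbb V_1^{\lambda+\mu-2j},$$ and this quotient is generated as a $\hat U_1$-module by the classes of $\tilde w_i,\dots,\tilde w_\mu$ (for $i>\mu$ it is zero). c) In particular $\tilde{\mathbb V}/a\tilde{\mathbb V}\simeq\mathbb W_1^{\lambda,\mu}$ as $\hat U_1$-modules, and it is generated as a $\hat U_1$-module by the classes of $\tilde w_0,\dots,\tilde w_\mu$. -/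

import Mathlib

open scoped TensorProduct Polynomial Pointwise DirectSum

namespace TwoPoint
noncomputable section

attribute [local instance 100] LieRing.ofAssociativeRing

section Disc
variable {k : Type} [CommRing k]

/-- The ring `k[t][1/q]`. For `k = ℂ`, `q = t` it is `ℂ[t, t⁻¹]`; for `k = ℂ[[a]]`, `q = t(t - a) = ts` it is
`k[t, s][1/ts]` with `s = t - a`. -/
abbrev Punctured (q : k[X]) : Type := Localization.Away q

/-- `p(t)` as a Laurent series in `t⁻¹`. -/
def polyInfty : k[X] →+* LaurentSeries k :=
  Polynomial.eval₂RingHom HahnSeries.C (HahnSeries.single (-1 : ℤ) (1 : k))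

theorem polyInfty_C_mul_X_pow (c : k) (n : ℕ) :
    polyInfty (Polynomial.C c * Polynomial.X ^ n) = HahnSeries.single (-(n : ℤ)) c := by
  simp [polyInfty, HahnSeries.C_apply]

theorem isUnit_polyInfty {q : k[X]} (hq : q.Monic) : IsUnit (polyInfty q) := by
  let _ : Invertible (HahnSeries.single (-1 : ℤ) (1 : k)) :=
    ⟨HahnSeries.single (1 : ℤ) (1 : k), by simp, by simp⟩
  have key : ∀ p : k[X], Polynomial.eval₂ HahnSeries.C (HahnSeries.single (1 : ℤ) (1 : k)) p =
      HahnSeries.ofPowerSeries ℤ k (p : PowerSeries k) := by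
    intro p
    induction p using Polynomial.induction_on' with
    | add p r hp hr => simp [hp, hr]
    | monomial n c => simp [← Polynomial.C_mul_X_pow_eq_monomial]
  have hu : IsUnit (q.reverse : PowerSeries k) := by
    rw [PowerSeries.isUnit_iff_constantCoeff]
    simp [Polynomial.coeff_zero_reverse, hq.leadingCoeff]
  have h2 := hu.map (HahnSeries.ofPowerSeries ℤ k)
  rw [← key] at h2
  have h3 := Polynomial.eval₂_reverse_mul_pow HahnSeries.C (HahnSeries.single (-1 : ℤ) (1 : k)) q
  rw [polyInfty, Polynomial.coe_eval₂RingHom, ← h3]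
  exact h2.mul ((isUnit_of_invertible _).pow _)

/-- Expansion of an element of `k[t][1/q]` at `t = ∞`: a Laurent series in the variable `t⁻¹`. -/
def expandInfty (q : k[X]) (hq : q.Monic) : Punctured q →+* LaurentSeries k :=
  IsLocalization.Away.lift q (isUnit_polyInfty hq)

theorem expandInfty_poly (q : k[X]) (hq : q.Monic) (p : k[X]) :
    expandInfty q hq (algebraMap k[X] (Punctured q) p) = polyInfty p :=
  IsLocalization.Away.lift_eq q (isUnit_polyInfty hq) p

theorem expandInfty_smul (q : k[X]) (hq : q.Monic) (c : k) (f : Punctured q) :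
    expandInfty q hq (c • f) = HahnSeries.C c * expandInfty q hq f := by
  rw [Algebra.smul_def, map_mul, IsScalarTower.algebraMap_apply k k[X] (Punctured q),
    expandInfty_poly]
  simp [polyInfty]

/-- The derivation `d/dt` on Laurent series in `x = t⁻¹`, that is `-x² d/dx`. -/
def ddt : LaurentSeries k →ₗ[k] LaurentSeries k where
  toFun F := -(HahnSeries.single (2 : ℤ) (1 : k) * LaurentSeries.derivative k F)
  map_add' F G := by simp [mul_add, add_comm]
  map_smul' c F := by
    ext n
    simp [HahnSeries.coeff_single_mul, mul_left_comm]

theorem ddt_coeff (f : LaurentSeries k) (n : ℤ) :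
    (ddt f).coeff n = -((n - 1 : ℤ) : k) * f.coeff (n - 1) := by
  have h : n - 2 + 1 = n - 1 := by ring
  simp [ddt, HahnSeries.coeff_single_mul, LaurentSeries.hasseDeriv_coeff, h]
  ring

theorem ddt_mul (f g : LaurentSeries k) : ddt (f * g) = ddt f * g + f * ddt g := by
  have hE : ∀ F : LaurentSeries k, ∃ E : LaurentSeries k,
      ddt F = -(HahnSeries.single (1 : ℤ) (1 : k) * E) ∧ ∀ n, E.coeff n = (n : k) * F.coeff n := by
    intro F
    refine ⟨-(HahnSeries.single (-1 : ℤ) (1 : k) * ddt F), ?_, fun n => ?_⟩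
    · rw [mul_neg, neg_neg, ← mul_assoc]; simp
    · simp [HahnSeries.coeff_single_mul, ddt_coeff]
  obtain ⟨E₁, h₁, c₁⟩ := hE f
  obtain ⟨E₂, h₂, c₂⟩ := hE g
  obtain ⟨E₃, h₃, c₃⟩ := hE (f * g)
  have : E₃ = E₁ * g + f * E₂ := by
    ext n
    have s₁ : E₁.support ⊆ f.support := by
      intro m hm hf
      exact hm (by rw [c₁]; simp [hf])
    have s₂ : E₂.support ⊆ g.support := by
      intro m hm hf
      exact hm (by rw [c₂]; simp [hf])
    rw [c₃, HahnSeries.coeff_add, HahnSeries.coeff_mul,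
      HahnSeries.coeff_mul_left' f.isPWO_support s₁, HahnSeries.coeff_mul_right' g.isPWO_support s₂,
      ← Finset.sum_add_distrib, Finset.mul_sum]
    refine Finset.sum_congr rfl fun ij hij => ?_
    have : ij.1 + ij.2 = n := (Finset.mem_antidiagonal.mp hij).2.2
    rw [c₁, c₂, ← this]
    push_cast
    ring
  rw [h₁, h₂, h₃, this]
  ring


theorem ddt_C_mul (c : k) (F : LaurentSeries k) :
    ddt (HahnSeries.C c * F) = HahnSeries.C c * ddt F := by
  rw [HahnSeries.C_mul_eq_smul, map_smul, HahnSeries.C_mul_eq_smul]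

theorem ddt_polyInfty (p : k[X]) : ddt (polyInfty p) = polyInfty (Polynomial.derivative p) := by
  induction p using Polynomial.induction_on' with
  | add p r hp hr => simp [hp, hr]
  | monomial n c =>
    rw [← Polynomial.C_mul_X_pow_eq_monomial, Polynomial.derivative_C_mul_X_pow,
      polyInfty_C_mul_X_pow, polyInfty_C_mul_X_pow]
    ext m
    rw [ddt_coeff]
    rcases n with _ | n
    · by_cases h : m - 1 = 0 <;> simp [h]
    · by_cases h : m = -(n : ℤ)
      · subst h
        simp [HahnSeries.coeff_single]
        ring_nf
        simp
      · have h' : m - 1 ≠ -1 + -(n : ℤ) := by omega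
        simp [h, h']

theorem polyInfty_coeff_one (p : k[X]) : (polyInfty p).coeff 1 = 0 := by
  induction p using Polynomial.induction_on' with
  | add p r hp hr => simp [hp, hr]
  | monomial m c =>
    rw [← Polynomial.C_mul_X_pow_eq_monomial, polyInfty_C_mul_X_pow]
    exact HahnSeries.coeff_single_of_ne (by omega)

/-- The form `(f, g) ↦ Res (g df)` on `k[t][1/q]`. Here `Res h dt` is the coefficient of `t⁻¹` (that is of `x¹`,
`x = t⁻¹`) in the expansion of `h` at infinity, i.e. the sum of the residues of `h dt` at all the finite
singular points: `Res₁` at `t = 0` for `ℂ[t, t⁻¹]`, and `Res₂ = Res_{t=0} + Res_{t=a}` for `ℂ[[a]][t][1/ts]`. -/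
def residuePairing (q : k[X]) (hq : q.Monic) : LinearMap.BilinForm k (Punctured q) :=
  LinearMap.mk₂ k
    (fun f g => (expandInfty q hq g * ddt (expandInfty q hq f)).coeff 1)
    (fun f f' g => by simp [mul_add])
    (fun c f g => by
      rw [expandInfty_smul, ddt_C_mul, mul_left_comm, HahnSeries.C_mul_eq_smul,
        HahnSeries.coeff_smul])
    (fun f g g' => by simp [add_mul])
    (fun c f g => by
      rw [expandInfty_smul, mul_assoc, HahnSeries.C_mul_eq_smul, HahnSeries.coeff_smul])

theorem residuePairing_apply (q : k[X]) (hq : q.Monic) (f g : Punctured q) :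
    residuePairing q hq f g = (expandInfty q hq g * ddt (expandInfty q hq f)).coeff 1 := rfl

theorem residuePairing_skew (q : k[X]) (hq : q.Monic) (f g : Punctured q) :
    residuePairing q hq f g = -residuePairing q hq g f := by
  have h : (ddt (expandInfty q hq f * expandInfty q hq g)).coeff 1 = 0 := by
    rw [ddt_coeff]; simp
  rw [ddt_mul, HahnSeries.coeff_add] at h
  rw [residuePairing_apply, residuePairing_apply, mul_comm (expandInfty q hq g)]
  exact eq_neg_of_add_eq_zero_left h

theorem residuePairing_cocycle (q : k[X]) (hq : q.Monic) (f g h : Punctured q) :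
    residuePairing q hq f (g * h) = residuePairing q hq (f * g) h - residuePairing q hq g (f * h) := by
  simp only [residuePairing_apply, map_mul, ddt_mul]
  rw [eq_sub_iff_add_eq, ← HahnSeries.coeff_add]
  congr 1
  ring

theorem residuePairing_polynomial (q : k[X]) (hq : q.Monic) (f g : k[X]) :
    residuePairing q hq (algebraMap k[X] (Punctured q) f) (algebraMap k[X] (Punctured q) g) = 0 := by
  rw [residuePairing_apply, expandInfty_poly, expandInfty_poly, ddt_polyInfty, ← map_mul]
  exact polyInfty_coeff_one _

end Disc

/-- A `k`-valued form on a `k`-algebra `K` which, together with an invariant symmetric form on a Lie algebra `g`,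
defines a 2-cocycle on `K ⊗ g`. -/
structure LoopCocycle (k K : Type) [CommRing k] [CommRing K] [Algebra k K] where
  form : LinearMap.BilinForm k K
  skew : ∀ f g, form f g = -form g f
  cocycle : ∀ f g h, form f (g * h) = form (f * g) h - form g (f * h)

section Affine
variable {k K : Type} [CommRing k] [CommRing K] [Algebra k K]
  [Algebra ℂ k] [Algebra ℂ K] [IsScalarTower ℂ k K]
  (g : Type) [LieRing g] [LieAlgebra ℂ g]

/-- The central extension `(K ⊗ g) ⊕ k C` with bracket
`[f x + p C, f' y + p' C] = f f' [x, y] + κ(x, y) c(f, f') C`, where `κ` is the Killing form of `g`. -/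
def Affine (_ : LoopCocycle k K) : Type := (K ⊗[ℂ] g) × k

instance (c : LoopCocycle k K) : AddCommGroup (Affine g c) :=
  inferInstanceAs (AddCommGroup ((K ⊗[ℂ] g) × k))

instance (c : LoopCocycle k K) : Module k (Affine g c) :=
  inferInstanceAs (Module k ((K ⊗[ℂ] g) × k))

/-- The form `(f x, f' y) ↦ κ(x, y) c(f, f')` on `K ⊗ g`. -/
def loopForm (c : LoopCocycle k K) : LinearMap.BilinForm k (K ⊗[ℂ] g) :=
  LinearMap.BilinForm.tmul c.form (killingForm ℂ g)

variable {g}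

theorem loopForm_tmul (c : LoopCocycle k K) (f f' : K) (x y : g) :
    loopForm g c (f ⊗ₜ x) (f' ⊗ₜ y) = killingForm ℂ g x y • c.form f f' := rfl

theorem loopForm_skew (c : LoopCocycle k K) (ξ η : K ⊗[ℂ] g) :
    loopForm g c ξ η = -loopForm g c η ξ := by
  induction ξ using TensorProduct.induction_on with
  | zero => simp
  | add _ _ h₁ h₂ => simp only [map_add, LinearMap.add_apply, h₁, h₂]; ring
  | tmul f x =>
    induction η using TensorProduct.induction_on with
    | zero => simp
    | add _ _ h₁ h₂ => simp only [map_add, LinearMap.add_apply, h₁, h₂]; ring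
    | tmul f' y =>
      rw [loopForm_tmul, loopForm_tmul, c.skew, LieModule.traceForm_comm, smul_neg]

theorem loopForm_self (c : LoopCocycle k K) (ξ : K ⊗[ℂ] g) : loopForm g c ξ ξ = 0 := by
  have h : (2 : ℂ) • loopForm g c ξ ξ = 0 := by
    rw [two_smul]
    nth_rewrite 1 [loopForm_skew]
    simp
  have h2 := congrArg (fun z => (2 : ℂ)⁻¹ • z) h
  simpa [smul_smul] using h2

theorem loopForm_cocycle (c : LoopCocycle k K) (ξ η ζ : K ⊗[ℂ] g) :
    loopForm g c ξ ⁅η, ζ⁆ = loopForm g c ⁅ξ, η⁆ ζ + loopForm g c η ⁅ξ, ζ⁆ := by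
  induction ξ using TensorProduct.induction_on with
  | zero => simp
  | add _ _ h₁ h₂ => simp only [map_add, add_lie, LinearMap.add_apply, h₁, h₂]; ring
  | tmul f x =>
    induction η using TensorProduct.induction_on with
    | zero => simp
    | add _ _ h₁ h₂ => simp only [map_add, add_lie, lie_add, LinearMap.add_apply, h₁, h₂]; ring
    | tmul f' y =>
      induction ζ using TensorProduct.induction_on with
      | zero => simp
      | add _ _ h₁ h₂ => simp only [map_add, lie_add, h₁, h₂]; ring
      | tmul f'' z =>
        have e₁ : killingForm ℂ g x ⁅y, z⁆ = killingForm ℂ g ⁅x, y⁆ z :=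
          (LieModule.traceForm_apply_lie_apply ℂ g g x y z).symm
        have e₂ : killingForm ℂ g y ⁅x, z⁆ = -killingForm ℂ g ⁅x, y⁆ z := by
          rw [← LieModule.traceForm_apply_lie_apply, ← lie_skew, map_neg, LinearMap.neg_apply]
        simp only [LieAlgebra.ExtendScalars.bracket_tmul, loopForm_tmul, e₁, e₂, c.cocycle f f' f'']
        module

instance (c : LoopCocycle k K) : LieRing (Affine g c) where
  bracket X Y := (⁅X.1, Y.1⁆, loopForm g c X.1 Y.1)
  add_lie X Y Z := Prod.ext (add_lie X.1 Y.1 Z.1)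
    (by change loopForm g c (X.1 + Y.1) Z.1 = _; rw [map_add]; rfl)
  lie_add X Y Z := Prod.ext (lie_add X.1 Y.1 Z.1) (map_add (loopForm g c X.1) Y.1 Z.1)
  lie_self X := Prod.ext (lie_self X.1) (loopForm_self c X.1)
  leibniz_lie X Y Z := Prod.ext (leibniz_lie X.1 Y.1 Z.1) (loopForm_cocycle c X.1 Y.1 Z.1)

theorem Affine.lie_def (c : LoopCocycle k K) (X Y : Affine g c) :
    ⁅X, Y⁆ = ((⁅X.1, Y.1⁆, loopForm g c X.1 Y.1) : (K ⊗[ℂ] g) × k) := rfl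

theorem lie_smul_base (r : k) (ξ η : K ⊗[ℂ] g) : ⁅ξ, r • η⁆ = r • ⁅ξ, η⁆ := by
  rw [← algebraMap_smul K r η, lie_smul, algebraMap_smul]

instance (c : LoopCocycle k K) : LieAlgebra k (Affine g c) where
  lie_smul r X Y := Prod.ext (lie_smul_base r X.1 Y.1) (map_smul (loopForm g c X.1) r Y.1)

/-- The element `f x` of `(K ⊗ g) ⊕ k C`. -/
def Affine.loop (c : LoopCocycle k K) (f : K) (x : g) : Affine g c :=
  (f ⊗ₜ[ℂ] x, (0 : k))

/-- The central element `C`. -/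
def Affine.central (c : LoopCocycle k K) : Affine g c := ((0 : K ⊗[ℂ] g), (1 : k))


variable {K' : Type} [CommRing K'] [Algebra k K'] [Algebra ℂ K'] [IsScalarTower ℂ k K']

/-- The map `φ ⊗ id : K ⊗ g → K' ⊗ g`. -/
def loopMap (g : Type) [LieRing g] [LieAlgebra ℂ g] (φ : K →ₐ[k] K') :
    K ⊗[ℂ] g →ₗ[k] K' ⊗[ℂ] g :=
  TensorProduct.AlgebraTensorModule.map φ.toLinearMap LinearMap.id

theorem loopMap_tmul (φ : K →ₐ[k] K') (f : K) (x : g) : loopMap g φ (f ⊗ₜ x) = φ f ⊗ₜ x := rfl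

theorem loopMap_lie (φ : K →ₐ[k] K') (ξ η : K ⊗[ℂ] g) :
    loopMap g φ ⁅ξ, η⁆ = ⁅loopMap g φ ξ, loopMap g φ η⁆ := by
  induction ξ using TensorProduct.induction_on with
  | zero => simp
  | add _ _ h₁ h₂ => simp only [map_add, add_lie, h₁, h₂]
  | tmul f x =>
    induction η using TensorProduct.induction_on with
    | zero => simp
    | add _ _ h₁ h₂ => simp only [map_add, lie_add, h₁, h₂]
    | tmul f' y =>
      simp only [LieAlgebra.ExtendScalars.bracket_tmul, loopMap_tmul, map_mul]

theorem loopForm_loopMap (c : LoopCocycle k K) (c' : LoopCocycle k K') (φ : K →ₐ[k] K')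
    (hφ : ∀ f f', c'.form (φ f) (φ f') = c.form f f') (ξ η : K ⊗[ℂ] g) :
    loopForm g c' (loopMap g φ ξ) (loopMap g φ η) = loopForm g c ξ η := by
  induction ξ using TensorProduct.induction_on with
  | zero => simp
  | add _ _ h₁ h₂ => simp only [map_add, LinearMap.add_apply, h₁, h₂]
  | tmul f x =>
    induction η using TensorProduct.induction_on with
    | zero => simp
    | add _ _ h₁ h₂ => simp only [map_add, h₁, h₂]
    | tmul f' y => rw [loopMap_tmul, loopMap_tmul, loopForm_tmul, loopForm_tmul, hφ]

/-- Functoriality of `(K ⊗ g) ⊕ k C`: `f x + p C ↦ φ(f) x + p C`. -/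
def Affine.map (c : LoopCocycle k K) (c' : LoopCocycle k K') (φ : K →ₐ[k] K')
    (hφ : ∀ f f', c'.form (φ f) (φ f') = c.form f f') : Affine g c →ₗ⁅k⁆ Affine g c' where
  toFun X := (loopMap g φ X.1, X.2)
  map_add' X Y := Prod.ext (map_add (loopMap g φ) X.1 Y.1) rfl
  map_smul' r X := Prod.ext (map_smul (loopMap g φ) r X.1) rfl
  map_lie' {X Y} := Prod.ext (loopMap_lie φ X.1 Y.1) (loopForm_loopMap c c' φ hφ X.1 Y.1).symm

end Affine

section Disc
variable {k : Type} [CommRing k] [Algebra ℂ k]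

/-- The cocycle `(f, g) ↦ Res (g df)`. -/
def resCocycle (q : k[X]) (hq : q.Monic) : LoopCocycle k (Punctured q) where
  form := residuePairing q hq
  skew := residuePairing_skew q hq
  cocycle := residuePairing_cocycle q hq

/-- On `k[t]` the residue cocycle vanishes. -/
def zeroCocycle (k : Type) [CommRing k] : LoopCocycle k k[X] where
  form := 0
  skew := by simp
  cocycle := by simp

/-- The affine Lie algebra `k[t][1/q] ⊗ g ⊕ k C` with bracket
`[f x, f' y] = f f' [x, y] + κ(x, y) Res (f' df) C`. -/
abbrev Hat (g : Type) [LieRing g] [LieAlgebra ℂ g] (q : k[X]) (hq : q.Monic) : Type :=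
  Affine g (resCocycle q hq)

/-- The Lie algebra `k[t] ⊗ g ⊕ k C`. -/
abbrev HatPlus (g : Type) [LieRing g] [LieAlgebra ℂ g] (k : Type) [CommRing k] [Algebra ℂ k] : Type :=
  Affine g (zeroCocycle k)

variable (g : Type) [LieRing g] [LieAlgebra ℂ g] (q : k[X]) (hq : q.Monic)

theorem loopForm_zeroCocycle {g : Type} [LieRing g] [LieAlgebra ℂ g] (ξ η : k[X] ⊗[ℂ] g) :
    loopForm g (zeroCocycle k) ξ η = 0 := by
  induction ξ using TensorProduct.induction_on with
  | zero => simp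
  | add _ _ h₁ h₂ => simp only [map_add, LinearMap.add_apply, h₁, h₂, add_zero]
  | tmul f x =>
    induction η using TensorProduct.induction_on with
    | zero => simp
    | add _ _ h₁ h₂ => simp only [map_add, h₁, h₂, add_zero]
    | tmul f' y => exact smul_zero _

/-- The inclusion of `k[t] ⊗ g ⊕ k C` in `k[t][1/q] ⊗ g ⊕ k C`. -/
def plusIncl : HatPlus g k →ₗ⁅k⁆ Hat g q hq :=
  Affine.map (g := g) (zeroCocycle k) (resCocycle q hq) (IsScalarTower.toAlgHom k k[X] (Punctured q))
    (residuePairing_polynomial q hq)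

end Disc

section Evaluation
variable {k K : Type} [CommRing k] [CommRing K] [Algebra k K] [Algebra ℂ k] [Algebra ℂ K]
  [IsScalarTower ℂ k K] {g : Type} [LieRing g] [LieAlgebra ℂ g]
  {M : Type} [AddCommGroup M] [Module k M] [Module ℂ M] [IsScalarTower ℂ k M]

/-- `f x ↦ ε(f) π(x)`. -/
def evalMap (ε : K →ₐ[k] k) (π : g →ₗ[ℂ] Module.End k M) : K ⊗[ℂ] g →ₗ[k] Module.End k M :=
  TensorProduct.AlgebraTensorModule.lift
    { toFun := fun f => ε f • π
      map_add' := fun f f' => by rw [map_add, add_smul]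
      map_smul' := fun c f => by rw [map_smul, smul_eq_mul, mul_smul]; rfl }

theorem evalMap_tmul (ε : K →ₐ[k] k) (π : g →ₗ[ℂ] Module.End k M) (f : K) (x : g) :
    evalMap ε π (f ⊗ₜ x) = ε f • π x := rfl

theorem evalMap_lie (ε : K →ₐ[k] k) (π : g →ₗ⁅ℂ⁆ Module.End k M) (ξ η : K ⊗[ℂ] g) :
    evalMap ε (π : g →ₗ[ℂ] Module.End k M) ⁅ξ, η⁆ =
      ⁅evalMap ε (π : g →ₗ[ℂ] Module.End k M) ξ, evalMap ε (π : g →ₗ[ℂ] Module.End k M) η⁆ := by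
  induction ξ using TensorProduct.induction_on with
  | zero => simp
  | add _ _ h₁ h₂ => simp only [map_add, add_lie, h₁, h₂]
  | tmul f x =>
    induction η using TensorProduct.induction_on with
    | zero => simp
    | add _ _ h₁ h₂ => simp only [map_add, lie_add, h₁, h₂]
    | tmul f' y =>
      simp only [LieAlgebra.ExtendScalars.bracket_tmul, evalMap_tmul, map_mul, LieHom.coe_toLinearMap,
        LieHom.map_lie, smul_lie, lie_smul, smul_smul, mul_comm]

theorem evalMap_commute (ε₁ ε₂ : K →ₐ[k] k) (π₁ π₂ : g →ₗ[ℂ] Module.End k M)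
    (h : ∀ x y, ⁅π₁ x, π₂ y⁆ = 0) (ξ η : K ⊗[ℂ] g) : ⁅evalMap ε₁ π₁ ξ, evalMap ε₂ π₂ η⁆ = 0 := by
  induction ξ using TensorProduct.induction_on with
  | zero => simp
  | add _ _ h₁ h₂ => simp only [map_add, add_lie, h₁, h₂, add_zero]
  | tmul f x =>
    induction η using TensorProduct.induction_on with
    | zero => simp
    | add _ _ h₁ h₂ => simp only [map_add, lie_add, h₁, h₂, add_zero]
    | tmul f' y => simp only [evalMap_tmul, smul_lie, lie_smul, h, smul_zero]

end Evaluation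

section Rep
variable {k : Type} [CommRing k] [Algebra ℂ k] {g : Type} [LieRing g] [LieAlgebra ℂ g]
  {M : Type} [AddCommGroup M] [Module k M] [Module ℂ M] [IsScalarTower ℂ k M]

theorem lie_add_scalar (X Y : Module.End k M) (r s : k) (z : ℂ) :
    ⁅X + r • (z • (1 : Module.End k M)), Y + s • (z • (1 : Module.End k M))⁆ = ⁅X, Y⁆ := by
  have h (T : Module.End k M) (r : k) : ⁅T, r • (z • (1 : Module.End k M))⁆ = 0 := by
    rw [LieRing.of_associative_ring_bracket, sub_eq_zero]
    simp
  have h' (T : Module.End k M) (r : k) : ⁅r • (z • (1 : Module.End k M)), T⁆ = 0 := by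
    rw [← lie_skew, h, neg_zero]
  rw [add_lie, lie_add, lie_add, h, h', h', add_zero, add_zero, add_zero]

/-- The representation of `k[t] ⊗ g ⊕ k C` in which `f x` acts as `f(p) π(x)` and `C` acts as `-1/2`. -/
def onePointRep (p : k) (π : g →ₗ⁅ℂ⁆ Module.End k M) : HatPlus g k →ₗ⁅k⁆ Module.End k M where
  toFun X := evalMap (Polynomial.aeval p) (π : g →ₗ[ℂ] Module.End k M) X.1 +
    X.2 • ((-1 / 2 : ℂ) • (1 : Module.End k M))
  map_add' X Y := by
    change evalMap _ _ (X.1 + Y.1) + (X.2 + Y.2) • _ = _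
    rw [map_add, add_smul]; abel
  map_smul' r X := by
    change evalMap _ _ (r • X.1) + (r • X.2) • _ = _
    rw [map_smul, smul_assoc, smul_add]; rfl
  map_lie' {X Y} := by
    have h0 : loopForm g (zeroCocycle k) X.1 Y.1 = 0 := loopForm_zeroCocycle X.1 Y.1
    change evalMap _ _ ⁅X.1, Y.1⁆ + loopForm g (zeroCocycle k) X.1 Y.1 • _ = _
    rw [h0, zero_smul, add_zero, evalMap_lie, lie_add_scalar]

/-- The representation of `k[t] ⊗ g ⊕ k C` in which `f x` acts as `f(p₁) π₁(x) + f(p₂) π₂(x)` and `C` acts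
as `-1/2`, for two commuting representations `π₁`, `π₂` of `g`. -/
def twoPointRep (p₁ p₂ : k) (π₁ π₂ : g →ₗ⁅ℂ⁆ Module.End k M) (h : ∀ x y, ⁅π₁ x, π₂ y⁆ = 0) :
    HatPlus g k →ₗ⁅k⁆ Module.End k M where
  toFun X := (evalMap (Polynomial.aeval p₁) (π₁ : g →ₗ[ℂ] Module.End k M) X.1 +
    evalMap (Polynomial.aeval p₂) (π₂ : g →ₗ[ℂ] Module.End k M) X.1) +
    X.2 • ((-1 / 2 : ℂ) • (1 : Module.End k M))
  map_add' X Y := by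
    change evalMap _ _ (X.1 + Y.1) + evalMap _ _ (X.1 + Y.1) + (X.2 + Y.2) • _ = _
    rw [map_add, map_add, add_smul]; abel
  map_smul' r X := by
    change evalMap _ _ (r • X.1) + evalMap _ _ (r • X.1) + (r • X.2) • _ = _
    rw [map_smul, map_smul, smul_assoc, smul_add, smul_add]; rfl
  map_lie' {X Y} := by
    have h0 : loopForm g (zeroCocycle k) X.1 Y.1 = 0 := loopForm_zeroCocycle X.1 Y.1
    have h' : ∀ x y, ⁅π₂ x, π₁ y⁆ = 0 := fun x y => by rw [← lie_skew, h, neg_zero]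
    change evalMap _ _ ⁅X.1, Y.1⁆ + evalMap _ _ ⁅X.1, Y.1⁆ +
      loopForm g (zeroCocycle k) X.1 Y.1 • _ = _
    rw [h0, zero_smul, add_zero, evalMap_lie, evalMap_lie, lie_add_scalar, add_lie, lie_add,
      lie_add, evalMap_commute _ _ _ _ h, evalMap_commute _ _ _ _ h', add_zero, zero_add]

end Rep

section Sl2

/-- The Lie algebra `sl(2, ℂ)`. -/
abbrev sl2 : Type := LieAlgebra.SpecialLinear.sl (Fin 2) ℂ

/-- The standard positive root vector `e` of `sl(2)`. -/
def sl2e : sl2 := ⟨!![0, 1; 0, 0], by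
  change Matrix.trace !![(0 : ℂ), 1; 0, 0] = 0
  simp [Matrix.trace_fin_two]⟩

/-- The action of a `2 × 2` matrix on `ℂ[X₀, X₁]` by the derivation which is the standard action on the linear
forms `X₀`, `X₁`. -/
def polyAct (x : Matrix (Fin 2) (Fin 2) ℂ) :
    Derivation ℂ (MvPolynomial (Fin 2) ℂ) (MvPolynomial (Fin 2) ℂ) :=
  MvPolynomial.mkDerivation ℂ fun j => ∑ i, x i j • MvPolynomial.X i

theorem polyAct_X (x : Matrix (Fin 2) (Fin 2) ℂ) (j : Fin 2) :
    polyAct x (MvPolynomial.X j) = ∑ i, x i j • MvPolynomial.X i :=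
  MvPolynomial.mkDerivation_X _ _ _

theorem polyAct_add (x y : Matrix (Fin 2) (Fin 2) ℂ) : polyAct (x + y) = polyAct x + polyAct y := by
  refine MvPolynomial.derivation_ext fun j => ?_
  simp [polyAct_X, add_smul]
  ring

theorem polyAct_smul (c : ℂ) (x : Matrix (Fin 2) (Fin 2) ℂ) : polyAct (c • x) = c • polyAct x := by
  refine MvPolynomial.derivation_ext fun j => ?_
  simp [polyAct_X, mul_smul]

theorem polyAct_lie (x y : Matrix (Fin 2) (Fin 2) ℂ) :
    polyAct (x * y - y * x) = ⁅polyAct x, polyAct y⁆ := by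
  refine MvPolynomial.derivation_ext fun j => ?_
  rw [Derivation.commutator_apply]
  simp only [polyAct_X, Fin.sum_univ_two, map_add, Derivation.map_smul, Matrix.sub_apply,
    Matrix.mul_apply]
  module

theorem polyAct_mem (x : Matrix (Fin 2) (Fin 2) ℂ) (n : ℕ) (p : MvPolynomial (Fin 2) ℂ)
    (hp : p ∈ MvPolynomial.homogeneousSubmodule (Fin 2) ℂ n) :
    polyAct x p ∈ MvPolynomial.homogeneousSubmodule (Fin 2) ℂ n := by
  have h : polyAct x p = ∑ j, ∑ i, x i j • (MvPolynomial.X i * MvPolynomial.pderiv j p) := by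
    have : polyAct x = ∑ j, ∑ i, (x i j • (MvPolynomial.X i : MvPolynomial (Fin 2) ℂ)) •
        MvPolynomial.pderiv (R := ℂ) j := by
      refine MvPolynomial.derivation_ext fun j => ?_
      fin_cases j <;> simp [polyAct_X, MvPolynomial.pderiv_X, Fin.sum_univ_two]
    rw [this]
    simp [Fin.sum_univ_two]
  rw [h]
  refine Submodule.sum_mem _ fun j _ => Submodule.sum_mem _ fun i _ => Submodule.smul_mem _ _ ?_
  rw [MvPolynomial.mem_homogeneousSubmodule] at hp ⊢
  rcases n with _ | n
  · rw [MvPolynomial.totalDegree_eq_zero_iff_eq_C.mp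
      (Nat.le_zero.mp (MvPolynomial.IsHomogeneous.totalDegree_le hp))]
    simpa using MvPolynomial.isHomogeneous_zero _ _ _
  · have := (MvPolynomial.isHomogeneous_X ℂ i).mul (hp.pderiv (i := j))
    simpa [add_comm] using this

/-- The irreducible representation `Vⁿ` of `sl(2)` of highest weight `n`: binary forms of degree `n`, i.e. the `n`-th
symmetric power of the standard representation. -/
def Vrep (n : ℕ) : Type := MvPolynomial.homogeneousSubmodule (Fin 2) ℂ n

instance (n : ℕ) : AddCommGroup (Vrep n) :=
  inferInstanceAs (AddCommGroup (MvPolynomial.homogeneousSubmodule (Fin 2) ℂ n))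

instance (n : ℕ) : Module ℂ (Vrep n) :=
  inferInstanceAs (Module ℂ (MvPolynomial.homogeneousSubmodule (Fin 2) ℂ n))

instance (n : ℕ) : LieRingModule sl2 (Vrep n) where
  bracket x p := ⟨polyAct x.1 p.1, polyAct_mem x.1 n p.1 p.2⟩
  add_lie x y p := Subtype.ext (by
    change polyAct (x.1 + y.1) p.1 = polyAct x.1 p.1 + polyAct y.1 p.1
    rw [polyAct_add]; rfl)
  lie_add x p r := Subtype.ext (map_add (polyAct x.1) p.1 r.1)
  leibniz_lie x y p := Subtype.ext (by
    change polyAct x.1 (polyAct y.1 p.1) =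
      polyAct (x.1 * y.1 - y.1 * x.1) p.1 + polyAct y.1 (polyAct x.1 p.1)
    rw [polyAct_lie, Derivation.commutator_apply]; abel)

instance (n : ℕ) : LieModule ℂ sl2 (Vrep n) where
  smul_lie c x p := Subtype.ext (by
    change polyAct (c • x.1) p.1 = c • polyAct x.1 p.1
    rw [polyAct_smul]; rfl)
  lie_smul c x p := Subtype.ext ((polyAct x.1).map_smul c p.1)

/-- The highest weight vector `X₀ⁿ` of `Vⁿ`. -/
def hwVec (n : ℕ) : Vrep n := ⟨MvPolynomial.X 0 ^ n, by
  simpa using (MvPolynomial.isHomogeneous_X ℂ (0 : Fin 2)).pow n⟩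

end Sl2

section Tensor
variable (k : Type) [CommRing k] [Algebra ℂ k] (g : Type) [LieRing g] [LieAlgebra ℂ g]
  (V W : Type) [AddCommGroup V] [Module ℂ V] [LieRingModule g V] [LieModule ℂ g V]
  [AddCommGroup W] [Module ℂ W] [LieRingModule g W] [LieModule ℂ g W]

/-- The action `p ⊗ v ⊗ w ↦ p ⊗ x v ⊗ w` of `g` on `k ⊗ V ⊗ W`. -/
def actFst : g →ₗ⁅ℂ⁆ Module.End k (k ⊗[ℂ] (V ⊗[ℂ] W)) where
  toFun x := ((LieModule.toEnd ℂ g V x).rTensor W).baseChange k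
  map_add' x y := by rw [map_add, LinearMap.rTensor_add, LinearMap.baseChange_add]
  map_smul' c x := by
    rw [map_smul, LinearMap.rTensor_smul, LinearMap.baseChange_smul]; rfl
  map_lie' {x y} := by
    rw [LieHom.map_lie]
    refine TensorProduct.AlgebraTensorModule.ext fun c v => ?_
    induction v using TensorProduct.induction_on with
    | zero => simp
    | add _ _ h₁ h₂ => rw [TensorProduct.tmul_add, map_add, map_add, h₁, h₂]
    | tmul v w =>
      simp [LieRing.of_associative_ring_bracket]

/-- The action `p ⊗ v ⊗ w ↦ p ⊗ v ⊗ x w` of `g` on `k ⊗ V ⊗ W`. -/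
def actSnd : g →ₗ⁅ℂ⁆ Module.End k (k ⊗[ℂ] (V ⊗[ℂ] W)) where
  toFun x := ((LieModule.toEnd ℂ g W x).lTensor V).baseChange k
  map_add' x y := by rw [map_add, LinearMap.lTensor_add, LinearMap.baseChange_add]
  map_smul' c x := by
    rw [map_smul, LinearMap.lTensor_smul, LinearMap.baseChange_smul]; rfl
  map_lie' {x y} := by
    rw [LieHom.map_lie]
    refine TensorProduct.AlgebraTensorModule.ext fun c v => ?_
    induction v using TensorProduct.induction_on with
    | zero => simp
    | add _ _ h₁ h₂ => rw [TensorProduct.tmul_add, map_add, map_add, h₁, h₂]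
    | tmul v w =>
      simp [LieRing.of_associative_ring_bracket]

theorem actFst_actSnd (x y : g) : ⁅actFst k g V W x, actSnd k g V W y⁆ = 0 := by
  refine TensorProduct.AlgebraTensorModule.ext fun c v => ?_
  induction v using TensorProduct.induction_on with
  | zero => simp
  | add _ _ h₁ h₂ => rw [TensorProduct.tmul_add, map_add, map_add, h₁, h₂]
  | tmul v w => simp [actFst, actSnd, LieRing.of_associative_ring_bracket]

end Tensor

section Induction
variable {k L L' M : Type} [CommRing k] [LieRing L] [LieAlgebra k L] [LieRing L'] [LieAlgebra k L']
  [AddCommGroup M] [Module k M]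

/-- The relations `u y ⊗ v = u ⊗ y v` (`u ∈ U(L)`, `y ∈ L'`, `v ∈ M`). -/
def indRel (j : L' →ₗ⁅k⁆ L) (ρ : L' →ₗ⁅k⁆ Module.End k M) :
    Submodule (UniversalEnvelopingAlgebra k L) (UniversalEnvelopingAlgebra k L ⊗[k] M) :=
  Submodule.span _ {z | ∃ (u : UniversalEnvelopingAlgebra k L) (y : L') (v : M),
    z = (u * UniversalEnvelopingAlgebra.ι k (j y)) ⊗ₜ[k] v - u ⊗ₜ[k] ρ y v}

/-- The induced module `U(L) ⊗_{U(L')} M` along `j : L' → L`, as the quotient of `U(L) ⊗_k M` by the relations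
`u y ⊗ v = u ⊗ y v`. -/
def Ind (j : L' →ₗ⁅k⁆ L) (ρ : L' →ₗ⁅k⁆ Module.End k M) : Type :=
  (UniversalEnvelopingAlgebra k L ⊗[k] M) ⧸ indRel j ρ

instance (j : L' →ₗ⁅k⁆ L) (ρ : L' →ₗ⁅k⁆ Module.End k M) : AddCommGroup (Ind j ρ) :=
  inferInstanceAs (AddCommGroup ((UniversalEnvelopingAlgebra k L ⊗[k] M) ⧸ indRel j ρ))

instance (j : L' →ₗ⁅k⁆ L) (ρ : L' →ₗ⁅k⁆ Module.End k M) :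
    Module (UniversalEnvelopingAlgebra k L) (Ind j ρ) :=
  inferInstanceAs (Module _ ((UniversalEnvelopingAlgebra k L ⊗[k] M) ⧸ indRel j ρ))

instance (j : L' →ₗ⁅k⁆ L) (ρ : L' →ₗ⁅k⁆ Module.End k M) : Module k (Ind j ρ) :=
  inferInstanceAs (Module k ((UniversalEnvelopingAlgebra k L ⊗[k] M) ⧸ indRel j ρ))

instance (j : L' →ₗ⁅k⁆ L) (ρ : L' →ₗ⁅k⁆ Module.End k M) :
    IsScalarTower k (UniversalEnvelopingAlgebra k L) (Ind j ρ) :=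
  inferInstanceAs (IsScalarTower k _ ((UniversalEnvelopingAlgebra k L ⊗[k] M) ⧸ indRel j ρ))

/-- The class of `1 ⊗ v`. -/
def indMk (j : L' →ₗ⁅k⁆ L) (ρ : L' →ₗ⁅k⁆ Module.End k M) (v : M) : Ind j ρ :=
  Submodule.Quotient.mk (1 ⊗ₜ[k] v)

end Induction

section Completion
variable {k : Type} [CommRing k] [Algebra ℂ k] (g : Type) [LieRing g] [LieAlgebra ℂ g]
  (q : k[X]) (hq : q.Monic)

/-- The universal enveloping algebra (over `k`) of the affine Lie algebra `k[t][1/q] ⊗ g ⊕ k C`. -/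
abbrev U : Type := UniversalEnvelopingAlgebra k (Hat g q hq)

/-- The left ideal of the enveloping algebra generated by `C + 1/2` and `qⁿ k[t] ⊗ g`. -/
def critIdeal (n : ℕ) : Submodule (U g q hq) (U g q hq) :=
  Submodule.span (U g q hq)
    ({UniversalEnvelopingAlgebra.ι k (Affine.central (g := g) (resCocycle q hq)) +
        algebraMap k (U g q hq) (algebraMap ℂ k (1 / 2))} ∪
      {z | ∃ (f : k[X]) (x : g), z = UniversalEnvelopingAlgebra.ι k
        (Affine.loop (resCocycle q hq) (algebraMap k[X] (Punctured q) (q ^ n * f)) x)})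

theorem critIdeal_antitone : Antitone (critIdeal g q hq) := by
  intro m n hmn
  refine Submodule.span_mono (Set.union_subset_union_right _ ?_)
  rintro _ ⟨f, x, rfl⟩
  refine ⟨q ^ (n - m) * f, x, ?_⟩
  rw [← mul_assoc, ← pow_add, Nat.add_sub_cancel' hmn]

/-- The completed enveloping algebra at the critical level, `lim_n U / (C = -1/2, qⁿ k[t] ⊗ g)_{left ideal}`:
compatible sequences `(x_n)`. For `q = t` this is `Û₁` and for `q = ts` it is `Û₂`. -/
def UHat : Type :=
  {x : ∀ n, U g q hq ⧸ critIdeal g q hq n //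
    ∀ m n (h : m ≤ n), Submodule.factor (critIdeal_antitone g q hq h) (x n) = x m}

variable {g q hq} {N : Type} [AddCommGroup N] [Module (U g q hq) N]

open Classical in
/-- The action of the completed enveloping algebra on a module: if `v` is killed by the `n`-th left ideal then
`x = (x_n)` acts on `v` as any representative of `x_n` (this does not depend on `n`). On the modules considered
below every vector is killed by one of these ideals; on other vectors the value is the irrelevant `0`. -/
def UHat.act (x : UHat g q hq) (v : N) : N :=
  if h : ∃ n, critIdeal g q hq n ≤ LinearMap.ker (LinearMap.toSpanSingleton (U g q hq) N v) then
    (critIdeal g q hq h.choose).liftQ (LinearMap.toSpanSingleton (U g q hq) N v) h.choose_spec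
      (x.1 h.choose)
  else 0

/-- The submodule over the completed enveloping algebra generated by `S`: the smallest submodule containing `S` that
is stable under the action of the completed algebra. -/
def hatSpan (S : Set N) : Submodule (U g q hq) N :=
  sInf {P | S ⊆ P ∧ ∀ (x : UHat g q hq), ∀ v ∈ P, x.act v ∈ P}

end Completion

section TwoSingularities

/-- `A = ℂ[[a]]`. -/
abbrev A : Type := PowerSeries ℂ

/-- The variable `a = t - s` of `A`. -/
def a : A := PowerSeries.X

/-- The polynomial `t s = t (t - a)`. -/
def ts : A[X] := Polynomial.X * (Polynomial.X - Polynomial.C a)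

theorem ts_monic : ts.Monic := Polynomial.monic_X.mul (Polynomial.monic_X_sub_C a)

/-- `ĝ₁ = ℂ[t, t⁻¹] ⊗ sl(2) ⊕ ℂ C₁`. -/
abbrev g₁ : Type := Hat sl2 (Polynomial.X : ℂ[X]) Polynomial.monic_X
/-- `ĝ₂ = A[t, s][1/ts] ⊗ sl(2) ⊕ A C₂`, a Lie algebra over `A`. -/
abbrev g₂ : Type := Hat sl2 ts ts_monic
abbrev U₁ : Type := U sl2 (Polynomial.X : ℂ[X]) Polynomial.monic_X
abbrev U₂ : Type := U sl2 ts ts_monic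
abbrev UHat₁ : Type := UHat sl2 (Polynomial.X : ℂ[X]) Polynomial.monic_X
abbrev UHat₂ : Type := UHat sl2 ts ts_monic

/-- The `ĝ₁`-module induced from the `sl(2)`-module `V`, on which `f(t) x` acts as `f(0) x` and `C₁` as `-1/2`. -/
abbrev Weyl₁Of (V : Type) [AddCommGroup V] [Module ℂ V] [LieRingModule sl2 V] [LieModule ℂ sl2 V] :
    Type :=
  Ind (plusIncl sl2 (Polynomial.X : ℂ[X]) Polynomial.monic_X)
    (onePointRep (0 : ℂ) (LieModule.toEnd ℂ sl2 V))

/-- The Weyl module `𝕍₁ⁿ`. -/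
abbrev Weyl₁ (n : ℕ) : Type := Weyl₁Of (Vrep n)

/-- The module `𝕎₁^{l,m}`, induced from `V^l ⊗ V^m`. -/
abbrev W₁ (l m : ℕ) : Type := Weyl₁Of (Vrep l ⊗[ℂ] Vrep m)

/-- The Weyl module `𝕍₂^{l,m}` with two singularities, induced from `A ⊗ V^l ⊗ V^m`, on which `f(t,s) x` acts as
`f(0,-a) (x ⊗ id) + f(a,0) (id ⊗ x)` and `C₂` as `-1/2`. (A polynomial in `t` and `s = t - a` is a polynomial in
`t`, evaluated at `t = 0` and at `t = a`.) -/
abbrev Weyl₂ (l m : ℕ) : Type :=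
  Ind (plusIncl sl2 ts ts_monic)
    (twoPointRep (0 : A) a (actFst A sl2 (Vrep l) (Vrep m)) (actSnd A sl2 (Vrep l) (Vrep m))
      (actFst_actSnd A sl2 (Vrep l) (Vrep m)))

variable (l m : ℕ)

/-- The element `1 ⊗ w` of `A ⊗ V^l ⊗ V^m ⊂ 𝕍₂^{l,m}`. -/
def vec (w : Vrep l ⊗[ℂ] Vrep m) : Weyl₂ l m := indMk _ _ ((1 : A) ⊗ₜ[ℂ] w)

/-- The `Û₂`-submodule `Ṽ` of `𝕍₂^{l,m}` generated by the highest weight vector `1 ⊗ v_l ⊗ v_m`. -/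
def tWeyl : Submodule U₂ (Weyl₂ l m) := hatSpan {vec l m (hwVec l ⊗ₜ hwVec m)}

/-- The submodule `a Ṽ`. -/
def atWeyl : Submodule U₂ (Weyl₂ l m) := a • tWeyl l m

/-- The decreasing filtration `𝓕_i = Ṽ ∩ aⁱ 𝕍₂^{l,m}`. -/
def fil (i : ℕ) : Submodule U₂ (Weyl₂ l m) := tWeyl l m ⊓ a ^ i • ⊤

end TwoSingularities

section Specialisation

/-- Specialisation `a = 0` on polynomials in `t`. -/
def spPoly : A[X] →+* ℂ[X] := Polynomial.mapRingHom (PowerSeries.constantCoeff (R := ℂ))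

theorem spPoly_ts : spPoly ts = Polynomial.X * Polynomial.X := by
  simp [spPoly, ts, a]

/-- The specialisation `Sp : A[t,s][1/ts] → ℂ[t, t⁻¹]`, `a ↦ 0`, `t, s ↦ t`. -/
def spK : Punctured ts →+* Punctured (Polynomial.X : ℂ[X]) :=
  IsLocalization.Away.lift ts
    (g := (algebraMap ℂ[X] (Punctured (Polynomial.X : ℂ[X]))).comp spPoly) (by
      rw [RingHom.comp_apply, spPoly_ts, map_mul]
      have := IsLocalization.Away.algebraMap_isUnit (S := Punctured (Polynomial.X : ℂ[X]))
        (Polynomial.X : ℂ[X])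
      exact this.mul this)

theorem spK_poly (p : A[X]) :
    spK (algebraMap A[X] (Punctured ts) p) = algebraMap ℂ[X] _ (spPoly p) :=
  IsLocalization.Away.lift_eq ts _ p

theorem spK_smul (p : A) (f : Punctured ts) :
    spK (p • f) = PowerSeries.constantCoeff p • spK f := by
  rw [Algebra.smul_def, map_mul, IsScalarTower.algebraMap_apply A A[X] (Punctured ts), spK_poly,
    Algebra.smul_def, IsScalarTower.algebraMap_apply ℂ ℂ[X] (Punctured (Polynomial.X : ℂ[X]))]
  simp [spPoly]

/-- The specialisation as a linear map. -/
def spKLinear : Punctured ts →ₗ[ℂ] Punctured (Polynomial.X : ℂ[X]) where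
  toFun := spK
  map_add' := map_add spK
  map_smul' c f := by
    rw [← algebraMap_smul A c f, spK_smul]
    simp

/-- Specialisation `a = 0` of the coefficients of a Laurent series. -/
def spLaurent : LaurentSeries A →+* LaurentSeries ℂ where
  toFun F := F.map (PowerSeries.constantCoeff (R := ℂ))
  map_one' := by ext n; by_cases h : n = 0 <;> simp [HahnSeries.coeff_one, h]
  map_mul' F G := HahnSeries.map_mul (PowerSeries.constantCoeff (R := ℂ) : A →ₙ+* ℂ)
  map_zero' := by ext n; simp
  map_add' F G := by ext n; simp

theorem spLaurent_coeff (F : LaurentSeries A) (n : ℤ) :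
    (spLaurent F).coeff n = PowerSeries.constantCoeff (F.coeff n) := rfl

theorem spLaurent_ddt (F : LaurentSeries A) : spLaurent (ddt F) = ddt (spLaurent F) := by
  ext n
  simp [spLaurent_coeff, ddt_coeff]

theorem spLaurent_expand (f : Punctured ts) :
    spLaurent (expandInfty ts ts_monic f) = expandInfty _ Polynomial.monic_X (spK f) := by
  have h : spLaurent.comp (expandInfty ts ts_monic) =
      (expandInfty _ Polynomial.monic_X).comp spK := by
    refine IsLocalization.ringHom_ext (Submonoid.powers ts) (RingHom.ext fun p => ?_)
    simp only [RingHom.comp_apply]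
    rw [expandInfty_poly, spK_poly, expandInfty_poly]
    induction p using Polynomial.induction_on' with
    | add p r hp hr => simp [hp, hr]
    | monomial n c =>
      rw [← Polynomial.C_mul_X_pow_eq_monomial, polyInfty_C_mul_X_pow]
      have : spPoly (Polynomial.C c * Polynomial.X ^ n) =
        Polynomial.C (PowerSeries.constantCoeff c) * Polynomial.X ^ n := by simp [spPoly]
      rw [this, polyInfty_C_mul_X_pow]
      exact HahnSeries.map_single (PowerSeries.constantCoeff (R := ℂ)).toZeroHom
  exact RingHom.congr_fun h f

theorem spK_pairing (f f' : Punctured ts) :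
    residuePairing _ Polynomial.monic_X (spK f) (spK f') =
      PowerSeries.constantCoeff (residuePairing ts ts_monic f f') := by
  rw [residuePairing_apply, residuePairing_apply, ← spLaurent_expand, ← spLaurent_expand,
    ← spLaurent_ddt, ← map_mul, spLaurent_coeff]

/-- The map `Sp ⊗ id`. -/
def spLoop : Punctured ts ⊗[ℂ] sl2 →ₗ[ℂ] Punctured (Polynomial.X : ℂ[X]) ⊗[ℂ] sl2 :=
  TensorProduct.map spKLinear LinearMap.id

theorem spLoop_smul (p : A) (ξ : Punctured ts ⊗[ℂ] sl2) :
    spLoop (p • ξ) = PowerSeries.constantCoeff p • spLoop ξ := by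
  induction ξ using TensorProduct.induction_on with
  | zero => simp
  | add _ _ h₁ h₂ => rw [smul_add, map_add, map_add, smul_add, h₁, h₂]
  | tmul f x =>
    change spK (p • f) ⊗ₜ[ℂ] x = _
    rw [spK_smul]; rfl

theorem lie_congr_aux {K K' : Type} [CommRing K] [CommRing K'] [Algebra ℂ K] [Algebra ℂ K']
    {g : Type} [LieRing g] [LieAlgebra ℂ g] (φ : K →ₗ[ℂ] K') (hφ : ∀ f f', φ (f * f') = φ f * φ f')
    (ξ η : K ⊗[ℂ] g) :
    TensorProduct.map φ LinearMap.id ⁅ξ, η⁆ =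
      ⁅TensorProduct.map φ LinearMap.id ξ, TensorProduct.map φ LinearMap.id η⁆ := by
  induction ξ using TensorProduct.induction_on with
  | zero => simp
  | add _ _ h₁ h₂ => simp only [map_add, add_lie, h₁, h₂]
  | tmul f x =>
    induction η using TensorProduct.induction_on with
    | zero => simp
    | add _ _ h₁ h₂ => simp only [map_add, lie_add, h₁, h₂]
    | tmul f' y => simp [hφ]

theorem spLoop_lie (ξ η : Punctured ts ⊗[ℂ] sl2) : spLoop ⁅ξ, η⁆ = ⁅spLoop ξ, spLoop η⁆ :=
  lie_congr_aux spKLinear (map_mul spK) ξ η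

theorem spLoop_form (ξ η : Punctured ts ⊗[ℂ] sl2) :
    loopForm sl2 (resCocycle _ Polynomial.monic_X) (spLoop ξ) (spLoop η) =
      PowerSeries.constantCoeff (loopForm sl2 (resCocycle ts ts_monic) ξ η) := by
  induction ξ using TensorProduct.induction_on with
  | zero => simp
  | add _ _ h₁ h₂ => simp only [map_add, LinearMap.add_apply, h₁, h₂]
  | tmul f x =>
    induction η using TensorProduct.induction_on with
    | zero => simp
    | add _ _ h₁ h₂ => simp only [map_add, h₁, h₂]
    | tmul f' y =>
      change killingForm ℂ sl2 x y • residuePairing _ _ (spK f) (spK f') =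
        PowerSeries.constantCoeff (killingForm ℂ sl2 x y • residuePairing ts ts_monic f f')
      rw [spK_pairing]; simp

/-- The specialisation `Sp : ĝ₂ → ĝ₁`, `f x + p(a) C₂ ↦ Sp(f) x + p(0) C₁`. -/
def spLie (X : g₂) : g₁ := (spLoop X.1, PowerSeries.constantCoeff X.2)

theorem spLie_lie (X Y : g₂) : spLie ⁅X, Y⁆ = ⁅spLie X, spLie Y⁆ :=
  Prod.ext (spLoop_lie X.1 Y.1) (spLoop_form X.1 Y.1).symm

/-- The ring homomorphism `Sp : U(ĝ₂) → U(ĝ₁)` induced by the specialisation of Lie algebras. -/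
def spU : U₂ →+* U₁ :=
  let _ : Algebra A U₁ :=
    ((algebraMap ℂ U₁).comp (PowerSeries.constantCoeff (R := ℂ))).toAlgebra'
      fun c x => Algebra.commutes (PowerSeries.constantCoeff c) x
  (UniversalEnvelopingAlgebra.lift A
    { toFun := fun X : g₂ => UniversalEnvelopingAlgebra.ι ℂ (spLie X)
      map_add' := fun X Y => by
        rw [← map_add]
        exact congrArg _ (Prod.ext (map_add spLoop X.1 Y.1) (map_add _ X.2 Y.2))
      map_smul' := fun p X => by
        have h : spLie (p • X) = PowerSeries.constantCoeff p • spLie X :=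
          Prod.ext (spLoop_smul p X.1) (map_mul _ p X.2)
        rw [h, map_smul, Algebra.smul_def]; rfl
      map_lie' := fun {X Y} => by rw [spLie_lie, LieHom.map_lie] } :
    U₂ →ₐ[A] U₁).toRingHom

theorem spU_ι (X : g₂) :
    spU (UniversalEnvelopingAlgebra.ι A X) = UniversalEnvelopingAlgebra.ι ℂ (spLie X) := by
  let _ : Algebra A U₁ :=
    ((algebraMap ℂ U₁).comp (PowerSeries.constantCoeff (R := ℂ))).toAlgebra'
      fun c x => Algebra.commutes (PowerSeries.constantCoeff c) x
  exact UniversalEnvelopingAlgebra.lift_ι_apply A _ X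

theorem spU_algebraMap (p : A) :
    spU (algebraMap A U₂ p) = algebraMap ℂ U₁ (PowerSeries.constantCoeff p) := by
  let _ : Algebra A U₁ :=
    ((algebraMap ℂ U₁).comp (PowerSeries.constantCoeff (R := ℂ))).toAlgebra'
      fun c x => Algebra.commutes (PowerSeries.constantCoeff c) x
  exact AlgHom.commutes _ p

end Specialisation

section Statement

variable (l m : ℕ)

/-- The increasing filtration `F^i = U(g) · (ℂ id ⊗ id + id ⊗ g)^i · (v_l ⊗ v_m)` of `V^l ⊗ V^m`. -/
def tensorFil (i : ℕ) : LieSubmodule ℂ sl2 (Vrep l ⊗[ℂ] Vrep m) :=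
  LieSubmodule.lieSpan ℂ sl2
    ((fun T : Module.End ℂ (Vrep l ⊗[ℂ] Vrep m) => T (hwVec l ⊗ₜ hwVec m)) ''
      (((Submodule.span ℂ {1} ⊔ Submodule.span ℂ
        (Set.range fun x : sl2 => (LieModule.toEnd ℂ sl2 (Vrep m) x).lTensor (Vrep l))) ^ i :
          Submodule ℂ (Module.End ℂ (Vrep l ⊗[ℂ] Vrep m))) : Set _))

/-- The quotient `P / a Ṽ`, for a submodule `P` containing `a Ṽ`. -/
abbrev modA (P : Submodule U₂ (Weyl₂ l m)) : Type := P ⧸ (atWeyl l m).submoduleOf P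

/-- The classes in `P / a Ṽ` of the vectors `a^j u_j`, `i ≤ j ≤ m`. -/
def classes (P : Submodule U₂ (Weyl₂ l m)) (u : ℕ → Vrep l ⊗[ℂ] Vrep m) (i : ℕ) :
    Set (modA l m P) :=
  {z | ∃ j, i ≤ j ∧ j ≤ m ∧ ∃ h : a ^ j • vec l m (u j) ∈ P,
    z = Submodule.Quotient.mk ⟨a ^ j • vec l m (u j), h⟩}

/-- The `ĝ₂`-module structure of `Q` descends along `Sp` to a `U(ĝ₁)`-module structure (necessarily unique, as `Sp` is
surjective), for which `Q` is isomorphic to `N` as a module over the completed enveloping algebra `Û₁` and is generated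
by `S` as a `Û₁`-module. -/
def IsoAndGenerated (Q N : Type) [AddCommGroup Q] [Module U₂ Q] [AddCommGroup N] [Module U₁ N]
    (S : Set Q) : Prop :=
  ∃ _ : Module U₁ Q, (∀ (x : U₂) (v : Q), spU x • v = x • v) ∧
    (∃ e : Q ≃ₗ[U₁] N, ∀ (x : UHat₁) (v : Q), e (x.act v) = x.act (e v)) ∧
    (hatSpan S : Submodule U₁ Q) = ⊤

end Statement

end
end TwoPoint

open TwoPoint

/-! On `A ⊗ V^l ⊗ V^m` a constant current acts diagonally and `t x` acts as `a (id ⊗ x)`. Starting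
from `v_l ⊗ v_m` these operators generate the lattice of series `∑ aⁿ z_n` with `z_n ∈ Fⁿ`, and `Ṽ`
is the submodule of `𝕍₂` induced from this lattice (`tWeyl_eq_latticeSpan`). Membership in `Ṽ` and
in `aⁱ 𝕍₂` can be tested on the coefficients of ordered monomials, by a Poincaré–Birkhoff–Witt
theorem for induced modules over an arbitrary base ring (`pbwMap_bijective`).

Modulo `a` the lattice becomes the associated graded space of `F`, identified with `V^l ⊗ V^m = ⊕
G^j` through the symbol map `TensorDecomp.sym`, which sends `∑ aⁿ z_n` to the sum of the
`G^n`-components of the `z_n`. On this fibre constant currents act as before, `t x` acts as the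
degree-one part `θ x` of `id ⊗ x`, and `tⁿ x` with `n ≥ 2` acts as zero. So `Ṽ / a Ṽ` is induced
from a module on which `t x` acts by `θ x`, whereas in `𝕎₁` it acts by zero on the inducing space.

The two induced modules agree because the deformed action already occurs inside `𝕎₁`: there is a map
`ψ : V^l ⊗ V^m → 𝕎₁`, equal to the inclusion modulo components of higher index, on whose image `t x`
acts through `θ x` (`TensorDecomp.exists_psi`). On highest weight vectors only `θ f` survives, with
`θ f u_j = γ_j u_{j+1}`, and `ψ u_j` is a combination of the vectors `(t⁻¹ e)^k u_{j+k}`. Its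
coefficients can be solved for since `t f` sends `(t⁻¹ e)^{k+1} v` to `-(k+1)(ν+k+2) (t⁻¹ e)^k v`
for `v` of highest weight `ν`, and this scalar is nonzero for `ν ≥ 0` (`tp_one_f_eVec`).

Extending `ψ ∘ sym` from the lattice gives an `Sp`-semilinear map `Θ : Ṽ → 𝕎₁` with kernel `a Ṽ`
that carries `𝓕_i` onto the sum of the components of index at least `i` (`exists_specialisation`).
All claims are read off from `Θ`. The completed algebras add nothing: on each vector a completed
element acts as some element of the enveloping algebra. -/

namespace TwoPoint
noncomputable section

attribute [local instance 100] LieRing.ofAssociativeRing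

set_option linter.unusedSectionVars false

/-! ### PBW for induced modules: the recursive action on the polynomial model `k[I] ⊗ M`. -/

section PBW
variable {k L L' M I : Type} [CommRing k] [LieRing L] [LieAlgebra k L] [LieRing L'] [LieAlgebra k L']
  [AddCommGroup M] [Module k M] [LinearOrder I]

/-- The vector of the complement of `L'` in `L` with index `i`. -/
def bvec (dec : L ≃ₗ[k] L' × (I →₀ k)) (i : I) : L := dec.symm (0, Finsupp.single i 1)

/-- The leading term of the action of `L` on `k[I] ⊗ M`: multiplication in the polynomial ring. -/
def lead (M : Type) [AddCommGroup M] [Module k M] (dec : L ≃ₗ[k] L' × (I →₀ k)) :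
    L →ₗ[k] Module.End k (Multiset I →₀ M) :=
  (Finsupp.linearCombination k fun i => (Finsupp.lmapDomain M k fun s : Multiset I => i ::ₘ s)) ∘ₗ
    LinearMap.snd k L' (I →₀ k) ∘ₗ dec.toLinearMap

/-- The projection of `L` which forgets the components of index at most `i`. -/
def trunc (dec : L ≃ₗ[k] L' × (I →₀ k)) (i : I) : L →ₗ[k] L :=
  dec.symm.toLinearMap ∘ₗ LinearMap.prodMap LinearMap.id
    (Finsupp.linearCombination k fun i' => if i < i' then Finsupp.single i' (1 : k) else 0) ∘ₗ
      dec.toLinearMap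

/-- One step in the recursive definition of the lower order term of the action of `L`, on `z_s ⊗ M`. -/
def corrAt (ρ : L' →ₗ⁅k⁆ Module.End k M) (dec : L ≃ₗ[k] L' × (I →₀ k))
    (D : L →ₗ[k] Module.End k (Multiset I →₀ M)) : List I → L →ₗ[k] M →ₗ[k] (Multiset I →₀ M)
  | [] =>
    { toFun := fun ξ => Finsupp.lsingle 0 ∘ₗ ρ (dec ξ).1
      map_add' := fun ξ η => by ext; simp
      map_smul' := fun c ξ => by ext; simp }
  -- Here `i` is the smallest index. Components of `ξ` of index at most `i` multiply an ordered
  -- monomial without correction, so only the truncation matters. For it, `ξ x_i z_T = x_i ξ z_T +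
  -- [ξ, x_i] z_T`, and removing the leading term leaves the expression below.
  | i :: T =>
    { toFun := fun ξ => ((lead M dec (bvec dec i) + D (bvec dec i)) ∘ₗ D (trunc dec i ξ) +
          (lead M dec + D) ⁅trunc dec i ξ, bvec dec i⁆) ∘ₗ Finsupp.lsingle (T : Multiset I)
      map_add' := fun ξ η => by
        simp only [map_add, add_lie, LinearMap.comp_add, LinearMap.add_comp]; abel
      map_smul' := fun c ξ => by
        simp only [map_smul, smul_lie, LinearMap.comp_smul, LinearMap.smul_comp, RingHom.id_apply,
          ← smul_add] }

/-- One step in the recursive definition of the lower order term of the action of `L`. -/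
def corrStep (ρ : L' →ₗ⁅k⁆ Module.End k M) (dec : L ≃ₗ[k] L' × (I →₀ k))
    (D : L →ₗ[k] Module.End k (Multiset I →₀ M)) : L →ₗ[k] Module.End k (Multiset I →₀ M) :=
  (Finsupp.lsum k).toLinearMap ∘ₗ LinearMap.pi fun s : Multiset I => corrAt ρ dec D (s.sort (· ≤ ·))

/-- The lower order term, correct in degrees less than `n`. -/
def corrN (ρ : L' →ₗ⁅k⁆ Module.End k M) (dec : L ≃ₗ[k] L' × (I →₀ k)) :
    ℕ → L →ₗ[k] Module.End k (Multiset I →₀ M)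
  | 0 => 0
  | n + 1 => corrStep ρ dec (corrN ρ dec n)

/-- The lower order term of the action of `L` on `k[I] ⊗ M`. -/
def corr (ρ : L' →ₗ⁅k⁆ Module.End k M) (dec : L ≃ₗ[k] L' × (I →₀ k)) :
    L →ₗ[k] Module.End k (Multiset I →₀ M) :=
  (Finsupp.lsum k).toLinearMap ∘ₗ LinearMap.pi fun s : Multiset I =>
    -- On degree `card s` the recursion has stabilised after `card s + 1` steps.
    (LinearMap.lcomp k _ (Finsupp.lsingle s)) ∘ₗ corrN ρ dec (s.card + 1)

/-- Elements of degree at most `n` in `k[I] ⊗ M`. -/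
def degLE (k M I : Type) [CommRing k] [AddCommGroup M] [Module k M] (n : ℕ) :
    Submodule k (Multiset I →₀ M) :=
  Finsupp.supported M k {s | s.card ≤ n}

variable (ρ : L' →ₗ⁅k⁆ Module.End k M) (dec : L ≃ₗ[k] L' × (I →₀ k))

theorem degLE_mono {n p : ℕ} (h : n ≤ p) : degLE k M I n ≤ degLE k M I p :=
  Finsupp.supported_mono fun _ hs => le_trans hs h

theorem single_mem_degLE {s : Multiset I} {n : ℕ} (h : s.card ≤ n) (v : M) :
    Finsupp.single s v ∈ degLE k M I n :=
  Finsupp.single_mem_supported k v h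

theorem degLE_induction {n : ℕ} {p : (Multiset I →₀ M) → Prop} (h0 : p 0)
    (hadd : ∀ z w, p z → p w → p (z + w))
    (hs : ∀ (s : Multiset I) (v : M), s.card ≤ n → p (Finsupp.single s v))
    {z : Multiset I →₀ M} (hz : z ∈ degLE k M I n) : p z := by
  have hz' : ∀ s ∈ z.support, s.card ≤ n := fun s h => hz h
  rw [← Finsupp.sum_single z]
  exact Finset.sum_induction _ p hadd h0 fun s h => hs s _ (hz' s h)

theorem ne_zero_exists_cons {s : Multiset I} (h : s ≠ 0) :
    ∃ (i : I) (T : Multiset I), s = i ::ₘ T ∧ ∀ t ∈ T, i ≤ t := by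
  classical
  have hl : s.sort (· ≤ ·) ≠ [] := by
    intro h'; apply h; rw [← Multiset.sort_eq s (· ≤ ·), h']; rfl
  obtain ⟨i, T, hT⟩ := List.exists_cons_of_ne_nil hl
  have hs : s = i ::ₘ (T : Multiset I) := by
    rw [← Multiset.sort_eq s (· ≤ ·), hT]; rfl
  refine ⟨i, T, hs, fun t ht => ?_⟩
  have hp := Multiset.pairwise_sort s (· ≤ ·)
  rw [hT, List.pairwise_cons] at hp
  exact hp.1 t ht

theorem corrStep_zero (D : L →ₗ[k] Module.End k (Multiset I →₀ M)) (ξ : L) (v : M) :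
    corrStep ρ dec D ξ (Finsupp.single 0 v) = Finsupp.single 0 (ρ (dec ξ).1 v) := by
  simp [corrStep, corrAt]

theorem corrStep_cons (D : L →ₗ[k] Module.End k (Multiset I →₀ M)) (ξ : L) (v : M) (i : I)
    (T : Multiset I) (h : ∀ t ∈ T, i ≤ t) :
    corrStep ρ dec D ξ (Finsupp.single (i ::ₘ T) v) =
      (lead M dec (bvec dec i) + D (bvec dec i)) (D (trunc dec i ξ) (Finsupp.single T v)) +
      (lead M dec + D) ⁅trunc dec i ξ, bvec dec i⁆ (Finsupp.single T v) := by
  simp [corrStep, Multiset.sort_cons i T _ h, corrAt]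

theorem dec_bvec (i : I) : dec (bvec dec i) = (0, Finsupp.single i 1) := by simp [bvec]

theorem lead_bvec_single (i : I) (s : Multiset I) (v : M) :
    lead M dec (bvec dec i) (Finsupp.single s v) = Finsupp.single (i ::ₘ s) v := by
  simp [lead, dec_bvec, Finsupp.mapDomain_single]

theorem lead_mem (ξ : L) {n : ℕ} {z : Multiset I →₀ M} (hz : z ∈ degLE k M I n) :
    lead M dec ξ z ∈ degLE k M I (n + 1) := by
  refine degLE_induction (p := fun z => lead M dec ξ z ∈ degLE k M I (n + 1)) (by simp)
    (fun z w h1 h2 => by rw [map_add]; exact add_mem h1 h2) (fun s v hs => ?_) hz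
  simp only [lead, LinearMap.comp_apply, Finsupp.linearCombination_apply, Finsupp.sum,
    LinearMap.sum_apply, LinearMap.smul_apply]
  refine Submodule.sum_mem _ fun i _ => Submodule.smul_mem _ _ ?_
  rw [Finsupp.lmapDomain_apply, Finsupp.mapDomain_single]
  exact single_mem_degLE (by simpa using hs) v

/-- The recursion in one degree calls only values in lower degree, and the correction never raises
the degree. Both facts must be proved together, since an inner value of the correction is fed into
the correction again. -/
theorem corrN_props (n : ℕ) :
    (∀ p, p < n → ∀ ξ z, z ∈ degLE k M I p → corrN ρ dec n ξ z ∈ degLE k M I p) ∧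
    (∀ p, p < n → ∀ ξ z, z ∈ degLE k M I p → corrN ρ dec (n + 1) ξ z = corrN ρ dec n ξ z) := by
  induction n with
  | zero => exact ⟨fun p h => absurd h (Nat.not_lt_zero p), fun p h => absurd h (Nat.not_lt_zero p)⟩
  | succ n ih =>
    obtain ⟨ih1, ih2⟩ := ih
    constructor
    · intro p hp ξ z hz
      refine degLE_induction (p := fun z => corrN ρ dec (n + 1) ξ z ∈ degLE k M I p) (by simp)
        (fun z w h1 h2 => by rw [map_add]; exact add_mem h1 h2) (fun s v hs => ?_) hz
      rw [corrN]
      by_cases h0 : s = 0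
      · subst h0
        rw [corrStep_zero]
        exact single_mem_degLE (by simp) _
      · obtain ⟨i, T, rfl, hT⟩ := ne_zero_exists_cons h0
        rw [corrStep_cons _ _ _ _ _ _ _ hT]
        rw [Multiset.card_cons] at hs
        have hTm : Finsupp.single T v ∈ degLE k M I T.card := single_mem_degLE le_rfl v
        have h1 := ih1 T.card (by omega) (trunc dec i ξ) _ hTm
        refine degLE_mono hs ?_
        rw [LinearMap.add_apply, LinearMap.add_apply, LinearMap.add_apply]
        exact add_mem (add_mem (lead_mem dec _ h1)
          (degLE_mono (Nat.le_succ _) (ih1 _ (by omega) _ _ h1)))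
          (add_mem (lead_mem dec _ hTm) (degLE_mono (Nat.le_succ _) (ih1 _ (by omega) _ _ hTm)))
    · intro p hp ξ z hz
      refine degLE_induction (p := fun z => corrN ρ dec (n + 1 + 1) ξ z = corrN ρ dec (n + 1) ξ z)
        (by simp) (fun z w h1 h2 => by rw [map_add, map_add, h1, h2]) (fun s v hs => ?_) hz
      rw [corrN]
      conv_rhs => rw [corrN]
      by_cases h0 : s = 0
      · subst h0
        rw [corrStep_zero, corrStep_zero]
      · obtain ⟨i, T, rfl, hT⟩ := ne_zero_exists_cons h0
        rw [corrStep_cons _ _ _ _ _ _ _ hT, corrStep_cons _ _ _ _ _ _ _ hT]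
        rw [Multiset.card_cons] at hs
        have hTm : Finsupp.single T v ∈ degLE k M I T.card := single_mem_degLE le_rfl v
        have h1 := ih1 T.card (by omega) (trunc dec i ξ) _ hTm
        simp only [LinearMap.add_apply]
        rw [ih2 T.card (by omega) _ _ hTm, ih2 T.card (by omega) _ _ hTm,
          ih2 T.card (by omega) _ _ h1]

theorem corr_single (ξ : L) (s : Multiset I) (v : M) :
    corr ρ dec ξ (Finsupp.single s v) = corrN ρ dec (s.card + 1) ξ (Finsupp.single s v) := by
  simp [corr]

theorem corrN_eq_corr (n : ℕ) (ξ : L) (z : Multiset I →₀ M) (p : ℕ) (hp : p < n)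
    (hz : z ∈ degLE k M I p) : corrN ρ dec n ξ z = corr ρ dec ξ z := by
  refine degLE_induction (p := fun z => corrN ρ dec n ξ z = corr ρ dec ξ z) (by simp)
    (fun z w h1 h2 => by rw [map_add, map_add, h1, h2]) (fun s v hs => ?_) hz
  rw [corr_single]
  have key : ∀ n, s.card + 1 ≤ n →
      corrN ρ dec n ξ (Finsupp.single s v) = corrN ρ dec (s.card + 1) ξ (Finsupp.single s v) := by
    intro n hn
    induction n, hn using Nat.le_induction with
    | base => rfl
    | succ n hn ih =>
      rw [(corrN_props ρ dec n).2 s.card (by omega) _ _ (single_mem_degLE le_rfl v), ih]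
  exact key n (by omega)

theorem corr_mem {n : ℕ} (ξ : L) {z : Multiset I →₀ M} (hz : z ∈ degLE k M I n) :
    corr ρ dec ξ z ∈ degLE k M I n := by
  rw [← corrN_eq_corr ρ dec (n + 1) ξ z n (Nat.lt_succ_self n) hz]
  exact (corrN_props ρ dec (n + 1)).1 n (Nat.lt_succ_self n) ξ z hz

theorem corr_zero (ξ : L) (v : M) :
    corr ρ dec ξ (Finsupp.single 0 v) = Finsupp.single 0 (ρ (dec ξ).1 v) := by
  rw [corr_single, corrN, corrStep_zero]

/-- The action of `L` on `k[I] ⊗ M`. -/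
def symAct : L →ₗ[k] Module.End k (Multiset I →₀ M) := lead M dec + corr ρ dec

/-- Stabilisation turns the iteration into a fixed-point equation, so that the counter `n`
disappears from the later arguments. -/
theorem corr_cons (ξ : L) (v : M) (i : I) (T : Multiset I) (h : ∀ t ∈ T, i ≤ t) :
    corr ρ dec ξ (Finsupp.single (i ::ₘ T) v) =
      symAct ρ dec (bvec dec i) (corr ρ dec (trunc dec i ξ) (Finsupp.single T v)) +
      symAct ρ dec ⁅trunc dec i ξ, bvec dec i⁆ (Finsupp.single T v) := by
  have hTm : Finsupp.single T v ∈ degLE k M I T.card := single_mem_degLE le_rfl v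
  rw [corr_single, corrN, corrStep_cons _ _ _ _ _ _ _ h, Multiset.card_cons]
  simp only [LinearMap.add_apply, symAct]
  have h1 : corrN ρ dec (T.card + 1) (trunc dec i ξ) (Finsupp.single T v) =
    corr ρ dec (trunc dec i ξ) (Finsupp.single T v) := corrN_eq_corr ρ dec _ _ _ _ (Nat.lt_succ_self _) hTm
  rw [h1, corrN_eq_corr ρ dec _ _ _ _ (Nat.lt_succ_self _) hTm,
    corrN_eq_corr ρ dec _ _ _ _ (Nat.lt_succ_self _) (corr_mem ρ dec _ hTm)]

end PBW
end
end TwoPoint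

namespace TwoPoint
noncomputable section

attribute [local instance 100] LieRing.ofAssociativeRing

set_option linter.unusedSectionVars false

/-! ### The polynomial model satisfies the commutation relations of `L`. -/

section PBW
variable {k L L' M I : Type} [CommRing k] [LieRing L] [LieAlgebra k L] [LieRing L'] [LieAlgebra k L']
  [AddCommGroup M] [Module k M] [LinearOrder I]
variable (ρ : L' →ₗ⁅k⁆ Module.End k M) (dec : L ≃ₗ[k] L' × (I →₀ k))

theorem trunc_bvec_of_lt {i l : I} (h : l < i) : trunc dec l (bvec dec i) = bvec dec i := by
  simp [trunc, bvec, h]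

theorem trunc_bvec_of_le {i l : I} (h : i ≤ l) : trunc dec l (bvec dec i) = 0 := by
  simp [trunc, bvec, not_lt.mpr h]

theorem trunc_of_snd_eq_zero {l : I} {ξ : L} (h : (dec ξ).2 = 0) : trunc dec l ξ = ξ := by
  rw [← dec.injective.eq_iff]
  ext : 1 <;> simp [trunc, h]

/-- The product with an index at most all those present is already ordered; in the recursion the
truncation kills the vector. -/
theorem corr_bvec_single {i : I} {s : Multiset I} (h : ∀ t ∈ s, i ≤ t) (v : M) :
    corr ρ dec (bvec dec i) (Finsupp.single s v) = 0 := by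
  by_cases h0 : s = 0
  · subst h0
    simp [corr_zero, dec_bvec]
  · obtain ⟨l, T, rfl, hT⟩ := ne_zero_exists_cons h0
    rw [corr_cons _ _ _ _ _ _ hT, trunc_bvec_of_le dec (h l (Multiset.mem_cons_self l T))]
    simp

theorem symAct_bvec_single {i : I} {s : Multiset I} (h : ∀ t ∈ s, i ≤ t) (v : M) :
    symAct ρ dec (bvec dec i) (Finsupp.single s v) = Finsupp.single (i ::ₘ s) v := by
  rw [symAct, LinearMap.add_apply, LinearMap.add_apply, corr_bvec_single ρ dec h, add_zero,
    lead_bvec_single]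

theorem symAct_single_zero {ξ : L} (h : (dec ξ).2 = 0) (v : M) :
    symAct ρ dec ξ (Finsupp.single 0 v) = Finsupp.single 0 (ρ (dec ξ).1 v) := by
  rw [symAct, LinearMap.add_apply, LinearMap.add_apply, corr_zero]
  simp [lead, h]

theorem lead_single_mem_span {l : I} {η : L} (h : trunc dec l η = η) (T : Multiset I) (v : M) :
    lead M dec η (Finsupp.single T v) ∈
      Submodule.span k {z : Multiset I →₀ M | ∃ i, l < i ∧ z = Finsupp.single (i ::ₘ T) v} := by
  have h2 : (dec η).2 =
      Finsupp.linearCombination k (fun i' => if l < i' then Finsupp.single i' (1 : k) else 0)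
        (dec η).2 := by
    conv_lhs => rw [← h]
    simp [trunc]
  rw [lead, LinearMap.comp_apply, LinearMap.comp_apply, LinearEquiv.coe_coe, LinearMap.snd_apply, h2,
    Finsupp.linearCombination_apply k (dec η).2, Finsupp.sum, map_sum, LinearMap.sum_apply]
  refine Submodule.sum_mem _ fun i _ => ?_
  rw [map_smul, LinearMap.smul_apply]
  refine Submodule.smul_mem _ _ ?_
  split_ifs with hi
  · refine Submodule.subset_span ⟨i, hi, ?_⟩
    simp [Finsupp.mapDomain_single]
  · simp

/-- The commutation relation `ξ η z = η ξ z + [ξ, η] z`. -/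
def Comm (ξ η : L) (z : Multiset I →₀ M) : Prop :=
  symAct ρ dec ξ (symAct ρ dec η z) = symAct ρ dec η (symAct ρ dec ξ z) + symAct ρ dec ⁅ξ, η⁆ z

theorem Comm.zero_right (ξ η : L) : Comm ρ dec ξ η 0 := by simp [Comm]

theorem Comm.add_right {ξ η : L} {z w : Multiset I →₀ M} (h1 : Comm ρ dec ξ η z)
    (h2 : Comm ρ dec ξ η w) : Comm ρ dec ξ η (z + w) := by
  unfold Comm at *
  simp only [map_add, h1, h2]; abel

theorem Comm.smul_right {ξ η : L} {z : Multiset I →₀ M} (c : k) (h1 : Comm ρ dec ξ η z) :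
    Comm ρ dec ξ η (c • z) := by
  unfold Comm at *
  simp only [map_smul, h1, smul_add]

theorem Comm.symm {ξ η : L} {z : Multiset I →₀ M} (h : Comm ρ dec ξ η z) : Comm ρ dec η ξ z := by
  unfold Comm at *
  rw [h, ← lie_skew ξ η, map_neg, LinearMap.neg_apply]; abel

theorem Comm.self (ξ : L) (z : Multiset I →₀ M) : Comm ρ dec ξ ξ z := by
  simp [Comm]

/-- This relation is built into the recursion: the correction of `ξ` on `x_l z_T` was defined by
commuting `ξ` past `x_l`. What remains is that multiplying by `x_l` commutes with the leading term
of `ξ`, whose monomials still have no index below `l`. -/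
theorem comm_bvec_single {l : I} {ξ : L} (h : trunc dec l ξ = ξ) {T : Multiset I}
    (hT : ∀ t ∈ T, l ≤ t) (v : M) : Comm ρ dec ξ (bvec dec l) (Finsupp.single T v) := by
  have h1 : symAct ρ dec (bvec dec l) (lead M dec ξ (Finsupp.single T v)) =
      lead M dec ξ (Finsupp.single (l ::ₘ T) v) := by
    have : ∀ z ∈ Submodule.span k {z : Multiset I →₀ M | ∃ i, l < i ∧ z = Finsupp.single (i ::ₘ T) v},
        corr ρ dec (bvec dec l) z = 0 := by
      intro z hz
      refine Submodule.span_induction (p := fun z _ => corr ρ dec (bvec dec l) z = 0) ?_ (by simp)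
        (fun _ _ _ _ h1 h2 => by rw [map_add, h1, h2, add_zero])
        (fun c _ _ h => by rw [map_smul, h, smul_zero]) hz
      rintro _ ⟨i, hi, rfl⟩
      refine corr_bvec_single ρ dec (fun t ht => ?_) v
      rcases Multiset.mem_cons.mp ht with rfl | ht
      · exact hi.le
      · exact hT t ht
    rw [symAct, LinearMap.add_apply, LinearMap.add_apply, this _ (lead_single_mem_span dec h T v),
      add_zero]
    simp only [lead, LinearMap.comp_apply, LinearEquiv.coe_coe, dec_bvec, LinearMap.snd_apply,
      Finsupp.linearCombination_apply, Finsupp.sum, LinearMap.sum_apply, LinearMap.smul_apply,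
      map_sum, map_smul, Finsupp.lmapDomain_apply, Finsupp.mapDomain_single]
    refine Finset.sum_congr rfl fun i _ => ?_
    -- The support of `single i 1` is `{i}` only if `1 ≠ 0`; over the zero ring everything is
    -- trivial.
    by_cases h1 : (1 : k) = 0
    · have := subsingleton_of_zero_eq_one h1.symm
      have : Subsingleton (Multiset I →₀ M) := Module.subsingleton k _
      exact Subsingleton.elim _ _
    · rw [Finsupp.support_single _ h1, Finset.sum_singleton]
      simp [Multiset.cons_swap l i T]
  unfold Comm
  rw [symAct_bvec_single ρ dec hT v]
  conv_lhs => rw [symAct, LinearMap.add_apply, LinearMap.add_apply, corr_cons _ _ _ _ _ _ hT, h, ← h1]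
  conv_rhs => rw [show symAct ρ dec ξ (Finsupp.single T v) =
    lead M dec ξ (Finsupp.single T v) + corr ρ dec ξ (Finsupp.single T v) from rfl, map_add]
  rw [add_assoc]

/-- Write the monomial as `x_l z_T` and move both `ξ` and `η` past `x_l`. The terms that do not
cancel match by the Jacobi identity for `ξ`, `η`, `x_l` and the relations already known on `z_T`. -/
theorem comm_cons {l : I} {ξ η : L} (hξ : trunc dec l ξ = ξ) (hη : trunc dec l η = η)
    {T : Multiset I} (hT : ∀ t ∈ T, l ≤ t)
    (ih : ∀ ξ η z, z ∈ degLE k M I T.card → Comm ρ dec ξ η z) (v : M) :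
    Comm ρ dec ξ η (Finsupp.single (l ::ₘ T) v) := by
  have hTm : Finsupp.single T v ∈ degLE k M I T.card := single_mem_degLE le_rfl v
  -- The top part of `η z_T` has degree `card T + 1`, out of reach of `ih`. But it is a combination
  -- of monomials `i ::ₘ T` with `l < i`, on which the relation with `x_l` holds by construction.
  have key : ∀ ξ η : L, trunc dec l ξ = ξ → trunc dec l η = η →
      Comm ρ dec ξ (bvec dec l) (symAct ρ dec η (Finsupp.single T v)) := by
    intro ξ η hξ hη
    refine Comm.add_right ρ dec ?_ (ih _ _ _ (corr_mem ρ dec η hTm))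
    refine Submodule.span_induction (p := fun z _ => Comm ρ dec ξ (bvec dec l) z) ?_
      (Comm.zero_right ρ dec _ _) (fun _ _ _ _ => Comm.add_right ρ dec)
      (fun c _ _ h => Comm.smul_right ρ dec c h) (lead_single_mem_span dec hη T v)
    rintro _ ⟨i, hi, rfl⟩
    refine comm_bvec_single ρ dec hξ (fun t ht => ?_) v
    rcases Multiset.mem_cons.mp ht with rfl | ht
    · exact hi.le
    · exact hT t ht
  have expand : ∀ ξ η : L, trunc dec l ξ = ξ → trunc dec l η = η →
      symAct ρ dec ξ (symAct ρ dec η (Finsupp.single (l ::ₘ T) v)) =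
        symAct ρ dec (bvec dec l) (symAct ρ dec ξ (symAct ρ dec η (Finsupp.single T v))) +
        symAct ρ dec ⁅ξ, bvec dec l⁆ (symAct ρ dec η (Finsupp.single T v)) +
        (symAct ρ dec ⁅η, bvec dec l⁆ (symAct ρ dec ξ (Finsupp.single T v)) +
          symAct ρ dec ⁅ξ, ⁅η, bvec dec l⁆⁆ (Finsupp.single T v)) := by
    intro ξ η hξ hη
    have h1 := comm_bvec_single ρ dec hη hT v
    unfold Comm at h1
    rw [symAct_bvec_single ρ dec hT v] at h1
    rw [h1, map_add, ih ξ ⁅η, bvec dec l⁆ _ hTm, key ξ η hξ hη]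
  have h3 : symAct ρ dec ⁅ξ, η⁆ (Finsupp.single (l ::ₘ T) v) =
      symAct ρ dec (bvec dec l) (symAct ρ dec ⁅ξ, η⁆ (Finsupp.single T v)) +
        symAct ρ dec ⁅⁅ξ, η⁆, bvec dec l⁆ (Finsupp.single T v) := by
    rw [← symAct_bvec_single ρ dec hT v]
    exact ih _ _ _ hTm
  unfold Comm
  rw [expand ξ η hξ hη, expand η ξ hη hξ, h3, ih ξ η _ hTm, map_add, lie_lie, map_sub,
    LinearMap.sub_apply]
  abel

variable (j : L' →ₗ⁅k⁆ L) (hj : ∀ y, dec (j y) = (y, 0))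
include hj

theorem generator_induction (P : L → Prop) (ha : ∀ x y, P x → P y → P (x + y))
    (hs : ∀ (c : k) x, P x → P (c • x)) (hy : ∀ y, P (j y)) (hi : ∀ i, P (bvec dec i)) (x : L) :
    P x := by
  have hx : x = j (dec x).1 + dec.symm (0, (dec x).2) := by
    apply dec.injective
    rw [map_add, hj]; simp
  rw [hx]
  refine ha _ _ (hy _) ?_
  induction (dec x).2 using Finsupp.induction_linear with
  | zero =>
    have h := hy 0
    rwa [map_zero, ← map_zero dec.symm] at h
  | add f g hf hg =>
    have h := ha _ _ hf hg
    rwa [← map_add, Prod.mk_add_mk, add_zero] at h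
  | single i c =>
    have h := hs c _ (hi i)
    rwa [bvec, ← map_smul, Prod.smul_mk, smul_zero, Finsupp.smul_single', mul_one] at h

theorem comm_of_generators {z : Multiset I →₀ M}
    (h1 : ∀ y y', Comm ρ dec (j y) (j y') z) (h2 : ∀ y i, Comm ρ dec (j y) (bvec dec i) z)
    (h3 : ∀ i i', Comm ρ dec (bvec dec i) (bvec dec i') z) (ξ η : L) : Comm ρ dec ξ η z := by
  have add_left : ∀ ξ ξ' η : L, Comm ρ dec ξ η z → Comm ρ dec ξ' η z → Comm ρ dec (ξ + ξ') η z := by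
    intro ξ ξ' η h h'
    unfold Comm at *
    simp only [map_add, LinearMap.add_apply, add_lie, h, h']; abel
  have smul_left : ∀ (c : k) (ξ η : L), Comm ρ dec ξ η z → Comm ρ dec (c • ξ) η z := by
    intro c ξ η h
    unfold Comm at *
    simp only [map_smul, LinearMap.smul_apply, smul_lie, h, smul_add]
  refine generator_induction dec j hj (fun ξ => Comm ρ dec ξ η z) (fun _ _ => add_left _ _ _) (fun c _ => smul_left c _ _)
    (fun y => ?_) (fun i => ?_) ξ
  · refine (generator_induction dec j hj (fun η => Comm ρ dec η (j y) z) (fun _ _ => add_left _ _ _)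
      (fun c _ => smul_left c _ _) (fun y' => h1 y' y) (fun i => (h2 y i).symm) η).symm
  · refine (generator_induction dec j hj (fun η => Comm ρ dec η (bvec dec i) z) (fun _ _ => add_left _ _ _)
      (fun c _ => smul_left c _ _) (fun y' => h2 y' i) (fun i' => h3 i' i) η).symm

/-- It suffices to treat pairs of generators. On a monomial with smallest index `l`, a pair whose
smallest basis index is at most `l` is covered by `comm_bvec_single`; in every other pair both
members are fixed by truncation at `l`, and `comm_cons` applies. -/
theorem comm_all (n : ℕ) : ∀ (ξ η : L) (z : Multiset I →₀ M), z ∈ degLE k M I n →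
    Comm ρ dec ξ η z := by
  induction n using Nat.strong_induction_on with
  | _ n ih =>
  intro ξ η z hz
  refine degLE_induction (Comm.zero_right ρ dec _ _) (fun _ _ => Comm.add_right ρ dec)
    (fun s v hs => ?_) hz
  have htr : ∀ l y, trunc dec l (j y) = j y := fun l y => trunc_of_snd_eq_zero dec (by rw [hj])
  by_cases h0 : s = 0
  · subst h0
    refine comm_of_generators ρ dec j hj (fun y y' => ?_)
      (fun y i => comm_bvec_single ρ dec (htr _ _) (by simp) v) (fun i i' => ?_) ξ η
    · unfold Comm
      have h (y : L') (v : M) : symAct ρ dec (j y) (Finsupp.single 0 v) = Finsupp.single 0 (ρ y v) := by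
        rw [symAct_single_zero ρ dec (by rw [hj]), hj]
      rw [← LieHom.map_lie, h, h, h, h, h, LieHom.map_lie, LieRing.of_associative_ring_bracket,
        ← Finsupp.single_add]
      simp
    · rcases lt_trichotomy i i' with h | rfl | h
      · exact (comm_bvec_single ρ dec (trunc_bvec_of_lt dec h) (by simp) v).symm
      · exact Comm.self ρ dec _ _
      · exact comm_bvec_single ρ dec (trunc_bvec_of_lt dec h) (by simp) v
  · obtain ⟨l, T, rfl, hT⟩ := ne_zero_exists_cons h0
    rw [Multiset.card_cons] at hs
    have ih' := ih T.card (by omega)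
    have hle : ∀ i, i ≤ l → ∀ t ∈ l ::ₘ T, i ≤ t := by
      intro i hi t ht
      rcases Multiset.mem_cons.mp ht with rfl | ht
      · exact hi
      · exact hi.trans (hT t ht)
    have hlt : ∀ i i', i' < i → Comm ρ dec (bvec dec i) (bvec dec i') (Finsupp.single (l ::ₘ T) v) := by
      intro i i' h
      rcases le_or_gt i' l with h' | h'
      · exact comm_bvec_single ρ dec (trunc_bvec_of_lt dec h) (hle i' h') v
      · exact comm_cons ρ dec (trunc_bvec_of_lt dec (h'.trans h)) (trunc_bvec_of_lt dec h') hT ih' v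
    refine comm_of_generators ρ dec j hj (fun y y' => ?_) (fun y i => ?_) (fun i i' => ?_) ξ η
    · exact comm_cons ρ dec (htr _ _) (htr _ _) hT ih' v
    · rcases le_or_gt i l with h' | h'
      · exact comm_bvec_single ρ dec (htr _ _) (hle i h') v
      · exact comm_cons ρ dec (htr _ _) (trunc_bvec_of_lt dec h') hT ih' v
    · rcases lt_trichotomy i i' with h | rfl | h
      · exact (hlt i' i h).symm
      · exact Comm.self ρ dec _ _
      · exact hlt i i' h

/-- The `L`-module structure on `k[I] ⊗ M`. -/
theorem symAct_lie (ξ η : L) : symAct ρ dec ⁅ξ, η⁆ = ⁅symAct ρ dec ξ, symAct ρ dec η⁆ := by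
  refine LinearMap.ext fun z => ?_
  obtain ⟨n, hn⟩ : ∃ n, z ∈ degLE k M I n := by
    refine ⟨z.support.sup Multiset.card, fun s hs => ?_⟩
    exact Finset.le_sup (f := Multiset.card) hs
  have h := comm_all ρ dec j hj n ξ η z hn
  unfold Comm at h
  rw [LieRing.of_associative_ring_bracket, LinearMap.sub_apply, Module.End.mul_apply,
    Module.End.mul_apply, h]
  abel

end PBW
end
end TwoPoint

namespace TwoPoint
noncomputable section

attribute [local instance 100] LieRing.ofAssociativeRing

set_option linter.unusedSectionVars false

/-! ### Generation of the enveloping algebra and the universal property of induction. -/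

section Enveloping
variable {k L : Type} [CommRing k] [LieRing L] [LieAlgebra k L]

/-- Corestrict `ι` to the subalgebra it generates and lift; followed by the inclusion this is the
identity by uniqueness in the universal property. -/
theorem uea_adjoin_range_ι :
    Algebra.adjoin k (Set.range (UniversalEnvelopingAlgebra.ι k : L → UniversalEnvelopingAlgebra k L)) =
      ⊤ := by
  set S := Algebra.adjoin k
    (Set.range (UniversalEnvelopingAlgebra.ι k : L → UniversalEnvelopingAlgebra k L)) with hS
  let f : L →ₗ⁅k⁆ S :=
    { toFun := fun x => ⟨UniversalEnvelopingAlgebra.ι k x, Algebra.subset_adjoin ⟨x, rfl⟩⟩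
      map_add' := fun x y => Subtype.ext (map_add _ x y)
      map_smul' := fun c x => Subtype.ext (map_smul _ c x)
      map_lie' := fun {x y} => Subtype.ext (LieHom.map_lie _ x y) }
  have h : S.val.comp (UniversalEnvelopingAlgebra.lift k f) = AlgHom.id k _ := by
    refine UniversalEnvelopingAlgebra.hom_ext k (LieHom.ext fun x => ?_)
    change ((UniversalEnvelopingAlgebra.lift k f (UniversalEnvelopingAlgebra.ι k x) : S) :
      UniversalEnvelopingAlgebra k L) = UniversalEnvelopingAlgebra.ι k x
    rw [UniversalEnvelopingAlgebra.lift_ι_apply]; rfl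
  refine eq_top_iff.mpr fun u _ => ?_
  have := AlgHom.congr_fun h u
  rw [AlgHom.id_apply] at this
  rw [← this]
  exact (UniversalEnvelopingAlgebra.lift k f u).2

theorem uea_induction {P : UniversalEnvelopingAlgebra k L → Prop}
    (hι : ∀ x, P (UniversalEnvelopingAlgebra.ι k x)) (hk : ∀ c, P (algebraMap k _ c))
    (hadd : ∀ u v, P u → P v → P (u + v)) (hmul : ∀ u v, P u → P v → P (u * v))
    (u : UniversalEnvelopingAlgebra k L) : P u := by
  have hu : u ∈ Algebra.adjoin k
      (Set.range (UniversalEnvelopingAlgebra.ι k : L → UniversalEnvelopingAlgebra k L)) := by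
    rw [uea_adjoin_range_ι]; trivial
  refine Algebra.adjoin_induction (p := fun u _ => P u) ?_ hk (fun _ _ _ _ => hadd _ _)
    (fun _ _ _ _ => hmul _ _) hu
  rintro _ ⟨x, rfl⟩
  exact hι x

variable {Z : Type} [AddCommGroup Z] [Module k Z] [Module (UniversalEnvelopingAlgebra k L) Z]
  [IsScalarTower k (UniversalEnvelopingAlgebra k L) Z]

theorem uea_smul_mem (P : Submodule k Z)
    (hι : ∀ ξ z, z ∈ P → UniversalEnvelopingAlgebra.ι k (ξ : L) • z ∈ P)
    (u : UniversalEnvelopingAlgebra k L) {z : Z} (hz : z ∈ P) : u • z ∈ P := by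
  refine uea_induction (P := fun u => ∀ z ∈ P, u • z ∈ P) (fun x z hz => hι x z hz)
    (fun c z hz => ?_) (fun u v hu hv z hz => ?_) (fun u v hu hv z hz => ?_) u z hz
  · rw [algebraMap_smul]; exact P.smul_mem c hz
  · rw [add_smul]; exact add_mem (hu z hz) (hv z hz)
  · rw [mul_smul]; exact hu _ (hv z hz)

end Enveloping

section IndLift
variable {k L L' M : Type} [CommRing k] [LieRing L] [LieAlgebra k L] [LieRing L']
  [LieAlgebra k L'] [AddCommGroup M] [Module k M]

theorem indMk_add (j : L' →ₗ⁅k⁆ L) (ρ : L' →ₗ⁅k⁆ Module.End k M) (v w : M) :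
    indMk j ρ (v + w) = indMk j ρ v + indMk j ρ w := by
  rw [indMk, TensorProduct.tmul_add]; rfl

theorem indMk_smul (j : L' →ₗ⁅k⁆ L) (ρ : L' →ₗ⁅k⁆ Module.End k M) (c : k) (v : M) :
    indMk j ρ (c • v) = c • indMk j ρ v := by
  rw [indMk, TensorProduct.tmul_smul]; rfl

/-- The inclusion `v ↦ 1 ⊗ v` as a linear map. -/
def indIncl (j : L' →ₗ⁅k⁆ L) (ρ : L' →ₗ⁅k⁆ Module.End k M) : M →ₗ[k] Ind j ρ where
  toFun := indMk j ρ
  map_add' := indMk_add j ρ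
  map_smul' := indMk_smul j ρ

theorem ι_smul_indMk (j : L' →ₗ⁅k⁆ L) (ρ : L' →ₗ⁅k⁆ Module.End k M) (y : L') (v : M) :
    UniversalEnvelopingAlgebra.ι k (j y) • indMk j ρ v = indMk j ρ (ρ y v) := by
  have h : (1 * UniversalEnvelopingAlgebra.ι k (j y)) ⊗ₜ[k] v -
      (1 : UniversalEnvelopingAlgebra k L) ⊗ₜ[k] ρ y v ∈ indRel j ρ :=
    Submodule.subset_span ⟨1, y, v, rfl⟩
  have h2 := (Submodule.Quotient.eq (indRel j ρ)).mpr h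
  refine Eq.trans ?_ h2
  rw [one_mul]
  change Submodule.Quotient.mk (UniversalEnvelopingAlgebra.ι k (j y) •
    ((1 : UniversalEnvelopingAlgebra k L) ⊗ₜ[k] v)) = _
  rw [TensorProduct.smul_tmul', smul_eq_mul, mul_one]

theorem ind_induction {j : L' →ₗ⁅k⁆ L} {ρ : L' →ₗ⁅k⁆ Module.End k M} {P : Ind j ρ → Prop}
    (hmk : ∀ v, P (indMk j ρ v)) (hadd : ∀ z w, P z → P w → P (z + w))
    (hsmul : ∀ (u : UniversalEnvelopingAlgebra k L) z, P z → P (u • z)) (z : Ind j ρ) : P z := by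
  obtain ⟨z, rfl⟩ := Submodule.Quotient.mk_surjective _ z
  induction z using TensorProduct.induction_on with
  | zero =>
    have := hsmul 0 _ (hmk 0)
    rwa [zero_smul] at this
  | add z w hz hw => exact hadd _ _ hz hw
  | tmul u v =>
    have h := hsmul u _ (hmk v)
    have h2 : u • indMk j ρ v = Submodule.Quotient.mk (u ⊗ₜ[k] v) := by
      change Submodule.Quotient.mk (u • ((1 : UniversalEnvelopingAlgebra k L) ⊗ₜ[k] v)) = _
      rw [TensorProduct.smul_tmul', smul_eq_mul, mul_one]
    rwa [h2] at h

variable {R' Z : Type} [Ring R'] [AddCommGroup Z] [Module R' Z]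
  (σ : UniversalEnvelopingAlgebra k L →+* R')

/-- The universal property of the induced module, for maps semilinear over a ring homomorphism. -/
theorem exists_indLift (j : L' →ₗ⁅k⁆ L) (ρ : L' →ₗ⁅k⁆ Module.End k M) (φ : M →+ Z)
    (hc : ∀ (c : k) v, φ (c • v) = σ (algebraMap k _ c) • φ v)
    (hy : ∀ y v, φ (ρ y v) = σ (UniversalEnvelopingAlgebra.ι k (j y)) • φ v) :
    ∃ Φ : Ind j ρ →ₛₗ[σ] Z, ∀ v, Φ (indMk j ρ v) = φ v := by
  let f : UniversalEnvelopingAlgebra k L →+ M →+ Z :=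
    AddMonoidHom.mk' (fun u => AddMonoidHom.mk' (fun v => σ u • φ v)
      fun v w => by rw [map_add, smul_add])
      fun u u' => by ext v; simp [add_smul]
  -- The target carries no `k`-structure of its own, so the map is built additively. Balancedness
  -- comes from `hc` and the centrality of scalars.
  let F : UniversalEnvelopingAlgebra k L ⊗[k] M →+ Z := TensorProduct.liftAddHom f (by
    intro c u v
    change σ (c • u) • φ v = σ u • φ (c • v)
    rw [hc, smul_smul, ← map_mul, ← Algebra.commutes, ← Algebra.smul_def])
  have hF : ∀ u v, F (u ⊗ₜ v) = σ u • φ v := fun u v => rfl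
  let G : UniversalEnvelopingAlgebra k L ⊗[k] M →ₛₗ[σ] Z :=
    { F with
      map_smul' := fun u z => by
        change F (u • z) = σ u • F z
        induction z using TensorProduct.induction_on with
        | zero => simp
        | add z w hz hw => rw [smul_add, map_add, map_add, smul_add, hz, hw]
        | tmul u' v => rw [TensorProduct.smul_tmul', hF, hF, smul_eq_mul, map_mul, mul_smul] }
  refine ⟨Submodule.liftQ (indRel j ρ) G ?_, fun v => ?_⟩
  · refine Submodule.span_le.mpr ?_
    rintro _ ⟨u, y, v, rfl⟩
    change F ((u * UniversalEnvelopingAlgebra.ι k (j y)) ⊗ₜ[k] v - u ⊗ₜ[k] ρ y v) = 0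
    rw [map_sub, hF, hF, hy, map_mul, mul_smul, sub_self]
  · change F ((1 : UniversalEnvelopingAlgebra k L) ⊗ₜ[k] v) = _
    rw [hF, map_one, one_smul]

theorem ind_hom_ext {j : L' →ₗ⁅k⁆ L} {ρ : L' →ₗ⁅k⁆ Module.End k M} {Φ Φ' : Ind j ρ →ₛₗ[σ] Z}
    (h : ∀ v, Φ (indMk j ρ v) = Φ' (indMk j ρ v)) : Φ = Φ' :=
  LinearMap.ext fun z => ind_induction (P := fun z => Φ z = Φ' z) h
    (fun z w h1 h2 => by rw [map_add, map_add, h1, h2])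
    (fun u z h => by rw [map_smulₛₗ, map_smulₛₗ, h]) z

end IndLift

/-! ### Ordered monomials and the PBW isomorphism. -/

section PBW
variable {k L L' M I : Type} [CommRing k] [LieRing L] [LieAlgebra k L] [LieRing L'] [LieAlgebra k L']
  [AddCommGroup M] [Module k M] [LinearOrder I]
variable (dec : L ≃ₗ[k] L' × (I →₀ k))

/-- The ordered monomial in the enveloping algebra. -/
def pbwMonomial (s : Multiset I) : UniversalEnvelopingAlgebra k L :=
  ((s.sort (· ≤ ·)).map fun i => UniversalEnvelopingAlgebra.ι k (bvec dec i)).prod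

variable {Z : Type} [AddCommGroup Z] [Module k Z] [Module (UniversalEnvelopingAlgebra k L) Z]
  [IsScalarTower k (UniversalEnvelopingAlgebra k L) Z]

/-- The map `z_s ⊗ v ↦ x_s φ(v)`, with `x_s` the ordered monomial with exponent `s`. -/
def pbwMap (φ : M →ₗ[k] Z) : (Multiset I →₀ M) →ₗ[k] Z :=
  Finsupp.lsum k fun s => Algebra.lsmul k k Z (pbwMonomial dec s) ∘ₗ φ

theorem pbwMap_single (φ : M →ₗ[k] Z) (s : Multiset I) (v : M) :
    pbwMap dec φ (Finsupp.single s v) = pbwMonomial dec s • φ v := by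
  simp [pbwMap]

theorem pbwMonomial_zero : pbwMonomial dec 0 = 1 := by simp [pbwMonomial]

theorem pbwMonomial_cons {i : I} {s : Multiset I} (h : ∀ t ∈ s, i ≤ t) :
    pbwMonomial dec (i ::ₘ s) = UniversalEnvelopingAlgebra.ι k (bvec dec i) * pbwMonomial dec s := by
  rw [pbwMonomial, Multiset.sort_cons i s _ h, List.map_cons, List.prod_cons]; rfl

theorem pbwMap_zero (φ : M →ₗ[k] Z) (v : M) : pbwMap dec φ (Finsupp.single 0 v) = φ v := by
  rw [pbwMap_single, pbwMonomial_zero, one_smul]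

theorem pbwMap_cons (φ : M →ₗ[k] Z) {i : I} {s : Multiset I} (h : ∀ t ∈ s, i ≤ t) (v : M) :
    pbwMap dec φ (Finsupp.single (i ::ₘ s) v) =
      UniversalEnvelopingAlgebra.ι k (bvec dec i) • pbwMap dec φ (Finsupp.single s v) := by
  rw [pbwMap_single, pbwMap_single, pbwMonomial_cons dec h, mul_smul]

variable (ρ : L' →ₗ⁅k⁆ Module.End k M) (j : L' →ₗ⁅k⁆ L) (hj : ∀ y, dec (j y) = (y, 0))
include hj

/-- The action on the model and the action on the induced module obey the same rule for moving `ξ`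
past the first factor of an ordered monomial, so they agree by induction on the degree. This makes
the image of the ordered monomials stable under `L`. -/
theorem pbwMap_equivariant (n : ℕ) : ∀ (ξ : L) (z : Multiset I →₀ M), z ∈ degLE k M I n →
    pbwMap dec (indIncl j ρ) (symAct ρ dec ξ z) =
      UniversalEnvelopingAlgebra.ι k ξ • pbwMap dec (indIncl j ρ) z := by
  induction n using Nat.strong_induction_on with
  | _ n ih =>
  intro ξ z hz
  have htr : ∀ l y, trunc dec l (j y) = j y := fun l y => trunc_of_snd_eq_zero dec (by rw [hj])
  have hb : ∀ i (s : Multiset I) (v : M), (∀ t ∈ s, i ≤ t) →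
      pbwMap dec (indIncl j ρ) (symAct ρ dec (bvec dec i) (Finsupp.single s v)) =
        UniversalEnvelopingAlgebra.ι k (bvec dec i) •
          pbwMap dec (indIncl j ρ) (Finsupp.single s v) := by
    intro i s v h
    rw [symAct_bvec_single ρ dec h, pbwMap_cons dec _ h]
  refine degLE_induction (p := fun z => pbwMap dec (indIncl j ρ) (symAct ρ dec ξ z) =
      UniversalEnvelopingAlgebra.ι k ξ • pbwMap dec (indIncl j ρ) z) (by simp)
    (fun z w h1 h2 => by simp only [map_add, smul_add, h1, h2]) (fun s v hs => ?_) hz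
  have gen := generator_induction dec j hj (fun ξ => pbwMap dec (indIncl j ρ)
      (symAct ρ dec ξ (Finsupp.single s v)) = UniversalEnvelopingAlgebra.ι k ξ •
        pbwMap dec (indIncl j ρ) (Finsupp.single s v))
      (fun x y h1 h2 => by simp only [map_add, LinearMap.add_apply, add_smul, h1, h2])
      (fun c x h => by simp only [map_smul, LinearMap.smul_apply, smul_assoc, h])
  by_cases h0 : s = 0
  · subst h0
    refine gen (fun y => ?_) (fun i => hb i _ v (by simp)) ξ
    rw [symAct_single_zero ρ dec (by rw [hj]), hj, pbwMap_zero, pbwMap_zero]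
    exact (ι_smul_indMk j ρ y v).symm
  · obtain ⟨l, T, rfl, hT⟩ := ne_zero_exists_cons h0
    rw [Multiset.card_cons] at hs
    have hTm : Finsupp.single T v ∈ degLE k M I T.card := single_mem_degLE le_rfl v
    have key : ∀ ξ : L, trunc dec l ξ = ξ → pbwMap dec (indIncl j ρ)
        (symAct ρ dec ξ (Finsupp.single (l ::ₘ T) v)) = UniversalEnvelopingAlgebra.ι k ξ •
          pbwMap dec (indIncl j ρ) (Finsupp.single (l ::ₘ T) v) := by
      intro ξ hξ
      have h1 : pbwMap dec (indIncl j ρ) (symAct ρ dec (bvec dec l)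
          (symAct ρ dec ξ (Finsupp.single T v))) = UniversalEnvelopingAlgebra.ι k (bvec dec l) •
            pbwMap dec (indIncl j ρ) (symAct ρ dec ξ (Finsupp.single T v)) := by
        rw [show symAct ρ dec ξ (Finsupp.single T v) =
          lead M dec ξ (Finsupp.single T v) + corr ρ dec ξ (Finsupp.single T v) from rfl,
          map_add, map_add, map_add, smul_add,
          ih T.card (by omega) _ _ (corr_mem ρ dec ξ hTm)]
        congr 1
        refine Submodule.span_induction (p := fun z _ => pbwMap dec (indIncl j ρ)
          (symAct ρ dec (bvec dec l) z) = UniversalEnvelopingAlgebra.ι k (bvec dec l) •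
            pbwMap dec (indIncl j ρ) z) ?_ (by simp)
          (fun _ _ _ _ h1 h2 => by simp only [map_add, smul_add, h1, h2])
          (fun c _ _ h => by simp only [map_smul, h, smul_comm c]) (lead_single_mem_span dec hξ T v)
        rintro _ ⟨i, hi, rfl⟩
        refine hb l _ v (fun t ht => ?_)
        rcases Multiset.mem_cons.mp ht with rfl | ht
        · exact hi.le
        · exact hT t ht
      have h2 := comm_all ρ dec j hj T.card ξ (bvec dec l) _ hTm
      unfold Comm at h2
      rw [symAct_bvec_single ρ dec hT] at h2
      rw [h2, map_add, h1, ih T.card (by omega) _ _ hTm, ih T.card (by omega) _ _ hTm,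
        pbwMap_cons dec _ hT, smul_smul, smul_smul, ← add_smul, LieHom.map_lie,
        LieRing.of_associative_ring_bracket]
      congr 1
      abel
    refine gen (fun y => key _ (htr l y)) (fun i => ?_) ξ
    rcases le_or_gt i l with h | h
    · refine hb i _ v (fun t ht => ?_)
      rcases Multiset.mem_cons.mp ht with rfl | ht
      · exact h
      · exact h.trans (hT t ht)
    · exact key _ (trunc_bvec_of_lt dec h)

/-- The Poincaré–Birkhoff–Witt theorem for induced modules. -/
theorem pbwMap_bijective : Function.Bijective (pbwMap dec (indIncl j ρ)) := by
  constructor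
  -- Injectivity: the action on the model yields, by the universal property, a map back from the
  -- induced module, and it is a left inverse.
  · let X : L →ₗ⁅k⁆ Module.End k (Multiset I →₀ M) :=
      { symAct ρ dec with map_lie' := fun {ξ η} => symAct_lie ρ dec j hj ξ η }
    let σ := UniversalEnvelopingAlgebra.lift k X
    have hσ : ∀ ξ, σ (UniversalEnvelopingAlgebra.ι k ξ) = symAct ρ dec ξ := fun ξ =>
      UniversalEnvelopingAlgebra.lift_ι_apply k X ξ
    obtain ⟨Φ, hΦ⟩ := exists_indLift (Z := Multiset I →₀ M) σ.toRingHom j ρ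
      (Finsupp.singleAddHom 0) (fun c v => by
        change _ = σ (algebraMap k _ c) _
        rw [AlgHom.commutes]
        simp) (fun y v => by
        change _ = σ _ _
        rw [hσ]
        change _ = symAct ρ dec (j y) (Finsupp.single 0 v)
        rw [symAct_single_zero ρ dec (by rw [hj]), hj]; rfl)
    have key : ∀ s v, Φ (pbwMap dec (indIncl j ρ) (Finsupp.single s v)) = Finsupp.single s v := by
      intro s v
      induction hn : s.card using Nat.strong_induction_on generalizing s with
      | _ n ih =>
      by_cases h0 : s = 0
      · subst h0
        rw [pbwMap_zero]
        exact hΦ v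
      · obtain ⟨l, T, rfl, hT⟩ := ne_zero_exists_cons h0
        rw [Multiset.card_cons] at hn
        rw [pbwMap_cons dec _ hT, map_smulₛₗ, ih T.card (by omega) T rfl]
        change σ _ _ = _
        rw [hσ, symAct_bvec_single ρ dec hT]
    refine Function.LeftInverse.injective (g := Φ) fun z => ?_
    induction z using Finsupp.induction_linear with
    | zero => rw [map_zero, LinearMap.map_zero]
    | add z w hz hw => rw [map_add, LinearMap.map_add, hz, hw]
    | single s v => exact key s v
  -- Surjectivity: the image contains the generators `1 ⊗ v` and is an `L`-submodule.
  · intro z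
    have hι : ∀ (ξ : L) (z : Ind j ρ), z ∈ LinearMap.range (pbwMap dec (indIncl j ρ)) →
        UniversalEnvelopingAlgebra.ι k ξ • z ∈ LinearMap.range (pbwMap dec (indIncl j ρ)) := by
      rintro ξ _ ⟨z, rfl⟩
      have hz : z ∈ degLE k M I (z.support.sup Multiset.card) := fun s hs =>
        Finset.le_sup (f := Multiset.card) hs
      exact ⟨_, pbwMap_equivariant dec ρ j hj _ ξ z hz⟩
    refine ind_induction (P := fun z => z ∈ LinearMap.range (pbwMap dec (indIncl j ρ)))
      (fun v => ⟨Finsupp.single 0 v, pbwMap_zero dec _ v⟩) (fun _ _ => add_mem)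
      (fun u z hz => uea_smul_mem (L := L) _ hι u hz) z
end PBW
end
end TwoPoint

namespace TwoPoint
noncomputable section

set_option linter.unusedSectionVars false

/-! ### Leading terms of expansions at infinity. -/

section Laurent
variable {k : Type} [CommRing k]

theorem polyInfty_coeff_neg (p : k[X]) (n : ℕ) : (polyInfty p).coeff (-(n : ℤ)) = p.coeff n := by
  induction p using Polynomial.induction_on' with
  | add p r hp hr => simp [hp, hr]
  | monomial m c =>
    rw [← Polynomial.C_mul_X_pow_eq_monomial, polyInfty_C_mul_X_pow]
    by_cases h : n = m
    · subst h; simp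
    · have h' : -(n : ℤ) ≠ -(m : ℤ) := by omega
      rw [HahnSeries.coeff_single_of_ne h', Polynomial.coeff_C_mul_X_pow, if_neg h]

theorem polyInfty_coeff_pos (p : k[X]) (n : ℤ) (hn : 0 < n) : (polyInfty p).coeff n = 0 := by
  induction p using Polynomial.induction_on' with
  | add p r hp hr => simp [hp, hr]
  | monomial m c =>
    rw [← Polynomial.C_mul_X_pow_eq_monomial, polyInfty_C_mul_X_pow]
    exact HahnSeries.coeff_single_of_ne (by omega)

/-- The Laurent series `F` has leading term `xⁿ`. -/
def HasLead (F : LaurentSeries k) (n : ℤ) : Prop := F.order = n ∧ F.leadingCoeff = 1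

theorem HasLead.coeff_self {F : LaurentSeries k} {n : ℤ} (h : HasLead F n) : F.coeff n = 1 := by
  rw [← h.2, HahnSeries.leadingCoeff_eq, h.1]

theorem HasLead.coeff_of_lt {F : LaurentSeries k} {n i : ℤ} (h : HasLead F n) (hi : i < n) :
    F.coeff i = 0 :=
  HahnSeries.coeff_eq_zero_of_lt_order (by rwa [h.1])

variable [IsDomain k]

theorem HasLead.ne_zero {F : LaurentSeries k} {n : ℤ} (h : HasLead F n) : F ≠ 0 := by
  rintro rfl
  exact zero_ne_one (HahnSeries.leadingCoeff_zero.symm.trans h.2)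

theorem HasLead.mul {F G : LaurentSeries k} {n m : ℤ} (h : HasLead F n) (h' : HasLead G m) :
    HasLead (F * G) (n + m) :=
  ⟨by rw [HahnSeries.order_mul h.ne_zero h'.ne_zero, h.1, h'.1],
    by rw [HahnSeries.leadingCoeff_mul, h.2, h'.2, one_mul]⟩

theorem HasLead.one : HasLead (1 : LaurentSeries k) 0 :=
  ⟨HahnSeries.order_one, HahnSeries.leadingCoeff_one⟩

theorem HasLead.pow {F : LaurentSeries k} {n : ℤ} (h : HasLead F n) (r : ℕ) :
    HasLead (F ^ r) (r * n) := by
  induction r with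
  | zero => simpa using HasLead.one
  | succ r ih =>
    rw [pow_succ]
    have := ih.mul h
    convert this using 1
    push_cast; ring

theorem HasLead.of_mul_eq_one {F G : LaurentSeries k} {n : ℤ} (h : HasLead F n) (hFG : F * G = 1) :
    HasLead G (-n) := by
  have hG : G ≠ 0 := by rintro rfl; simp at hFG
  constructor
  · have := congrArg HahnSeries.order hFG
    rw [HahnSeries.order_mul h.ne_zero hG, h.1, HahnSeries.order_one] at this
    omega
  · have := congrArg HahnSeries.leadingCoeff hFG
    rwa [HahnSeries.leadingCoeff_mul, h.2, one_mul, HahnSeries.leadingCoeff_one] at this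

theorem hasLead_polyInfty {q : k[X]} (hq : q.Monic) : HasLead (polyInfty q) (-(q.natDegree : ℤ)) := by
  have h1 : (polyInfty q).coeff (-(q.natDegree : ℤ)) = 1 := by
    rw [polyInfty_coeff_neg]; exact hq
  have h0 : polyInfty q ≠ 0 := by
    intro h; rw [h] at h1; simp at h1
  have ho : (polyInfty q).order = -(q.natDegree : ℤ) := by
    apply le_antisymm
    · exact HahnSeries.order_le_of_coeff_ne_zero (by rw [h1]; exact one_ne_zero)
    · by_contra hlt
      rw [not_le] at hlt
      refine mt HahnSeries.coeff_order_eq_zero.mp h0 ?_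
      obtain ⟨n, hn⟩ : ∃ n : ℕ, (polyInfty q).order = -(n : ℤ) :=
        ⟨(-(polyInfty q).order).toNat, by omega⟩
      rw [hn, polyInfty_coeff_neg]
      exact Polynomial.coeff_eq_zero_of_natDegree_lt (by omega)
  exact ⟨ho, by rw [HahnSeries.leadingCoeff_eq, ho, h1]⟩

theorem hasLead_invSelf {q : k[X]} (hq : q.Monic) :
    HasLead (expandInfty q hq (IsLocalization.Away.invSelf q)) q.natDegree := by
  have h := (hasLead_polyInfty hq).of_mul_eq_one
    (G := expandInfty q hq (IsLocalization.Away.invSelf q)) (by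
      rw [← expandInfty_poly q hq, ← map_mul, IsLocalization.Away.mul_invSelf, map_one])
  rwa [neg_neg] at h

end Laurent

/-! ### A free complement of `k[t] ⊗ g ⊕ k C` in the affine algebra. -/

section Decomposition
variable {k : Type} [CommRing k] [Algebra ℂ k] {q : k[X]} (hq : q.Monic) (τ : ℕ → Punctured q)

/-- The functions `τ_n` form a basis of a complement of `k[t]` in `k[t][1/q]`. -/
structure PolarBasis : Prop where
  lead : ∀ n : ℕ, HasLead (expandInfty q hq (τ n)) (n + 1)
  span : ∀ f : Punctured q, ∃ (p : k[X]) (c : ℕ →₀ k),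
    f = algebraMap k[X] (Punctured q) p + Finsupp.linearCombination k τ c

variable {hq τ}

/-- Expand in `x = t⁻¹`. Exponents at most `0` see only the polynomial, positive exponents see only
the `τ_n`, and there the system is triangular with ones on the diagonal because `τ_n` starts with
`x^{n+1}`. -/
theorem PolarBasis.injective (h : PolarBasis hq τ) {p : k[X]} {c : ℕ →₀ k}
    (h0 : algebraMap k[X] (Punctured q) p + Finsupp.linearCombination k τ c = 0) :
    p = 0 ∧ c = 0 := by
  have hc : ∀ i : ℤ, (expandInfty q hq (Finsupp.linearCombination k τ c)).coeff i =
      c.sum fun n r => r * (expandInfty q hq (τ n)).coeff i := by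
    intro i
    rw [Finsupp.linearCombination_apply, Finsupp.sum, map_sum, HahnSeries.coeff_sum]
    refine Finset.sum_congr rfl fun n _ => ?_
    rw [expandInfty_smul, HahnSeries.C_mul_eq_smul, HahnSeries.coeff_smul, smul_eq_mul]
  have hz : ∀ i : ℤ, (polyInfty p).coeff i +
      (c.sum fun n r => r * (expandInfty q hq (τ n)).coeff i) = 0 := by
    intro i
    rw [← hc, ← expandInfty_poly q hq, ← HahnSeries.coeff_add, ← map_add, h0, map_zero,
      HahnSeries.coeff_zero]
  constructor
  · ext n
    have := hz (-(n : ℤ))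
    rw [polyInfty_coeff_neg, Finsupp.sum, Finset.sum_eq_zero, add_zero] at this
    · simpa using this
    · intro m _
      rw [(h.lead m).coeff_of_lt (by omega), mul_zero]
  · ext n
    rw [Finsupp.zero_apply]
    induction n using Nat.strong_induction_on with
    | _ n ih =>
      have := hz (n + 1)
      rw [polyInfty_coeff_pos _ _ (by omega), zero_add, Finsupp.sum, Finset.sum_eq_single n,
        (h.lead n).coeff_self, mul_one] at this
      · exact this
      · intro m _ hm
        rcases Nat.lt_or_gt_of_ne hm with h' | h'
        · rw [ih m h', zero_mul]
        · rw [(h.lead m).coeff_of_lt (by omega), mul_zero]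
      · intro hn
        rw [Finsupp.notMem_support_iff.mp hn, zero_mul]

variable {g : Type} [LieRing g] [LieAlgebra ℂ g] {ι : Type} [Fintype ι]
  (b : Module.Basis ι ℂ g)

/-- The coordinate of an element of `K ⊗ g` with respect to a basis of `g`. -/
def loopCoord {k K : Type} [CommRing k] [CommRing K] [Algebra k K] [Algebra ℂ k] [Algebra ℂ K]
    [IsScalarTower ℂ k K] (b : Module.Basis ι ℂ g) (r : ι) : K ⊗[ℂ] g →ₗ[k] K :=
  ((Algebra.TensorProduct.basis K b).coord r).restrictScalars k

theorem loopCoord_tmul {k K : Type} [CommRing k] [CommRing K] [Algebra k K] [Algebra ℂ k]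
    [Algebra ℂ K] [IsScalarTower ℂ k K] (r : ι) (f : K) (x : g) :
    loopCoord (k := k) b r (f ⊗ₜ[ℂ] x) = b.repr x r • f := by
  simp [loopCoord, Algebra.smul_def, mul_comm]

theorem loopCoord_loopMap {k K K' : Type} [CommRing k] [CommRing K] [CommRing K'] [Algebra k K]
    [Algebra k K'] [Algebra ℂ k] [Algebra ℂ K] [Algebra ℂ K'] [IsScalarTower ℂ k K]
    [IsScalarTower ℂ k K'] (φ : K →ₐ[k] K') (r : ι) (ξ : K ⊗[ℂ] g) :
    loopCoord (k := k) b r (loopMap g φ ξ) = φ (loopCoord (k := k) b r ξ) := by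
  induction ξ using TensorProduct.induction_on with
  | zero => simp
  | add _ _ h₁ h₂ => simp only [map_add, h₁, h₂]
  | tmul f x =>
    rw [loopMap_tmul, loopCoord_tmul, loopCoord_tmul, ← algebraMap_smul k (b.repr x r) f, map_smul,
      algebraMap_smul]

theorem eq_zero_of_loopCoord {k K : Type} [CommRing k] [CommRing K] [Algebra k K] [Algebra ℂ k]
    [Algebra ℂ K] [IsScalarTower ℂ k K] {ξ : K ⊗[ℂ] g} (h : ∀ r, loopCoord (k := k) b r ξ = 0) :
    ξ = 0 := by
  rw [← (Algebra.TensorProduct.basis K b).forall_coord_eq_zero_iff]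
  exact h

theorem loop_add_left {k K : Type} [CommRing k] [CommRing K] [Algebra k K] [Algebra ℂ k]
    [Algebra ℂ K] [IsScalarTower ℂ k K] (c : LoopCocycle k K) (f f' : K) (x : g) :
    Affine.loop c (f + f') x = Affine.loop c f x + Affine.loop c f' x :=
  Prod.ext (TensorProduct.add_tmul _ _ _) (add_zero 0).symm

theorem loop_smul_left {k K : Type} [CommRing k] [CommRing K] [Algebra k K] [Algebra ℂ k]
    [Algebra ℂ K] [IsScalarTower ℂ k K] (c : LoopCocycle k K) (v : k) (f : K) (x : g) :
    Affine.loop c (v • f) x = v • Affine.loop c f x :=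
  Prod.ext rfl (smul_zero _).symm

theorem loop_add_right {k K : Type} [CommRing k] [CommRing K] [Algebra k K] [Algebra ℂ k]
    [Algebra ℂ K] [IsScalarTower ℂ k K] (c : LoopCocycle k K) (f : K) (x y : g) :
    Affine.loop c f (x + y) = Affine.loop c f x + Affine.loop c f y :=
  Prod.ext (TensorProduct.tmul_add _ _ _) (add_zero 0).symm

theorem loop_smul_right {k K : Type} [CommRing k] [CommRing K] [Algebra k K] [Algebra ℂ k]
    [Algebra ℂ K] [IsScalarTower ℂ k K] (c : LoopCocycle k K) (v : ℂ) (f : K) (x : g) :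
    Affine.loop c f (v • x) = algebraMap ℂ k v • Affine.loop c f x := by
  refine Prod.ext ?_ (smul_zero _).symm
  change f ⊗ₜ[ℂ] (v • x) = algebraMap ℂ k v • (f ⊗ₜ[ℂ] x)
  rw [algebraMap_smul, TensorProduct.tmul_smul]

/-- `f ↦ f x` as a linear map. -/
def loopLeft {k K : Type} [CommRing k] [CommRing K] [Algebra k K] [Algebra ℂ k]
    [Algebra ℂ K] [IsScalarTower ℂ k K] (c : LoopCocycle k K) (x : g) : K →ₗ[k] Affine g c where
  toFun f := Affine.loop c f x
  map_add' f f' := loop_add_left c f f' x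
  map_smul' v f := loop_smul_left c v f x

/-- The element of `K ⊗ g ⊕ k C` is the sum of its loop part and its central part. -/
theorem affine_induction {k K : Type} [CommRing k] [CommRing K] [Algebra k K] [Algebra ℂ k]
    [Algebra ℂ K] [IsScalarTower ℂ k K] (c : LoopCocycle k K) {P : Affine g c → Prop}
    (hadd : ∀ X Y, P X → P Y → P (X + Y)) (hloop : ∀ f x, P (Affine.loop c f x))
    (hC : ∀ v : k, P (v • Affine.central c)) (X : Affine g c) : P X := by
  let X₀ : Affine g c := (X.1, (0 : k))
  have h : X = X₀ + X.2 • Affine.central (g := g) c := by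
    refine Prod.ext ?_ ?_
    · change X.1 = X.1 + X.2 • 0
      rw [smul_zero, add_zero]
    · change X.2 = 0 + X.2 • (1 : k)
      simp
  rw [h]
  refine hadd _ _ ?_ (hC _)
  let F : K ⊗[ℂ] g → Affine g c := fun ξ => (ξ, (0 : k))
  have hF : ∀ ξ η, F (ξ + η) = F ξ + F η := fun ξ η => Prod.ext rfl (add_zero 0).symm
  change P (F X.1)
  generalize X.1 = ξ
  induction ξ using TensorProduct.induction_on with
  | zero =>
    have h0 := hloop 0 0
    rwa [Affine.loop, TensorProduct.zero_tmul] at h0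
  | add ξ η hξ hη =>
    rw [hF]
    exact hadd _ _ hξ hη
  | tmul f x => exact hloop f x

variable {I : Type} (e : I ≃ ℕ × ι)

variable (hq τ) in
/-- The map `k[t] ⊗ g ⊕ k C ⊕ ⊕ k τ_n b_r → k[t][1/q] ⊗ g ⊕ k C`. -/
def assemble : HatPlus g k × (I →₀ k) →ₗ[k] Hat g q hq :=
  LinearMap.coprod (plusIncl g q hq : HatPlus g k →ₗ[k] Hat g q hq)
    (Finsupp.linearCombination k fun i => Affine.loop (resCocycle q hq) (τ (e i).1) (b (e i).2))

theorem assemble_apply (y : HatPlus g k) (c : I →₀ k) :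
    assemble hq τ b e (y, c) = plusIncl g q hq y + Finsupp.linearCombination k
      (fun i => Affine.loop (resCocycle q hq) (τ (e i).1) (b (e i).2)) c := rfl

/-- Coordinates along the basis of `g` reduce the claim to `PolarBasis.injective`, one coordinate at
a time; the central coordinate is then read off directly. -/
theorem assemble_injective (h : PolarBasis hq τ) : Function.Injective (assemble hq τ b e) := by
  rw [injective_iff_map_eq_zero]
  rintro ⟨y, c⟩ hyc
  rw [assemble_apply] at hyc
  have hinj : ∀ r, Function.Injective fun n => e.symm (n, r) := fun r n m h => by simpa using h
  have hr : ∀ r, loopCoord (k := k) b r y.1 = 0 ∧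
      Finsupp.lcomapDomain (R := k) (fun n => e.symm (n, r)) (hinj r) c = 0 := by
    intro r
    refine h.injective ?_
    let π : Hat g q hq →ₗ[k] Punctured q :=
      loopCoord (k := k) b r ∘ₗ LinearMap.fst k (Punctured q ⊗[ℂ] g) k
    have h1 := congrArg π hyc
    rw [map_add, map_zero] at h1
    rw [← h1]
    congr 1
    · exact (loopCoord_loopMap (k := k) b (IsScalarTower.toAlgHom k k[X] (Punctured q)) r y.1).symm
    · have : Finsupp.linearCombination k τ ∘ₗ
          Finsupp.lcomapDomain (R := k) (fun n => e.symm (n, r)) (hinj r) =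
          π ∘ₗ Finsupp.linearCombination k (fun i => Affine.loop (resCocycle q hq) (τ (e i).1)
            (b (e i).2)) := by
        refine Finsupp.lhom_ext fun i v => ?_
        obtain ⟨⟨n, s⟩, rfl⟩ := e.symm.surjective i
        rw [LinearMap.comp_apply, LinearMap.comp_apply, Finsupp.linearCombination_single, map_smul,
          e.apply_symm_apply]
        change _ = v • loopCoord (k := k) b r (τ n ⊗ₜ[ℂ] b s)
        rw [loopCoord_tmul, b.repr_self]
        by_cases hs : s = r
        · subst hs
          have : Finsupp.lcomapDomain (R := k) (fun n => e.symm (n, s)) (hinj s)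
              (Finsupp.single (e.symm (n, s)) v) = Finsupp.single n v :=
            Finsupp.comapDomain_single (fun n => e.symm (n, s)) n v _
          rw [this]
          simp
        · have : Finsupp.lcomapDomain (R := k) (fun n => e.symm (n, r)) (hinj r)
              (Finsupp.single (e.symm (n, s)) v) = 0 := by
            ext m
            change Finsupp.single (e.symm (n, s)) v (e.symm (m, r)) = 0
            simp [hs]
          rw [this]
          simp [hs]
      exact LinearMap.congr_fun this c
  have hc : c = 0 := by
    ext i
    have := DFunLike.congr_fun (hr (e i).2).2 (e i).1
    change c (e.symm (e i)) = 0 at this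
    rwa [e.symm_apply_apply] at this
  subst hc
  have hy1 : y.1 = 0 := eq_zero_of_loopCoord (k := k) b fun r => (hr r).1
  rw [map_zero, add_zero] at hyc
  have hy2 : y.2 = 0 := congrArg Prod.snd hyc
  exact Prod.ext (Prod.ext hy1 hy2) rfl

theorem assemble_surjective (h : PolarBasis hq τ) : Function.Surjective (assemble hq τ b e) := by
  rw [← LinearMap.range_eq_top, eq_top_iff]
  have hpoly : ∀ y, plusIncl g q hq y ∈ LinearMap.range (assemble hq τ b e) := fun y =>
    ⟨(y, 0), by rw [assemble_apply, map_zero, add_zero]⟩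
  have hb : ∀ f r, Affine.loop (resCocycle q hq) f (b r) ∈ LinearMap.range (assemble hq τ b e) := by
    intro f r
    obtain ⟨p, c, rfl⟩ := h.span f
    rw [loop_add_left]
    refine add_mem (hpoly (Affine.loop (zeroCocycle k) p (b r))) ?_
    change loopLeft (resCocycle q hq) (b r) _ ∈ _
    rw [Finsupp.linearCombination_apply, Finsupp.sum, map_sum]
    refine Submodule.sum_mem _ fun n _ => ?_
    rw [map_smul]
    refine Submodule.smul_mem _ _ ⟨(0, Finsupp.single (e.symm (n, r)) 1), ?_⟩
    rw [assemble_apply, map_zero, zero_add, Finsupp.linearCombination_single, one_smul,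
      e.apply_symm_apply]
    rfl
  intro X _
  refine affine_induction _ (P := fun X => X ∈ LinearMap.range (assemble hq τ b e))
    (fun _ _ => add_mem) (fun f x => ?_) (fun v => Submodule.smul_mem _ _ ?_) X
  · rw [← b.sum_repr x]
    refine Finset.sum_induction _ (fun x => Affine.loop (resCocycle q hq) f x ∈
      LinearMap.range (assemble hq τ b e))
      (fun x y hx hy => by rw [loop_add_right]; exact add_mem hx hy) ?_
      fun r _ => by rw [loop_smul_right]; exact Submodule.smul_mem _ _ (hb f r)
    rw [Affine.loop, TensorProduct.tmul_zero]; exact zero_mem _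
  · have : Affine.central (g := g) (resCocycle q hq) = plusIncl g q hq (Affine.central (zeroCocycle k)) :=
      Prod.ext (map_zero (loopMap g _)).symm rfl
    rw [this]
    exact hpoly _

/-- The decomposition of `k[t][1/q] ⊗ g ⊕ k C` given by a basis of polar parts. -/
def hatDec (h : PolarBasis hq τ) : Hat g q hq ≃ₗ[k] HatPlus g k × (I →₀ k) :=
  (LinearEquiv.ofBijective (assemble hq τ b e)
    (show Function.Bijective _ from ⟨assemble_injective b e h, assemble_surjective b e h⟩)).symm

theorem hatDec_plusIncl (h : PolarBasis hq τ) (y : HatPlus g k) :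
    hatDec b e h (plusIncl g q hq y) = (y, 0) := by
  have h1 : plusIncl g q hq y = assemble hq τ b e (y, 0) := by
    rw [assemble_apply, map_zero, add_zero]
  rw [h1]
  exact (LinearEquiv.ofBijective (assemble hq τ b e) _).symm_apply_apply (y, 0)

theorem bvec_hatDec (h : PolarBasis hq τ) (i : I) :
    bvec (hatDec b e h) i = Affine.loop (resCocycle q hq) (τ (e i).1) (b (e i).2) := by
  have h1 : bvec (hatDec b e h) i = assemble hq τ b e (0, Finsupp.single i 1) := rfl
  rw [h1, assemble_apply, map_zero, zero_add, Finsupp.linearCombination_single, one_smul]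

end Decomposition
end
end TwoPoint

namespace TwoPoint
noncomputable section

/-! ### Explicit polar bases for one and two singular points. -/

section Polar

/-- The function `t^{-n-1}`. -/
def τ₁ (n : ℕ) : Punctured (Polynomial.X : ℂ[X]) :=
  IsLocalization.Away.invSelf (Polynomial.X : ℂ[X]) ^ (n + 1)

/-- The functions `t (ts)^{-r-1}` for `n = 2r` and `(ts)^{-r-1}` for `n = 2r + 1`. -/
def τ₂ (n : ℕ) : Punctured ts :=
  algebraMap A[X] (Punctured ts) (Polynomial.X ^ (1 - n % 2)) *
    IsLocalization.Away.invSelf ts ^ (n / 2 + 1)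

theorem exists_mul_pow_invSelf {k : Type} [CommRing k] (q : k[X]) (f : Punctured q) :
    ∃ (p : k[X]) (n : ℕ), f = algebraMap k[X] (Punctured q) p * IsLocalization.Away.invSelf q ^ n := by
  obtain ⟨n, p, h⟩ := IsLocalization.Away.surj q f
  refine ⟨p, n, ?_⟩
  rw [← h, mul_assoc, ← mul_pow, IsLocalization.Away.mul_invSelf, one_pow, mul_one]

/-- Division with remainder by `q`. -/
theorem polar_span {k : Type} [CommRing k] {q : k[X]} (hq : q.Monic) (τ : ℕ → Punctured q)
    (hτ : ∀ (r : k[X]) (n : ℕ), r.degree < q.degree →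
      algebraMap k[X] (Punctured q) r * IsLocalization.Away.invSelf q ^ (n + 1) ∈
        Submodule.span k (Set.range τ)) (f : Punctured q) :
    ∃ (p : k[X]) (c : ℕ →₀ k),
      f = algebraMap k[X] (Punctured q) p + Finsupp.linearCombination k τ c := by
  obtain ⟨p, n, rfl⟩ := exists_mul_pow_invSelf q f
  induction n generalizing p with
  | zero => exact ⟨p, 0, by simp⟩
  | succ n ih =>
    by_cases hk : Nontrivial k
    · obtain ⟨p', c, h⟩ := ih (p /ₘ q)
      obtain ⟨c', hc'⟩ := (Finsupp.mem_span_range_iff_exists_finsupp).mp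
        (hτ (p %ₘ q) n (Polynomial.degree_modByMonic_lt p hq))
      refine ⟨p', c + c', ?_⟩
      rw [map_add, ← add_assoc, ← h, Finsupp.linearCombination_apply k c', hc']
      conv_lhs => rw [← Polynomial.modByMonic_add_div p q]
      rw [map_add, map_mul, add_mul, add_comm]
      congr 1
      rw [pow_succ', mul_assoc, mul_left_comm, ← mul_assoc (algebraMap _ _ q),
        IsLocalization.Away.mul_invSelf, one_mul]
    · rw [not_nontrivial_iff_subsingleton] at hk
      have := Module.subsingleton k (Punctured q)
      exact ⟨0, 0, Subsingleton.elim _ _⟩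

theorem natDegree_lt_of_degree_lt {k : Type} [CommRing k] {r q : k[X]} (h : r.degree < q.degree)
    (hq : 0 < q.natDegree) : r.natDegree < q.natDegree := by
  by_cases h0 : r = 0
  · rwa [h0, Polynomial.natDegree_zero]
  · exact Polynomial.natDegree_lt_natDegree h0 h

theorem polarBasis₁ : PolarBasis Polynomial.monic_X τ₁ where
  lead n := by
    have h := (hasLead_invSelf (Polynomial.monic_X (R := ℂ))).pow (n + 1)
    rw [← map_pow] at h
    rw [τ₁]
    convert h using 1
    simp
  span := by
    refine polar_span Polynomial.monic_X τ₁ fun r n hr => ?_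
    have hr0 : r.natDegree = 0 := by
      have := natDegree_lt_of_degree_lt hr (by rw [Polynomial.natDegree_X]; exact one_pos)
      rw [Polynomial.natDegree_X] at this
      omega
    rw [Polynomial.eq_C_of_natDegree_eq_zero hr0, ← Polynomial.algebraMap_eq, ← IsScalarTower.algebraMap_apply, ← Algebra.smul_def]
    exact Submodule.smul_mem _ _ (Submodule.subset_span ⟨n, rfl⟩)

theorem natDegree_ts : ts.natDegree = 2 := by
  rw [ts, Polynomial.Monic.natDegree_mul Polynomial.monic_X (Polynomial.monic_X_sub_C a),
    Polynomial.natDegree_X, Polynomial.natDegree_X_sub_C]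

/-- Remainders modulo `ts` have degree at most one, so the numerators `t` and `1` suffice over each
power of `ts`. Their orders at infinity, `2r + 1` and `2r + 2` over `(ts)^{r+1}`, run through each
positive integer once. -/
theorem polarBasis₂ : PolarBasis ts_monic τ₂ where
  lead n := by
    have h := (hasLead_invSelf ts_monic).pow (n / 2 + 1)
    rw [← map_pow] at h
    have h2 := (hasLead_polyInfty (Polynomial.monic_X_pow (R := A) (1 - n % 2))).mul h
    rw [← expandInfty_poly ts ts_monic, ← map_mul] at h2
    rw [τ₂]
    convert h2 using 1
    rw [natDegree_ts, Polynomial.natDegree_X_pow]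
    push_cast
    omega
  span := by
    refine polar_span ts_monic τ₂ fun r n hr => ?_
    have hr2 : r.natDegree < 2 := by
      rw [← natDegree_ts]
      exact natDegree_lt_of_degree_lt hr (by rw [natDegree_ts]; exact two_pos)
    have h0 : τ₂ (2 * n + 1) = IsLocalization.Away.invSelf ts ^ (n + 1) := by
      rw [τ₂, show (2 * n + 1) % 2 = 1 by omega, show (2 * n + 1) / 2 = n by omega]; simp
    have h1 : τ₂ (2 * n) =
        algebraMap A[X] _ Polynomial.X * IsLocalization.Away.invSelf ts ^ (n + 1) := by
      rw [τ₂, show (2 * n) % 2 = 0 by omega, show (2 * n) / 2 = n by omega]; simp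
    rw [Polynomial.as_sum_range_C_mul_X_pow' r hr2]
    simp only [Finset.sum_range_succ, Finset.sum_range_zero, zero_add, pow_zero, mul_one, pow_one,
      map_add, map_mul, add_mul]
    rw [mul_assoc, ← h1, ← h0, ← Polynomial.algebraMap_eq, ← IsScalarTower.algebraMap_apply,
      ← IsScalarTower.algebraMap_apply, ← Algebra.smul_def, ← Algebra.smul_def]
    exact add_mem (Submodule.smul_mem _ _ (Submodule.subset_span ⟨_, rfl⟩))
      (Submodule.smul_mem _ _ (Submodule.subset_span ⟨_, rfl⟩))

/-- At `a = 0` the product `ts` becomes `t²`. The two bases are indexed to correspond, so that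
ordered monomials for `ĝ₂` specialise to ordered monomials for `ĝ₁`. -/
theorem spK_τ₂ (n : ℕ) : spK (τ₂ n) = τ₁ n := by
  have hX : algebraMap ℂ[X] (Punctured (Polynomial.X : ℂ[X])) Polynomial.X *
    IsLocalization.Away.invSelf (Polynomial.X : ℂ[X]) = 1 := IsLocalization.Away.mul_invSelf _
  have h : spK (IsLocalization.Away.invSelf ts) =
      IsLocalization.Away.invSelf (Polynomial.X : ℂ[X]) ^ 2 := by
    have h1 : spK (algebraMap A[X] _ ts) * spK (IsLocalization.Away.invSelf ts) = 1 := by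
      rw [← map_mul, IsLocalization.Away.mul_invSelf, map_one]
    rw [spK_poly, spPoly_ts, map_mul] at h1
    calc _ = (algebraMap ℂ[X] (Punctured (Polynomial.X : ℂ[X])) Polynomial.X *
        IsLocalization.Away.invSelf (Polynomial.X : ℂ[X])) ^ 2 *
        spK (IsLocalization.Away.invSelf ts) := by rw [hX]; ring
      _ = IsLocalization.Away.invSelf (Polynomial.X : ℂ[X]) ^ 2 *
        (algebraMap ℂ[X] (Punctured (Polynomial.X : ℂ[X])) Polynomial.X *
          algebraMap ℂ[X] (Punctured (Polynomial.X : ℂ[X])) Polynomial.X *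
          spK (IsLocalization.Away.invSelf ts)) := by ring
      _ = _ := by rw [h1, mul_one]
  rw [τ₂, τ₁, map_mul, map_pow spK, h, spK_poly]
  have hp : spPoly (Polynomial.X ^ (1 - n % 2)) = Polynomial.X ^ (1 - n % 2) := by simp [spPoly]
  rw [hp, map_pow, ← pow_mul]
  rcases Nat.mod_two_eq_zero_or_one n with h | h
  · rw [h, show 2 * (n / 2 + 1) = n + 1 + 1 by omega, Nat.sub_zero, pow_one, pow_succ', ← mul_assoc,
      hX, one_mul]
  · rw [h, show 2 * (n / 2 + 1) = n + 1 by omega]; simp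

end Polar

/-! ### The standard basis of `sl(2)` and values of the Killing form. -/

section Sl2Basis

/-- The element `h` of `sl(2)`. -/
def sl2h : sl2 := ⟨!![1, 0; 0, -1], by
  change Matrix.trace !![(1 : ℂ), 0; 0, -1] = 0
  simp [Matrix.trace_fin_two]⟩

/-- The element `f` of `sl(2)`. -/
def sl2f : sl2 := ⟨!![0, 0; 1, 0], by
  change Matrix.trace !![(0 : ℂ), 0; 1, 0] = 0
  simp [Matrix.trace_fin_two]⟩

theorem sl2_decomp (x : sl2) : x = x.1 0 1 • sl2e + x.1 0 0 • sl2h + x.1 1 0 • sl2f := by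
  have h : x.1 1 1 = - x.1 0 0 := by
    have h : Matrix.trace x.1 = 0 := x.2
    rw [Matrix.trace_fin_two] at h
    linear_combination h
  apply Subtype.ext
  change x.1 = x.1 0 1 • !![0, 1; 0, 0] + x.1 0 0 • !![1, 0; 0, -1] + x.1 1 0 • !![0, 0; 1, 0]
  ext i j
  fin_cases i <;> fin_cases j <;> simp [h]

/-- The basis `e`, `h`, `f` of `sl(2)`. -/
def sl2Basis : Module.Basis (Fin 3) ℂ sl2 := Module.Basis.ofEquivFun
  { toFun := fun x => ![x.1 0 1, x.1 0 0, x.1 1 0]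
    map_add' := fun x y => by ext i; fin_cases i <;> rfl
    map_smul' := fun c x => by ext i; fin_cases i <;> rfl
    invFun := fun v => v 0 • sl2e + v 1 • sl2h + v 2 • sl2f
    left_inv := fun x => (sl2_decomp x).symm
    right_inv := fun v => by
      ext i
      fin_cases i <;> simp [sl2e, sl2h, sl2f] }

theorem lie_h_e : ⁅sl2h, sl2e⁆ = (2 : ℂ) • sl2e := by
  apply Subtype.ext
  change !![(1 : ℂ), 0; 0, -1] * !![0, 1; 0, 0] - !![0, 1; 0, 0] * !![1, 0; 0, -1] =
    (2 : ℂ) • !![0, 1; 0, 0]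
  ext i j
  fin_cases i <;> fin_cases j <;> norm_num

theorem lie_h_f : ⁅sl2h, sl2f⁆ = (-2 : ℂ) • sl2f := by
  apply Subtype.ext
  change !![(1 : ℂ), 0; 0, -1] * !![0, 0; 1, 0] - !![0, 0; 1, 0] * !![1, 0; 0, -1] =
    (-2 : ℂ) • !![0, 0; 1, 0]
  ext i j
  fin_cases i <;> fin_cases j <;> norm_num

theorem lie_e_f : ⁅sl2e, sl2f⁆ = sl2h := by
  apply Subtype.ext
  change !![(0 : ℂ), 1; 0, 0] * !![0, 0; 1, 0] - !![0, 0; 1, 0] * !![0, 1; 0, 0] = !![1, 0; 0, -1]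
  ext i j
  fin_cases i <;> fin_cases j <;> simp

theorem killing_aux (x y : sl2) : killingForm ℂ sl2 x y =
    ∑ i, sl2Basis.repr ⁅x, ⁅y, sl2Basis i⁆⁆ i := by
  rw [killingForm_apply_apply, LinearMap.trace_eq_matrix_trace ℂ sl2Basis, Matrix.trace]
  refine Finset.sum_congr rfl fun i _ => ?_
  rw [Matrix.diag_apply, LinearMap.toMatrix_apply]; rfl

theorem sl2Basis_zero : sl2Basis 0 = sl2e := by
  rw [sl2Basis, Module.Basis.coe_ofEquivFun]
  change (Pi.single 0 1 : Fin 3 → ℂ) 0 • sl2e + (Pi.single 0 1 : Fin 3 → ℂ) 1 • sl2h +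
    (Pi.single 0 1 : Fin 3 → ℂ) 2 • sl2f = _
  simp

theorem sl2Basis_one : sl2Basis 1 = sl2h := by
  rw [sl2Basis, Module.Basis.coe_ofEquivFun]
  change (Pi.single 1 1 : Fin 3 → ℂ) 0 • sl2e + (Pi.single 1 1 : Fin 3 → ℂ) 1 • sl2h +
    (Pi.single 1 1 : Fin 3 → ℂ) 2 • sl2f = _
  simp

theorem sl2Basis_two : sl2Basis 2 = sl2f := by
  rw [sl2Basis, Module.Basis.coe_ofEquivFun]
  change (Pi.single 2 1 : Fin 3 → ℂ) 0 • sl2e + (Pi.single 2 1 : Fin 3 → ℂ) 1 • sl2h +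
    (Pi.single 2 1 : Fin 3 → ℂ) 2 • sl2f = _
  simp

theorem lie_e_h : ⁅sl2e, sl2h⁆ = (-2 : ℂ) • sl2e := by rw [← lie_skew, lie_h_e, neg_smul]
theorem lie_f_h : ⁅sl2f, sl2h⁆ = (2 : ℂ) • sl2f := by rw [← lie_skew, lie_h_f, neg_smul, neg_neg]
theorem lie_f_e : ⁅sl2f, sl2e⁆ = (-1 : ℂ) • sl2h := by rw [← lie_skew, lie_e_f, neg_one_smul]

/-- With `C` acting as `-1/2`, the value `4` yields the central contribution `-2` used in
`tp_one_f_eVec`. -/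
theorem killing_f_e : killingForm ℂ sl2 sl2f sl2e = 4 := by
  rw [killing_aux, Fin.sum_univ_three, sl2Basis_zero, sl2Basis_one, sl2Basis_two, lie_self, lie_zero,
    lie_e_h, lie_smul, lie_f_e, lie_e_f, lie_f_h, ← sl2Basis_one, ← sl2Basis_two, smul_smul, map_smul,
    map_smul, sl2Basis.repr_self, sl2Basis.repr_self]
  simp; norm_num

theorem killing_h_e : killingForm ℂ sl2 sl2h sl2e = 0 := by
  rw [killing_aux, Fin.sum_univ_three, sl2Basis_zero, sl2Basis_one, sl2Basis_two, lie_self, lie_zero,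
    lie_e_h, lie_smul, lie_h_e, lie_e_f, lie_self, ← sl2Basis_zero, smul_smul, map_smul,
    sl2Basis.repr_self]
  simp

theorem killing_e_e : killingForm ℂ sl2 sl2e sl2e = 0 := by
  rw [killing_aux, Fin.sum_univ_three, sl2Basis_zero, sl2Basis_one, sl2Basis_two, lie_self, lie_zero,
    lie_e_h, lie_smul, lie_self, lie_e_f, lie_e_h, smul_zero, ← sl2Basis_zero, map_smul,
    sl2Basis.repr_self]
  simp

end Sl2Basis
end
end TwoPoint

namespace TwoPoint
noncomputable section

attribute [local instance 100] LieRing.ofAssociativeRing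

/-! ### Highest weight vectors in arbitrary `sl(2)`-modules. -/

section HighestWeight
variable {Z : Type} [AddCommGroup Z] [Module ℂ Z] (π : sl2 →ₗ⁅ℂ⁆ Module.End ℂ Z)

theorem rep_lie (x y : sl2) (z : Z) : π x (π y z) = π y (π x z) + π ⁅x, y⁆ z := by
  rw [LieHom.map_lie, LieRing.of_associative_ring_bracket, LinearMap.sub_apply,
    Module.End.mul_apply, Module.End.mul_apply]
  abel

theorem rep_decomp (x : sl2) :
    π x = x.1 0 1 • π sl2e + x.1 0 0 • π sl2h + x.1 1 0 • π sl2f := by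
  conv_lhs => rw [sl2_decomp x]
  rw [map_add, map_add, map_smul, map_smul, map_smul]

variable {π} {y : Z} {n : ℂ}

theorem h_pow_f (hh : π sl2h y = n • y) (k : ℕ) :
    π sl2h ((π sl2f ^ k) y) = (n - 2 * k) • (π sl2f ^ k) y := by
  induction k with
  | zero => simp [hh]
  | succ k ih =>
    rw [pow_succ', Module.End.mul_apply, rep_lie, ih, lie_h_f, map_smul, map_smul,
      LinearMap.smul_apply, ← add_smul]
    congr 1
    push_cast; ring

theorem e_pow_f (he : π sl2e y = 0) (hh : π sl2h y = n • y) (k : ℕ) :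
    π sl2e ((π sl2f ^ (k + 1)) y) = ((k + 1) * (n - k)) • (π sl2f ^ k) y := by
  induction k with
  | zero =>
    rw [zero_add, pow_one, pow_zero, rep_lie, he, lie_e_f, hh]; simp
  | succ k ih =>
    rw [pow_succ', Module.End.mul_apply, rep_lie, ih, lie_e_f, h_pow_f hh, map_smul,
      ← Module.End.mul_apply, ← pow_succ', ← add_smul]
    congr 1
    push_cast; ring

/-- If `f^{k+1} y = 0` with `k > n`, applying `e` gives the nonzero multiple `(k+1)(n-k)` of `f^k
y`, so the exponent can be lowered until it reaches `n + 1`. -/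
theorem pow_f_eq_zero {n : ℕ} (he : π sl2e y = 0) (hh : π sl2h y = (n : ℂ) • y) {N : ℕ}
    (hN : (π sl2f ^ N) y = 0) : (π sl2f ^ (n + 1)) y = 0 := by
  induction N with
  | zero =>
    rw [pow_zero, Module.End.one_apply] at hN
    rw [hN, map_zero]
  | succ k ih =>
    by_cases hk : k ≤ n
    · obtain ⟨d, rfl⟩ := Nat.exists_eq_add_of_le hk
      rw [show k + d + 1 = d + (k + 1) by ring, pow_add, Module.End.mul_apply, hN, map_zero]
    · apply ih
      have h := e_pow_f he hh k
      rw [hN, map_zero, eq_comm, smul_eq_zero] at h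
      refine h.resolve_left (mul_ne_zero (by exact_mod_cast Nat.succ_ne_zero k) ?_)
      rw [sub_ne_zero]
      exact_mod_cast (by omega : n ≠ k)

end HighestWeight

/-! ### The modules of binary forms: weight basis and irreducibility. -/

section Irreducible
open MvPolynomial

theorem polyAct_e (b c : ℕ) : polyAct sl2e.1 (X 0 ^ b * X 1 ^ c) =
    (c : ℂ) • (X 0 ^ (b + 1) * X 1 ^ (c - 1) : MvPolynomial (Fin 2) ℂ) := by
  rw [Derivation.leibniz, Derivation.leibniz_pow, Derivation.leibniz_pow, polyAct_X, polyAct_X]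
  simp [sl2e, Fin.sum_univ_two, smul_eq_C_mul]
  ring

theorem polyAct_f (b c : ℕ) : polyAct sl2f.1 (X 0 ^ b * X 1 ^ c) =
    (b : ℂ) • (X 0 ^ (b - 1) * X 1 ^ (c + 1) : MvPolynomial (Fin 2) ℂ) := by
  rw [Derivation.leibniz, Derivation.leibniz_pow, Derivation.leibniz_pow, polyAct_X, polyAct_X]
  simp [sl2f, Fin.sum_univ_two, smul_eq_C_mul]
  ring

theorem polyAct_h (b c : ℕ) : polyAct sl2h.1 (X 0 ^ b * X 1 ^ c) =
    ((b : ℂ) - c) • (X 0 ^ b * X 1 ^ c : MvPolynomial (Fin 2) ℂ) := by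
  rw [Derivation.leibniz, Derivation.leibniz_pow, Derivation.leibniz_pow, polyAct_X, polyAct_X]
  rcases b with _ | b <;> rcases c with _ | c <;>
    simp only [sl2h, Fin.sum_univ_two, smul_eq_C_mul, Nat.add_sub_cancel, pow_zero, Nat.cast_zero,
      Nat.cast_add, Nat.cast_one, pow_succ, smul_eq_mul, nsmul_eq_mul, map_sub, map_add, map_one,
      map_zero, map_natCast, Matrix.of_apply, Matrix.cons_val', Matrix.cons_val_zero,
      Matrix.cons_val_one, Matrix.cons_val_fin_one, map_neg] <;> ring

/-- A homogeneous polynomial of degree `n`, as an element of `Vⁿ`. -/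
def Vrep.mk {n : ℕ} (p : MvPolynomial (Fin 2) ℂ) (hp : p ∈ homogeneousSubmodule (Fin 2) ℂ n) :
    Vrep n := ⟨p, hp⟩

theorem X_pow_mul_X_pow_mem {n k : ℕ} (h : k ≤ n) :
    (X 0 ^ (n - k) * X 1 ^ k : MvPolynomial (Fin 2) ℂ) ∈ homogeneousSubmodule (Fin 2) ℂ n := by
  rw [mem_homogeneousSubmodule]
  have := ((isHomogeneous_X ℂ (0 : Fin 2)).pow (n - k)).mul
    ((isHomogeneous_X ℂ (1 : Fin 2)).pow k)
  simpa [Nat.sub_add_cancel h] using this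

/-- The weight vector `X₀ⁿ⁻ᵏ X₁ᵏ` of `Vⁿ` (and `0` for `k > n`). -/
def wvec (n k : ℕ) : Vrep n :=
  if h : k ≤ n then Vrep.mk (X 0 ^ (n - k) * X 1 ^ k) (X_pow_mul_X_pow_mem h) else 0

theorem wvec_val {n k : ℕ} (h : k ≤ n) :
    (wvec n k).1 = (X 0 ^ (n - k) * X 1 ^ k : MvPolynomial (Fin 2) ℂ) := by
  rw [wvec, dif_pos h]; rfl

theorem wvec_of_lt {n k : ℕ} (h : n < k) : wvec n k = 0 := by
  rw [wvec, dif_neg (by omega)]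

theorem wvec_zero (n : ℕ) : wvec n 0 = hwVec n := by
  apply Subtype.ext
  rw [wvec_val (Nat.zero_le n)]
  simp [hwVec]

theorem e_wvec {n k : ℕ} (h : k ≤ n) : ⁅sl2e, wvec n k⁆ = (k : ℂ) • wvec n (k - 1) := by
  apply Subtype.ext
  change polyAct sl2e.1 (wvec n k).1 = (k : ℂ) • (wvec n (k - 1)).1
  rw [wvec_val h, wvec_val (by omega), polyAct_e]
  rcases k with _ | k
  · simp
  · rw [show n - (k + 1) + 1 = n - (k + 1 - 1) by omega]

theorem f_wvec {n k : ℕ} (h : k ≤ n) : ⁅sl2f, wvec n k⁆ = ((n : ℂ) - k) • wvec n (k + 1) := by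
  rcases h.eq_or_lt with rfl | h'
  · rw [sub_self, zero_smul]
    apply Subtype.ext
    change polyAct sl2f.1 (wvec k k).1 = 0
    rw [wvec_val h, polyAct_f]; simp
  · apply Subtype.ext
    change polyAct sl2f.1 (wvec n k).1 = ((n : ℂ) - k) • (wvec n (k + 1)).1
    rw [wvec_val h, wvec_val h', polyAct_f, Nat.cast_sub h, Nat.sub_sub]

theorem h_wvec {n k : ℕ} (h : k ≤ n) : ⁅sl2h, wvec n k⁆ = ((n : ℂ) - 2 * k) • wvec n k := by
  apply Subtype.ext
  change polyAct sl2h.1 (wvec n k).1 = ((n : ℂ) - 2 * k) • (wvec n k).1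
  rw [wvec_val h, polyAct_h, Nat.cast_sub h]
  congr 1; ring

theorem coeff_X_pow_mul_X_pow (b c : ℕ) (d : Fin 2 →₀ ℕ) :
    coeff d (X 0 ^ b * X 1 ^ c : MvPolynomial (Fin 2) ℂ) = if d 0 = b ∧ d 1 = c then 1 else 0 := by
  rw [X_pow_eq_monomial, X_pow_eq_monomial, monomial_mul, coeff_monomial, one_mul]
  congr 1
  rw [eq_iff_iff, Finsupp.ext_iff, Fin.forall_fin_two]
  simp [eq_comm]

/-- The basis of weight vectors of `Vⁿ`. -/
def wBasis (n : ℕ) : Module.Basis (Fin (n + 1)) ℂ (Vrep n) := Module.Basis.ofEquivFun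
  { toFun := fun p k => coeff (Finsupp.single 0 (n - k) + Finsupp.single 1 (k : ℕ)) p.1
    map_add' := fun p r => by ext k; exact coeff_add _ _ _
    map_smul' := fun c p => by ext k; exact coeff_smul _ _ _
    invFun := fun v => ∑ k : Fin (n + 1), v k • wvec n k
    left_inv := fun p => by
      apply Subtype.ext
      have h : ∀ v : Fin (n + 1) → ℂ, (∑ k : Fin (n + 1), v k • wvec n k).1 =
          ∑ k : Fin (n + 1), v k • (X 0 ^ (n - (k : ℕ)) * X 1 ^ (k : ℕ) : MvPolynomial (Fin 2) ℂ) := by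
        intro v
        have := map_sum (homogeneousSubmodule (Fin 2) ℂ n).subtype (fun k => v k • wvec n k)
          Finset.univ
        refine this.trans (Finset.sum_congr rfl fun k _ => ?_)
        change v k • (wvec n k).1 = _
        rw [wvec_val (by omega)]
      rw [h]
      ext d
      rw [coeff_sum]
      simp only [coeff_smul, coeff_X_pow_mul_X_pow, smul_eq_mul, mul_ite, mul_one, mul_zero]
      by_cases hd : d 0 + d 1 = n
      · have hd1 : d 1 < n + 1 := by omega
        rw [Finset.sum_eq_single ⟨d 1, hd1⟩]
        · rw [if_pos ⟨by dsimp only; omega, rfl⟩]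
          congr 1
          rw [Finsupp.ext_iff, Fin.forall_fin_two]
          simp; omega
        · intro k _ hk
          rw [if_neg]
          rintro ⟨-, h2⟩
          exact hk (Fin.ext h2.symm)
        · simp
      · have hp : p.1.IsHomogeneous n := (mem_homogeneousSubmodule _ _).mp p.2
        rw [hp.coeff_eq_zero]
        · refine Finset.sum_eq_zero fun k _ => if_neg ?_
          rintro ⟨h1, h2⟩
          omega
        · rwa [Finsupp.degree_eq_sum, Fin.sum_univ_two]
    right_inv := fun v => by
      ext k
      have h : (∑ k : Fin (n + 1), v k • wvec n k).1 =
          ∑ k : Fin (n + 1), v k • (X 0 ^ (n - (k : ℕ)) * X 1 ^ (k : ℕ) : MvPolynomial (Fin 2) ℂ) := by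
        have := map_sum (homogeneousSubmodule (Fin 2) ℂ n).subtype (fun k => v k • wvec n k)
          Finset.univ
        refine this.trans (Finset.sum_congr rfl fun k _ => ?_)
        change v k • (wvec n k).1 = _
        rw [wvec_val (by omega)]
      change coeff _ (∑ k : Fin (n + 1), v k • wvec n k).1 = v k
      rw [h, coeff_sum, Finset.sum_eq_single k]
      · rw [coeff_smul, coeff_X_pow_mul_X_pow]
        simp
      · intro k' _ hk
        rw [coeff_smul, coeff_X_pow_mul_X_pow, if_neg]
        · simp
        · rintro ⟨-, h2⟩
          apply hk
          simp at h2
          exact Fin.ext h2.symm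
      · simp }

theorem wBasis_apply (n : ℕ) (k : Fin (n + 1)) : wBasis n k = wvec n k := by
  rw [wBasis, Module.Basis.coe_ofEquivFun]
  change ∑ i : Fin (n + 1), (Pi.single k 1 : Fin (n + 1) → ℂ) i • wvec n i = _
  rw [Finset.sum_eq_single k]
  · simp
  · intro i _ hi
    simp [hi]
  · simp

variable {Z : Type} [AddCommGroup Z] [Module ℂ Z] (π : sl2 →ₗ⁅ℂ⁆ Module.End ℂ Z)

/-- A highest weight vector of weight `n` killed by `f^{n+1}` is the image of that of `Vⁿ`. -/
theorem exists_hom_of_hw {n : ℕ} {y : Z} (he : π sl2e y = 0) (hh : π sl2h y = (n : ℂ) • y)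
    (hf : (π sl2f ^ (n + 1)) y = 0) :
    ∃ φ : Vrep n →ₗ[ℂ] Z, φ (hwVec n) = y ∧ ∀ x v, φ ⁅x, v⁆ = π x (φ v) := by
  -- The scalars are forced by `f^k X₀ⁿ = n!/(n-k)! · X₀ⁿ⁻ᵏ X₁ᵏ`.
  let φ : Vrep n →ₗ[ℂ] Z := (wBasis n).constr ℂ fun k : Fin (n + 1) =>
    (((n - k : ℕ).factorial : ℂ) / n.factorial) • (π sl2f ^ (k : ℕ)) y
  have hφ : ∀ k, k ≤ n → φ (wvec n k) =
      (((n - k : ℕ).factorial : ℂ) / n.factorial) • (π sl2f ^ k) y := by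
    intro k hk
    have := (wBasis n).constr_basis ℂ (fun k : Fin (n + 1) =>
      (((n - k : ℕ).factorial : ℂ) / n.factorial) • (π sl2f ^ (k : ℕ)) y) ⟨k, by omega⟩
    rwa [wBasis_apply] at this
  have hn : (n.factorial : ℂ) ≠ 0 := by exact_mod_cast n.factorial_ne_zero
  have hstep : ∀ k, k < n → ((n - k : ℕ).factorial : ℂ) = (n - k) * (n - (k + 1) : ℕ).factorial := by
    intro k hk
    obtain ⟨d, rfl⟩ := Nat.exists_eq_add_of_lt hk
    rw [show k + d + 1 - k = d + 1 by omega, show k + d + 1 - (k + 1) = d by omega,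
      Nat.factorial_succ]
    push_cast; ring
  have ext : ∀ x, (∀ k, k ≤ n → φ ⁅x, wvec n k⁆ = π x (φ (wvec n k))) →
      ∀ v, φ ⁅x, v⁆ = π x (φ v) := by
    intro x hx v
    have : φ ∘ₗ LieModule.toEnd ℂ sl2 (Vrep n) x = π x ∘ₗ φ := by
      refine (wBasis n).ext fun k => ?_
      rw [wBasis_apply]
      exact hx k (by omega)
    exact LinearMap.congr_fun this v
  have hE := ext sl2e fun k hk => by
    rw [e_wvec hk, map_smul, hφ _ hk, hφ _ (by omega), map_smul]
    rcases k with _ | k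
    · simp [he]
    · rw [e_pow_f he hh, smul_smul, smul_smul, Nat.add_sub_cancel, hstep k (by omega)]
      congr 1
      push_cast; ring
  have hF := ext sl2f fun k hk => by
    rw [f_wvec hk, map_smul, hφ _ hk, map_smul, ← Module.End.mul_apply, ← pow_succ']
    -- At the lowest weight vector `k = n` equivariance under `f` is exactly the hypothesis `f^{n+1}
    -- y = 0`.
    rcases hk.eq_or_lt with rfl | h'
    · rw [hf]; simp
    · rw [hφ _ h', smul_smul, hstep k h', mul_div_assoc]
  have hH := ext sl2h fun k hk => by
    rw [h_wvec hk, map_smul, hφ _ hk, map_smul, h_pow_f hh, smul_comm]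
  refine ⟨φ, ?_, fun x v => ?_⟩
  · rw [← wvec_zero, hφ 0 (Nat.zero_le n)]
    simp [hn]
  · conv_lhs => rw [sl2_decomp x]
    rw [rep_decomp π x, add_lie, add_lie, smul_lie, smul_lie, smul_lie, map_add, map_add, map_smul,
      map_smul, map_smul, hE, hF, hH]
    rfl

/-- `e` sends `wvec n (k+1)` to a nonzero multiple of `wvec n k`, so it is injective on the span of
the lower weight vectors. -/
theorem eq_smul_hwVec {n : ℕ} {v : Vrep n} (h : ⁅sl2e, v⁆ = 0) : ∃ c : ℂ, v = c • hwVec n := by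
  rw [← (wBasis n).sum_repr v, Fin.sum_univ_succ, lie_add, lie_sum, lie_smul, wBasis_apply,
    e_wvec (by omega)] at h
  have h2 : ∑ i : Fin n, ((wBasis n).repr v i.succ * (i.1 + 1)) • wBasis n i.castSucc = 0 := by
    rw [← h]
    simp only [Fin.val_zero, Nat.cast_zero, zero_smul, smul_zero, zero_add]
    refine Finset.sum_congr rfl fun i _ => ?_
    rw [lie_smul, wBasis_apply, wBasis_apply, e_wvec (by omega), smul_smul]
    simp
  have h3 := Fintype.linearIndependent_iff.mp
    ((wBasis n).linearIndependent.comp _ (Fin.castSucc_injective n)) _ h2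
  refine ⟨(wBasis n).repr v 0, ?_⟩
  conv_lhs => rw [← (wBasis n).sum_repr v, Fin.sum_univ_succ, wBasis_apply]
  rw [Finset.sum_eq_zero, add_zero]
  · exact congrArg _ (wvec_zero n)
  · intro i _
    have := (mul_eq_zero.mp (h3 i)).resolve_right (by exact_mod_cast Nat.succ_ne_zero i.1)
    rw [this, zero_smul]

theorem e_pow_nilpotent (n : ℕ) (v : Vrep n) : ∃ N, (LieModule.toEnd ℂ sl2 (Vrep n) sl2e ^ N) v = 0 := by
  have hw : ∀ k, k ≤ n → (LieModule.toEnd ℂ sl2 (Vrep n) sl2e ^ (k + 1)) (wvec n k) = 0 := by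
    intro k
    induction k with
    | zero =>
      intro h
      rw [zero_add, pow_one, LieModule.toEnd_apply_apply, e_wvec h]; simp
    | succ k ih =>
      intro h
      rw [pow_succ, Module.End.mul_apply, LieModule.toEnd_apply_apply, e_wvec h, map_smul,
        Nat.add_sub_cancel, ih (by omega), smul_zero]
  refine ⟨n + 1, ?_⟩
  have : LieModule.toEnd ℂ sl2 (Vrep n) sl2e ^ (n + 1) = 0 := by
    refine (wBasis n).ext fun k => ?_
    obtain ⟨d, hd⟩ : ∃ d, n + 1 = d + (k.1 + 1) := ⟨n - k, by omega⟩
    rw [wBasis_apply, congrArg (LieModule.toEnd ℂ sl2 (Vrep n) sl2e ^ ·) hd]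
    rw [pow_add, Module.End.mul_apply, hw k (by omega), map_zero, LinearMap.zero_apply]
  rw [this, LinearMap.zero_apply]

/-- A homomorphism from `Vⁿ` not vanishing on the highest weight vector is injective. -/
theorem injective_of_hwVec_ne_zero {n : ℕ} {φ : Vrep n →ₗ[ℂ] Z}
    (hφ : ∀ v, φ ⁅sl2e, v⁆ = π sl2e (φ v)) (h : φ (hwVec n) ≠ 0) : Function.Injective φ := by
  rw [injective_iff_map_eq_zero]
  intro v hv
  obtain ⟨N, hN⟩ := e_pow_nilpotent n v
  -- The kernel is stable under the nilpotent operator `e`, so induction on the nilpotency index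
  -- reduces to vectors killed by `e`, which are multiples of the highest weight vector.
  induction N generalizing v with
  | zero => simpa using hN
  | succ N ih =>
    have h0 : ⁅sl2e, v⁆ = 0 := by
      refine ih _ (by rw [hφ, hv, map_zero]) ?_
      rwa [pow_succ, Module.End.mul_apply] at hN
    obtain ⟨c, rfl⟩ := eq_smul_hwVec h0
    rw [map_smul, smul_eq_zero] at hv
    rw [hv.resolve_right h, zero_smul]

/-- The highest weight vector generates `Vⁿ`, already under the action of `f`. -/
theorem vrep_submodule_eq_top {n : ℕ} (N : Submodule ℂ (Vrep n)) (h0 : hwVec n ∈ N)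
    (hf : ∀ v ∈ N, ⁅sl2f, v⁆ ∈ N) : N = ⊤ := by
  have hw : ∀ k, k ≤ n → wvec n k ∈ N := by
    intro k
    induction k with
    | zero => intro _; rwa [wvec_zero]
    | succ k ih =>
      intro h
      have h1 := hf _ (ih (by omega))
      rw [f_wvec (by omega)] at h1
      have h2 : (n : ℂ) - k ≠ 0 := by
        rw [sub_ne_zero]; exact_mod_cast (by omega : n ≠ k)
      exact (N.smul_mem_iff h2).mp h1
  rw [eq_top_iff, ← (wBasis n).span_eq, Submodule.span_le]
  rintro _ ⟨k, rfl⟩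
  rw [wBasis_apply]
  exact hw k (by omega)

theorem e_hwVec (n : ℕ) : ⁅sl2e, hwVec n⁆ = 0 := by
  rw [← wvec_zero, e_wvec (Nat.zero_le n)]; simp

theorem h_hwVec (n : ℕ) : ⁅sl2h, hwVec n⁆ = (n : ℂ) • hwVec n := by
  rw [← wvec_zero, h_wvec (Nat.zero_le n)]; simp

end Irreducible
end
end TwoPoint

namespace TwoPoint
noncomputable section

attribute [local instance 100] LieRing.ofAssociativeRing

/-! ### The filtration `F^i` of the tensor product. -/

section Filtration
variable (l m : ℕ)

/-- The action of `sl(2)` on the second factor of `V^l ⊗ V^m`. -/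
def sndAct : sl2 →ₗ[ℂ] Module.End ℂ (Vrep l ⊗[ℂ] Vrep m) :=
  LinearMap.lTensorHom (Vrep l) ∘ₗ (LieModule.toEnd ℂ sl2 (Vrep m) : sl2 →ₗ[ℂ] Module.End ℂ (Vrep m))

theorem sndAct_tmul (x : sl2) (v : Vrep l) (w : Vrep m) :
    sndAct l m x (v ⊗ₜ w) = v ⊗ₜ ⁅x, w⁆ := rfl

/-- The operators `id ⊗ x` transform in the adjoint representation under the diagonal action. Hence
they map `F^i` to `F^{i+1}` although `F^i` is generated diagonally. -/
theorem lie_sndAct (x y : sl2) (z : Vrep l ⊗[ℂ] Vrep m) :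
    ⁅y, sndAct l m x z⁆ = sndAct l m x ⁅y, z⁆ + sndAct l m ⁅y, x⁆ z := by
  induction z using TensorProduct.induction_on with
  | zero => simp
  | add z w hz hw => simp only [map_add, lie_add, hz, hw]; abel
  | tmul v w =>
    rw [sndAct_tmul, sndAct_tmul, TensorProduct.LieModule.lie_tmul_right,
      TensorProduct.LieModule.lie_tmul_right, map_add, sndAct_tmul, sndAct_tmul, leibniz_lie y x w,
      TensorProduct.tmul_add]
    abel

/-- The space of operators `ℂ id ⊗ id + id ⊗ g`. -/
abbrev sndOps : Submodule ℂ (Module.End ℂ (Vrep l ⊗[ℂ] Vrep m)) :=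
  Submodule.span ℂ {1} ⊔ Submodule.span ℂ
    (Set.range fun x : sl2 => (LieModule.toEnd ℂ sl2 (Vrep m) x).lTensor (Vrep l))

theorem sndAct_mem_sndOps (x : sl2) : sndAct l m x ∈ sndOps l m :=
  Submodule.mem_sup_right (Submodule.subset_span ⟨x, rfl⟩)

theorem sndOps_pow_succ (i : ℕ) : sndOps l m ^ (i + 1) = sndOps l m * sndOps l m ^ i := by
  rcases Nat.eq_zero_or_pos i with rfl | h
  · rw [Submodule.pow_succ, Submodule.pow_zero, Submodule.one_mul, Submodule.mul_one]
  · exact Submodule.pow_succ' _ h.ne'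

theorem mem_sndOps_pow_zero {T : Module.End ℂ (Vrep l ⊗[ℂ] Vrep m)} :
    T ∈ sndOps l m ^ 0 ↔ ∃ c : ℂ, algebraMap ℂ _ c = T := by
  rw [Submodule.pow_zero, Submodule.mem_one]

variable {l m}

theorem sndAct_mem_tensorFil {i : ℕ} {z : Vrep l ⊗[ℂ] Vrep m} (hz : z ∈ tensorFil l m i) (x : sl2) :
    sndAct l m x z ∈ tensorFil l m (i + 1) := by
  revert x
  refine LieSubmodule.lieSpan_induction (R := ℂ) (L := sl2)
    (p := fun z _ => ∀ x, sndAct l m x z ∈ tensorFil l m (i + 1)) ?_ ?_ ?_ ?_ ?_ hz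
  · rintro _ ⟨T, hT, rfl⟩ x
    refine LieSubmodule.subset_lieSpan ⟨sndAct l m x * T, ?_, rfl⟩
    change sndAct l m x * T ∈ sndOps l m ^ (i + 1)
    rw [sndOps_pow_succ]
    exact Submodule.mul_mem_mul (sndAct_mem_sndOps l m x) hT
  · intro x
    rw [map_zero]; exact zero_mem _
  · intro z w _ _ hz hw x
    rw [map_add]; exact add_mem (hz x) (hw x)
  · intro c z _ hz x
    rw [map_smul]; exact (tensorFil l m (i + 1)).smul_mem c (hz x)
  · intro y z _ hz x
    have h := lie_sndAct l m x y z
    rw [← sub_eq_iff_eq_add] at h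
    rw [← h]
    exact sub_mem ((tensorFil l m (i + 1)).lie_mem (hz x)) (hz _)

variable (l m) in
/-- The vectors `v_l ⊗ w`, `w` a weight vector of `V^m`. -/
def rootVec (k : ℕ) : Vrep l ⊗[ℂ] Vrep m := hwVec l ⊗ₜ wvec m k

theorem rootVec_of_lt {k : ℕ} (h : m < k) : rootVec l m k = 0 := by
  rw [rootVec, wvec_of_lt h, TensorProduct.tmul_zero]

theorem e_rootVec {k : ℕ} (h : k ≤ m) : ⁅sl2e, rootVec l m k⁆ = (k : ℂ) • rootVec l m (k - 1) := by
  rw [rootVec, TensorProduct.LieModule.lie_tmul_right, e_hwVec, e_wvec h, TensorProduct.zero_tmul,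
    zero_add, TensorProduct.tmul_smul]; rfl

theorem h_rootVec {k : ℕ} (h : k ≤ m) :
    ⁅sl2h, rootVec l m k⁆ = ((l : ℂ) + m - 2 * k) • rootVec l m k := by
  rw [rootVec, TensorProduct.LieModule.lie_tmul_right, h_hwVec, h_wvec h, TensorProduct.tmul_smul,
    ← TensorProduct.smul_tmul', ← add_smul]
  congr 1; ring

theorem sndAct_rootVec_mem {k i : ℕ} (h : k ≤ i) (x : sl2) : sndAct l m x (rootVec l m k) ∈
    Submodule.span ℂ (rootVec l m '' Set.Iic (i + 1)) := by
  by_cases hk : k ≤ m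
  · have hs : ∀ k' ≤ i + 1, rootVec l m k' ∈ Submodule.span ℂ (rootVec l m '' Set.Iic (i + 1)) :=
      fun k' h' => Submodule.subset_span ⟨k', h', rfl⟩
    rw [sl2_decomp x, map_add, map_add, map_smul, map_smul, map_smul, rootVec, LinearMap.add_apply,
      LinearMap.add_apply, LinearMap.smul_apply, LinearMap.smul_apply, LinearMap.smul_apply,
      sndAct_tmul, sndAct_tmul, sndAct_tmul, e_wvec hk, h_wvec hk, f_wvec hk, TensorProduct.tmul_smul,
      TensorProduct.tmul_smul, TensorProduct.tmul_smul]
    exact add_mem (add_mem (Submodule.smul_mem _ _ (Submodule.smul_mem _ _ (hs _ (by omega))))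
      (Submodule.smul_mem _ _ (Submodule.smul_mem _ _ (hs _ (by omega)))))
      (Submodule.smul_mem _ _ (Submodule.smul_mem _ _ (hs _ (by omega))))
  · rw [rootVec_of_lt (by omega), map_zero]; exact zero_mem _

/-- Operators on the second factor stay inside `v_l ⊗ V^m`, and each of them lowers the weight by at
most one step. -/
theorem sndOps_pow_apply_mem (i : ℕ) : ∀ T ∈ sndOps l m ^ i,
    T (hwVec l ⊗ₜ hwVec m) ∈ Submodule.span ℂ (rootVec l m '' Set.Iic i) := by
  induction i with
  | zero =>
    intro T hT
    rw [mem_sndOps_pow_zero] at hT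
    obtain ⟨c, rfl⟩ := hT
    rw [Module.algebraMap_end_apply]
    refine Submodule.smul_mem _ _ (Submodule.subset_span ⟨0, by simp, ?_⟩)
    rw [rootVec, wvec_zero]
  | succ i ih =>
    intro T hT
    rw [sndOps_pow_succ] at hT
    have key : ∀ S ∈ sndOps l m, ∀ z ∈ Submodule.span ℂ (rootVec l m '' Set.Iic i),
        S z ∈ Submodule.span ℂ (rootVec l m '' Set.Iic (i + 1)) := by
      intro S hS z hz
      obtain ⟨S₁, h₁, S₂, h₂, rfl⟩ := Submodule.mem_sup.mp hS
      rw [LinearMap.add_apply]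
      refine add_mem ?_ ?_
      · obtain ⟨c, rfl⟩ := Submodule.mem_span_singleton.mp h₁
        rw [LinearMap.smul_apply, Module.End.one_apply]
        exact Submodule.smul_mem _ _ (Submodule.span_mono
          (Set.image_mono (Set.Iic_subset_Iic.mpr (Nat.le_succ i))) hz)
      · refine Submodule.span_induction (p := fun S _ => S z ∈
          Submodule.span ℂ (rootVec l m '' Set.Iic (i + 1))) ?_ (zero_mem _)
          (fun _ _ _ _ h h' => add_mem h h') (fun c _ _ h => Submodule.smul_mem _ c h) h₂
        rintro _ ⟨x, rfl⟩
        refine Submodule.span_induction (p := fun z _ => sndAct l m x z ∈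
          Submodule.span ℂ (rootVec l m '' Set.Iic (i + 1))) ?_ (by rw [map_zero]; exact zero_mem _)
          (fun _ _ _ _ h h' => by rw [map_add]; exact add_mem h h')
          (fun c _ _ h => by rw [map_smul]; exact Submodule.smul_mem _ c h) hz
        rintro _ ⟨k, hk, rfl⟩
        exact sndAct_rootVec_mem hk x
    refine Submodule.mul_induction_on hT (fun S hS R hR => key S hS _ (ih R hR)) fun S R hS hR => ?_
    rw [LinearMap.add_apply]; exact add_mem hS hR

/-- Together with `rootVec_mem` and monotonicity this describes `F^i` as the diagonal submodule
generated by the vectors `v_l ⊗ w_k`, `k ≤ i`, the form in which the filtration is used later. -/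
theorem tensorFil_le {i : ℕ} {N : LieSubmodule ℂ sl2 (Vrep l ⊗[ℂ] Vrep m)}
    (h : ∀ k ≤ i, rootVec l m k ∈ N) : tensorFil l m i ≤ N := by
  refine LieSubmodule.lieSpan_le.mpr ?_
  rintro _ ⟨T, hT, rfl⟩
  have h2 : Submodule.span ℂ (rootVec l m '' Set.Iic i) ≤ N.toSubmodule := by
    rw [Submodule.span_le]
    rintro _ ⟨k, hk, rfl⟩
    exact h k hk
  exact h2 (sndOps_pow_apply_mem i T hT)

theorem tensorFil_mono : Monotone (tensorFil l m) := by
  refine monotone_nat_of_le_succ fun i => ?_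
  refine LieSubmodule.lieSpan_mono (Set.image_mono ?_)
  intro T hT
  change T ∈ sndOps l m ^ (i + 1)
  rw [sndOps_pow_succ, ← one_mul T]
  exact Submodule.mul_mem_mul (Submodule.mem_sup_left (Submodule.mem_span_singleton_self 1)) hT

theorem rootVec_mem (k : ℕ) : rootVec l m k ∈ tensorFil l m k := by
  induction k with
  | zero =>
    refine LieSubmodule.subset_lieSpan ⟨1, ?_, ?_⟩
    · exact (mem_sndOps_pow_zero l m).mpr ⟨1, map_one _⟩
    · rw [rootVec, wvec_zero]; rfl
  | succ k ih =>
    rcases Nat.lt_or_ge k m with h | h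
    · have h1 := sndAct_mem_tensorFil ih sl2f
      rw [rootVec, sndAct_tmul, f_wvec h.le, TensorProduct.tmul_smul] at h1
      have h2 : (m : ℂ) - k ≠ 0 := by
        rw [sub_ne_zero]; exact_mod_cast (by omega : m ≠ k)
      exact ((tensorFil l m (k + 1)).toSubmodule.smul_mem_iff h2).mp h1
    · rw [rootVec_of_lt (by omega)]; exact zero_mem _

/-- `F^m` contains `v_l ⊗ V^m`, and `f v ⊗ w = f (v ⊗ w) - v ⊗ f w` lets the first factor descend
from `v_l` to all of `V^l`. -/
theorem tensorFil_eq_top : tensorFil l m m = ⊤ := by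
  have h1 : ∀ w : Vrep m, hwVec l ⊗ₜ[ℂ] w ∈ tensorFil l m m := by
    intro w
    rw [← (wBasis m).sum_repr w, TensorProduct.tmul_sum]
    refine sum_mem fun k _ => ?_
    rw [TensorProduct.tmul_smul, wBasis_apply]
    exact (tensorFil l m m).smul_mem _ (tensorFil_mono (by omega : k.1 ≤ m) (rootVec_mem k.1))
  let N : Submodule ℂ (Vrep l) :=
    { carrier := {v | ∀ w : Vrep m, v ⊗ₜ[ℂ] w ∈ tensorFil l m m}
      add_mem' := fun {v v'} h h' w => by
        rw [TensorProduct.add_tmul]; exact add_mem (h w) (h' w)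
      zero_mem' := fun w => by rw [TensorProduct.zero_tmul]; exact zero_mem _
      smul_mem' := fun c v h w => by
        rw [← TensorProduct.smul_tmul']; exact (tensorFil l m m).smul_mem c (h w) }
  have hN : N = ⊤ := vrep_submodule_eq_top N h1 fun v hv w => by
    have h2 : ⁅sl2f, v⁆ ⊗ₜ[ℂ] w = ⁅sl2f, v ⊗ₜ[ℂ] w⁆ - v ⊗ₜ[ℂ] ⁅sl2f, w⁆ := by
      rw [TensorProduct.LieModule.lie_tmul_right]; abel
    rw [h2]
    exact sub_mem ((tensorFil l m m).lie_mem (hv w)) (hv _)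
  rw [eq_top_iff]
  intro z _
  induction z using TensorProduct.induction_on with
  | zero => exact zero_mem _
  | add z w hz hw => exact add_mem (hz trivial) (hw trivial)
  | tmul v w =>
    have : v ∈ N := by rw [hN]; trivial
    exact this w

theorem vrep_f_pow (n : ℕ) : LieModule.toEnd ℂ sl2 (Vrep n) sl2f ^ (n + 1) = 0 := by
  have hk : ∀ k, (LieModule.toEnd ℂ sl2 (Vrep n) sl2f ^ (k + 1)) (wvec n (n - k)) = 0 := by
    intro k
    induction k with
    | zero =>
      rw [zero_add, pow_one, LieModule.toEnd_apply_apply, f_wvec (by omega)]; simp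
    | succ k ih =>
      rcases Nat.lt_or_ge k n with h | h
      · rw [pow_succ, Module.End.mul_apply, LieModule.toEnd_apply_apply, f_wvec (by omega), map_smul,
          show n - (k + 1) + 1 = n - k by omega, ih, smul_zero]
      · rw [show n - (k + 1) = n - k by omega, pow_succ', Module.End.mul_apply, ih, map_zero]
  refine (wBasis n).ext fun k => ?_
  have h1 : n - (n - k.1) = k.1 := by omega
  have h2 := hk (n - k.1)
  rw [h1] at h2
  rw [wBasis_apply, congrArg (LieModule.toEnd ℂ sl2 (Vrep n) sl2f ^ ·)
    (show n + 1 = k.1 + (n - k.1 + 1) by omega)]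
  rw [pow_add, Module.End.mul_apply, h2, map_zero, LinearMap.zero_apply]

theorem tensor_f_nilpotent : IsNilpotent (LieModule.toEnd ℂ sl2 (Vrep l ⊗[ℂ] Vrep m) sl2f) := by
  have h : LieModule.toEnd ℂ sl2 (Vrep l ⊗[ℂ] Vrep m) sl2f =
      (LieModule.toEnd ℂ sl2 (Vrep l) sl2f).rTensor (Vrep m) +
        (LieModule.toEnd ℂ sl2 (Vrep m) sl2f).lTensor (Vrep l) := by
    refine TensorProduct.ext' fun v w => ?_
    rw [LieModule.toEnd_apply_apply, TensorProduct.LieModule.lie_tmul_right]; rfl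
  rw [h]
  refine Commute.isNilpotent_add ?_ ⟨l + 1, ?_⟩ ⟨m + 1, ?_⟩
  · refine TensorProduct.ext' fun v w => rfl
  · rw [LinearMap.rTensor_pow, vrep_f_pow, LinearMap.rTensor_zero]
  · rw [LinearMap.lTensor_pow, vrep_f_pow, LinearMap.lTensor_zero]

end Filtration
end
end TwoPoint

/-! ### Splitting the filtration into irreducible components. -/

namespace TwoPoint
noncomputable section

attribute [local instance 100] LieRing.ofAssociativeRing

/-- A decomposition of `V^l ⊗ V^m` into irreducible components `V^{l+m-2j}`, `j ≤ m`, adapted to the filtration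
`tensorFil` and with prescribed highest weight vectors. -/
structure TensorDecomp (l m : ℕ) (u : ℕ → Vrep l ⊗[ℂ] Vrep m) where
  ι : ∀ j, Vrep (l + m - 2 * j) →ₗ[ℂ] Vrep l ⊗[ℂ] Vrep m
  q : ∀ j, Vrep l ⊗[ℂ] Vrep m →ₗ[ℂ] Vrep (l + m - 2 * j)
  lie_ι : ∀ j (x : sl2) v, ι j ⁅x, v⁆ = ⁅x, ι j v⁆
  lie_q : ∀ j (x : sl2) v, q j ⁅x, v⁆ = ⁅x, q j v⁆
  q_ι_self : ∀ j ≤ m, ∀ v, q j (ι j v) = v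
  q_ι_ne : ∀ j k v, j ≠ k → q j (ι k v) = 0
  sum_ι_q : ∀ v, ∑ j ∈ Finset.range (m + 1), ι j (q j v) = v
  ι_hwVec : ∀ j ≤ m, ι j (hwVec _) = u j
  ι_eq_zero : ∀ j, m < j → ι j = 0
  q_eq_zero : ∀ j, m < j → q j = 0
  mem_tensorFil : ∀ i v, v ∈ tensorFil l m i ↔ ∀ k, i < k → q k v = 0

section Decomposition
variable {l m : ℕ}

/-- The preceding step of the filtration, `⊥` for `i = 0`. -/
def prevFil (l m : ℕ) : ℕ → LieSubmodule ℂ sl2 (Vrep l ⊗[ℂ] Vrep m)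
  | 0 => ⊥
  | i + 1 => tensorFil l m i

theorem rootVec_mem_prevFil {k j : ℕ} (h : k < j) : rootVec l m k ∈ prevFil l m j := by
  rcases j with _ | j
  · omega
  · exact tensorFil_mono (by omega : k ≤ j) (rootVec_mem k)

theorem e_rootVec_mem_prevFil {j : ℕ} (h : j ≤ m) : ⁅sl2e, rootVec l m j⁆ ∈ prevFil l m j := by
  rw [e_rootVec h]
  rcases j with _ | j
  · rw [Nat.cast_zero, zero_smul]; exact zero_mem _
  · exact (prevFil l m (j + 1)).smul_mem _ (rootVec_mem_prevFil (by omega))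

/-- A complement of the preceding step of the filtration is irreducible. -/
theorem exists_component (hml : m ≤ l) {j : ℕ} (hj : j ≤ m)
    {G : LieSubmodule ℂ sl2 (Vrep l ⊗[ℂ] Vrep m)} (hG : prevFil l m j ⊔ G = tensorFil l m j)
    (hG' : Disjoint (prevFil l m j) G) {u : Vrep l ⊗[ℂ] Vrep m} (hu : u ∈ G) (hu0 : u ≠ 0)
    (hue : ⁅sl2e, u⁆ = 0) :
    ∃ ι : Vrep (l + m - 2 * j) →ₗ[ℂ] Vrep l ⊗[ℂ] Vrep m, (∀ (x : sl2) v, ι ⁅x, v⁆ = ⁅x, ι v⁆) ∧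
      Function.Injective ι ∧ ι (hwVec _) = u ∧ (∀ v, ι v ∈ G) ∧ ∀ z ∈ G, ∃ v, ι v = z := by
  have h0 : ∀ z, z ∈ prevFil l m j → z ∈ G → z = 0 := fun z h h' => by
    have h2 : z ∈ prevFil l m j ⊓ G := ⟨h, h'⟩
    rwa [hG'.eq_bot, LieSubmodule.mem_bot] at h2
  -- Modulo the preceding step, `v_l ⊗ w_j` is killed by `e` and has weight `l + m - 2j`. Its
  -- component `τ` in the complement satisfies both exactly, since the defects lie in `prevFil l m
  -- j` and in `G`, hence vanish.
  have hr := rootVec_mem (l := l) (m := m) j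
  rw [← hG, LieSubmodule.mem_sup] at hr
  obtain ⟨b, hb, τ, hτ, hbτ⟩ := hr
  have hτe : ⁅sl2e, τ⁆ = 0 := by
    refine h0 _ ?_ (G.lie_mem hτ)
    rw [← add_sub_cancel_left b τ, hbτ, lie_sub]
    exact sub_mem (e_rootVec_mem_prevFil hj) ((prevFil l m j).lie_mem hb)
  have hτh : ⁅sl2h, τ⁆ = ((l + m - 2 * j : ℕ) : ℂ) • τ := by
    have hc : ((l + m - 2 * j : ℕ) : ℂ) = (l : ℂ) + m - 2 * j := by
      rw [Nat.cast_sub (by omega)]; push_cast; ring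
    rw [hc, ← sub_eq_zero]
    refine h0 _ ?_ (sub_mem (G.lie_mem hτ) (G.smul_mem _ hτ))
    rw [← add_sub_cancel_left b τ, hbτ, lie_sub, h_rootVec hj, smul_sub, sub_sub_sub_cancel_left]
    exact sub_mem ((prevFil l m j).smul_mem _ hb) ((prevFil l m j).lie_mem hb)
  obtain ⟨N, hN⟩ := tensor_f_nilpotent (l := l) (m := m)
  obtain ⟨φ, hφ, hφl⟩ := exists_hom_of_hw (LieModule.toEnd ℂ sl2 (Vrep l ⊗[ℂ] Vrep m)) hτe hτh
    (pow_f_eq_zero (N := N) hτe hτh (by rw [hN]; rfl))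
  have hφG : ∀ v, φ v ∈ G := by
    have : G.toSubmodule.comap φ = ⊤ := vrep_submodule_eq_top _ (by
      rw [Submodule.mem_comap, hφ]; exact hτ) fun v hv => by
        rw [Submodule.mem_comap, hφl]; exact G.lie_mem hv
    intro v
    have hv : v ∈ G.toSubmodule.comap φ := by rw [this]; trivial
    exact hv
  let R : LieSubmodule ℂ sl2 (Vrep l ⊗[ℂ] Vrep m) :=
    { LinearMap.range φ with
      lie_mem := by
        rintro x _ ⟨v, rfl⟩
        exact ⟨⁅x, v⁆, hφl x v⟩ }
  -- `F^j` is generated by the root vectors of index at most `j`, and only the last one is not in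
  -- the preceding step.
  have hR : tensorFil l m j ≤ prevFil l m j ⊔ R := by
    refine tensorFil_le fun k hk => ?_
    rcases hk.lt_or_eq with h | rfl
    · exact (le_sup_left : prevFil l m j ≤ _) (rootVec_mem_prevFil h)
    · rw [← hbτ]
      exact LieSubmodule.mem_sup _ _ _ |>.mpr ⟨b, hb, τ, ⟨_, hφ⟩, rfl⟩
  have hsurj : ∀ z ∈ G, ∃ v, φ v = z := by
    intro z hz
    have hz' : z ∈ tensorFil l m j := by rw [← hG]; exact (le_sup_right : G ≤ _) hz
    obtain ⟨b', hb', _, ⟨v, rfl⟩, hv⟩ := (LieSubmodule.mem_sup _ _ _).mp (hR hz')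
    refine ⟨v, ?_⟩
    have : b' = 0 := h0 b' hb' (by
      rw [← add_sub_cancel_right b' (φ v), hv]; exact sub_mem hz (hφG v))
    rwa [this, zero_add] at hv
  obtain ⟨v₀, hv₀⟩ := hsurj u hu
  -- Otherwise `φ = 0`, although its image contains the nonzero vector `u`.
  have hτ0 : φ (hwVec _) ≠ 0 := by
    intro h
    have : LinearMap.ker φ = ⊤ := vrep_submodule_eq_top _ h fun v hv => by
      rw [LinearMap.mem_ker] at hv ⊢; rw [hφl, hv, map_zero]
    apply hu0
    rw [← hv₀, ← LinearMap.mem_ker, this]; trivial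
  have hinj := injective_of_hwVec_ne_zero (LieModule.toEnd ℂ sl2 (Vrep l ⊗[ℂ] Vrep m))
    (fun v => hφl sl2e v) hτ0
  -- The preimage of `u` is killed by `e`, hence a multiple of the highest weight vector; rescaling
  -- `φ` by that multiple makes it hit `u`.
  obtain ⟨c, hc⟩ := eq_smul_hwVec (v := v₀) (hinj (by
    rw [hφl, hv₀, map_zero]; exact hue))
  have hc0 : c ≠ 0 := by
    rintro rfl
    rw [zero_smul] at hc
    rw [hc, map_zero] at hv₀
    exact hu0 hv₀.symm
  refine ⟨c • φ, fun x v => ?_, fun v w h => hinj (smul_right_injective _ hc0 h), ?_,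
    fun v => G.smul_mem c (hφG v), fun z hz => ?_⟩
  · rw [LinearMap.smul_apply, LinearMap.smul_apply, hφl, lie_smul]; rfl
  · rw [LinearMap.smul_apply, ← map_smul, ← hc, hv₀]
  · obtain ⟨v, hv⟩ := hsurj z hz
    refine ⟨c⁻¹ • v, ?_⟩
    rw [LinearMap.smul_apply, map_smul, smul_smul, mul_inv_cancel₀ hc0, one_smul, hv]

theorem sum_range_mem_prevFil {G : ℕ → LieSubmodule ℂ sl2 (Vrep l ⊗[ℂ] Vrep m)}
    (hG : ∀ i, prevFil l m i ⊔ G i = tensorFil l m i) {z : ℕ → Vrep l ⊗[ℂ] Vrep m} {n : ℕ}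
    (hz : ∀ j < n, z j ∈ G j) : ∑ j ∈ Finset.range n, z j ∈ prevFil l m n := by
  rcases n with _ | n
  · rw [Finset.sum_range_zero]; exact zero_mem _
  · refine sum_mem fun j hj => ?_
    have hj' := Finset.mem_range.mp hj
    refine tensorFil_mono (by omega : j ≤ n) ?_
    rw [← hG]; exact (le_sup_right : G j ≤ _) (hz j hj')

/-- The last summand lies both in its complement and in the preceding step, so the relation is
peeled off from the top. -/
theorem eq_zero_of_sum_range_eq_zero {G : ℕ → LieSubmodule ℂ sl2 (Vrep l ⊗[ℂ] Vrep m)}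
    (hG : ∀ i, prevFil l m i ⊔ G i = tensorFil l m i) (hG' : ∀ i, Disjoint (prevFil l m i) (G i))
    {z : ℕ → Vrep l ⊗[ℂ] Vrep m} {n : ℕ} (hz : ∀ j < n, z j ∈ G j)
    (h : ∑ j ∈ Finset.range n, z j = 0) : ∀ j < n, z j = 0 := by
  induction n with
  | zero => intro j hj; omega
  | succ n ih =>
    rw [Finset.sum_range_succ] at h
    have h1 := sum_range_mem_prevFil hG (fun j hj => hz j (hj.trans n.lt_succ_self))
    have h2 : z n ∈ prevFil l m n := by
      rw [← neg_eq_of_add_eq_zero_right h]; exact neg_mem h1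
    have h3 : z n = 0 := by
      have h4 : z n ∈ prevFil l m n ⊓ G n := ⟨h2, hz n n.lt_succ_self⟩
      rwa [(hG' n).eq_bot, LieSubmodule.mem_bot] at h4
    rw [h3, add_zero] at h
    intro j hj
    rcases Nat.lt_succ_iff_lt_or_eq.mp hj with hj | rfl
    · exact ih (fun j hj => hz j (hj.trans n.lt_succ_self)) h j hj
    · exact h3

theorem exists_sum_of_mem_tensorFil {G : ℕ → LieSubmodule ℂ sl2 (Vrep l ⊗[ℂ] Vrep m)}
    (hG : ∀ i, prevFil l m i ⊔ G i = tensorFil l m i) {i : ℕ} :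
    ∀ {v : Vrep l ⊗[ℂ] Vrep m}, v ∈ tensorFil l m i →
      ∃ z : ℕ → Vrep l ⊗[ℂ] Vrep m, (∀ j, z j ∈ G j) ∧ v = ∑ j ∈ Finset.range (i + 1), z j := by
  induction i with
  | zero =>
    intro v hv
    rw [← hG, prevFil, bot_sup_eq] at hv
    refine ⟨fun j => if h : j = 0 then v else 0, fun j => ?_, by simp⟩
    by_cases h : j = 0
    · subst h; simpa using hv
    · simp [h]
  | succ i ih =>
    intro v hv
    rw [← hG, LieSubmodule.mem_sup] at hv
    obtain ⟨b, hb, g, hg, rfl⟩ := hv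
    obtain ⟨z, hz, rfl⟩ := ih hb
    refine ⟨Function.update z (i + 1) g, fun j => ?_, ?_⟩
    · by_cases h : j = i + 1
      · subst h; simpa using hg
      · rw [Function.update_of_ne h]; exact hz j
    · rw [Finset.sum_range_succ _ (i + 1), Function.update_self]
      congr 1
      refine Finset.sum_congr rfl fun j hj => ?_
      rw [Function.update_of_ne (by have := Finset.mem_range.mp hj; omega)]

/-- The complements of index at most `m` are independent and fill `F^m`, which is everything; the
projections are the coordinates of the inverse of the resulting isomorphism. Since `F^i` is the sum
of the first of them, it is cut out by the vanishing of the later coordinates. -/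
theorem exists_tensorDecomp (hml : m ≤ l) {G : ℕ → LieSubmodule ℂ sl2 (Vrep l ⊗[ℂ] Vrep m)}
    (hG : ∀ i, prevFil l m i ⊔ G i = tensorFil l m i) (hG' : ∀ i, Disjoint (prevFil l m i) (G i))
    {u : ℕ → Vrep l ⊗[ℂ] Vrep m} (hu : ∀ i ≤ m, u i ∈ G i ∧ u i ≠ 0 ∧ ⁅sl2e, u i⁆ = 0) :
    Nonempty (TensorDecomp l m u) := by
  have key : ∀ j, ∃ ι : Vrep (l + m - 2 * j) →ₗ[ℂ] Vrep l ⊗[ℂ] Vrep m, (∀ (x : sl2) v, ι ⁅x, v⁆ = ⁅x, ι v⁆) ∧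
      (∀ v, ι v ∈ G j) ∧ (j ≤ m → Function.Injective ι ∧ ι (hwVec _) = u j ∧
        ∀ z ∈ G j, ∃ v, ι v = z) ∧ (m < j → ι = 0) := by
    intro j
    by_cases hj : j ≤ m
    · obtain ⟨ι, h1, h2, h3, h4, h5⟩ :=
        exists_component hml hj (hG j) (hG' j) (hu j hj).1 (hu j hj).2.1 (hu j hj).2.2
      exact ⟨ι, h1, h4, fun _ => ⟨h2, h3, h5⟩, fun h => by omega⟩
    -- Beyond `m` the filtration is exhausted; the zero map is taken, whatever the truncated
    -- subtraction in `l + m - 2 * j` gives.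
    · exact ⟨0, fun x v => by simp, fun v => zero_mem _, fun h => by omega, fun _ => rfl⟩
  choose ι hlie hmem hle hlt using key
  let E : (∀ j : Fin (m + 1), Vrep (l + m - 2 * j)) →ₗ[ℂ] Vrep l ⊗[ℂ] Vrep m :=
    ∑ j : Fin (m + 1), ι j ∘ₗ LinearMap.proj j
  have hE : ∀ f, E f = ∑ j : Fin (m + 1), ι j (f j) := fun f => by
    simp [E, LinearMap.sum_apply]
  have hinj : Function.Injective E := by
    rw [injective_iff_map_eq_zero]
    intro f hf
    rw [hE] at hf
    let z : ℕ → Vrep l ⊗[ℂ] Vrep m := fun j => if h : j < m + 1 then ι j (f ⟨j, h⟩) else 0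
    have hz : ∀ j : Fin (m + 1), z j = ι j (f j) := fun j => dif_pos j.2
    have h2 := eq_zero_of_sum_range_eq_zero hG hG' (z := z) (n := m + 1) (fun j hj => by
      have := hz ⟨j, hj⟩
      simp only at this
      rw [this]; exact hmem _ _) (by
        rw [← Fin.sum_univ_eq_sum_range, ← hf]
        exact Finset.sum_congr rfl fun j _ => hz j)
    funext j
    have h3 := h2 j j.2
    rw [hz] at h3
    exact (hle j (by omega)).1 (by rw [h3]; simp)
  have hsurj : Function.Surjective E := by
    intro v
    have hv : v ∈ tensorFil l m m := by rw [tensorFil_eq_top]; trivial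
    obtain ⟨z, hz, rfl⟩ := exists_sum_of_mem_tensorFil hG hv
    choose f hf using fun j : Fin (m + 1) => (hle j (by omega)).2.2 (z j) (hz j)
    refine ⟨f, ?_⟩
    rw [hE, ← Fin.sum_univ_eq_sum_range]
    exact Finset.sum_congr rfl fun j _ => hf j
  let e := LinearEquiv.ofBijective E ⟨hinj, hsurj⟩
  have he : ∀ f, e f = ∑ j : Fin (m + 1), ι j (f j) := hE
  let q : ∀ j, Vrep l ⊗[ℂ] Vrep m →ₗ[ℂ] Vrep (l + m - 2 * j) := fun j =>
    if h : j < m + 1 then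
      (LinearMap.proj (φ := fun j : Fin (m + 1) => Vrep (l + m - 2 * j)) ⟨j, h⟩) ∘ₗ e.symm.toLinearMap
    else 0
  have hq : ∀ (j : Fin (m + 1)) v, q j v = e.symm v j := fun j v => by
    simp only [q]; rw [dif_pos j.2]; rfl
  have hq0 : ∀ j, m < j → q j = 0 := fun j hj => dif_neg (by omega)
  have hqι : ∀ (j k : Fin (m + 1)) v, q j (ι k v) = (Pi.single (M := fun j : Fin (m + 1) => Vrep (l + m - 2 * j)) k v) j := by
    intro j k v
    have : ι k v = e (Pi.single k v) := by
      rw [he, Finset.sum_eq_single k, Pi.single_eq_same]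
      · intro i _ hi; rw [Pi.single_eq_of_ne hi, map_zero]
      · simp
    rw [this, hq, LinearEquiv.symm_apply_apply]
  have hne : ∀ j k v, j ≠ k → q j (ι k v) = 0 := by
    intro j k v hjk
    by_cases hj : m < j
    · rw [hq0 j hj]; rfl
    by_cases hk : m < k
    · rw [hlt k hk, LinearMap.zero_apply, map_zero]
    have := hqι ⟨j, by omega⟩ ⟨k, by omega⟩ v
    rw [Pi.single_eq_of_ne (by simpa using hjk)] at this
    exact this
  have hsum : ∀ v, ∑ j ∈ Finset.range (m + 1), ι j (q j v) = v := by
    intro v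
    rw [← Fin.sum_univ_eq_sum_range fun j => ι j (q j v)]
    conv_rhs => rw [← e.apply_symm_apply v, he]
    exact Finset.sum_congr rfl fun j _ => by rw [hq]
  refine ⟨ι, q, hlie, ?_, ?_, hne, hsum, fun j hj => (hle j hj).2.1, hlt, hq0, ?_⟩
  · intro j x v
    by_cases hj : m < j
    · rw [hq0 j hj]; simp
    have h1 := hq ⟨j, by omega⟩
    simp only at h1
    rw [h1, h1]
    have h2 : ⁅x, v⁆ = e (fun j => ⁅x, e.symm v j⁆) := by
      rw [he]
      conv_lhs => rw [← e.apply_symm_apply v, he, lie_sum]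
      exact Finset.sum_congr rfl fun j _ => (hlie _ _ _).symm
    rw [h2, LinearEquiv.symm_apply_apply]
  · intro j hj v
    have := hqι ⟨j, by omega⟩ ⟨j, by omega⟩ v
    rw [Pi.single_eq_same] at this
    exact this
  · have hfor : ∀ i ≤ m, ∀ v ∈ tensorFil l m i, ∀ k, i < k → q k v = 0 := by
      intro i hi v hv k hk
      obtain ⟨z, hz, rfl⟩ := exists_sum_of_mem_tensorFil hG hv
      rw [map_sum]
      refine Finset.sum_eq_zero fun j hj => ?_
      have hj' := Finset.mem_range.mp hj
      obtain ⟨w, hw⟩ := (hle j (by omega)).2.2 (z j) (hz j)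
      rw [← hw]
      exact hne _ _ _ (by omega)
    intro i v
    refine ⟨fun hv k hk => ?_, fun h => ?_⟩
    · by_cases hi : i ≤ m
      · exact hfor i hi v hv k hk
      · rw [hq0 k (by omega)]; rfl
    · rw [← hsum v]
      refine sum_mem fun j _ => ?_
      by_cases hj : i < j
      · rw [h j hj, map_zero]; exact zero_mem _
      · refine tensorFil_mono (by omega : j ≤ i) ?_
        rw [← hG]; exact (le_sup_right : G j ≤ _) (hmem j _)

end Decomposition
end
end TwoPoint

namespace TwoPoint
noncomputable section

attribute [local instance 100] LieRing.ofAssociativeRing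

/-! ### The symbol `θ` of the action on the second factor. -/

namespace TensorDecomp
variable {l m : ℕ} {u : ℕ → Vrep l ⊗[ℂ] Vrep m} (D : TensorDecomp l m u)

/-- The projection of `V^l ⊗ V^m` to the `j`-th component. -/
def p (j : ℕ) : Module.End ℂ (Vrep l ⊗[ℂ] Vrep m) := D.ι j ∘ₗ D.q j

/-- The highest weight vector of the `j`-th component. -/
def hv (j : ℕ) : Vrep l ⊗[ℂ] Vrep m := D.ι j (hwVec _)

theorem hv_eq {j : ℕ} (h : j ≤ m) : D.hv j = u j := D.ι_hwVec j h

theorem hv_of_lt {j : ℕ} (h : m < j) : D.hv j = 0 := by rw [hv, D.ι_eq_zero j h]; rfl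

theorem p_of_lt {j : ℕ} (h : m < j) : D.p j = 0 := by rw [p, D.ι_eq_zero j h]; rfl

theorem p_apply (j : ℕ) (v : Vrep l ⊗[ℂ] Vrep m) : D.p j v = D.ι j (D.q j v) := rfl

theorem lie_p (j : ℕ) (x : sl2) (v : Vrep l ⊗[ℂ] Vrep m) : D.p j ⁅x, v⁆ = ⁅x, D.p j v⁆ := by
  rw [p_apply, D.lie_q, D.lie_ι]; rfl

theorem p_p_self (j : ℕ) (v : Vrep l ⊗[ℂ] Vrep m) : D.p j (D.p j v) = D.p j v := by
  by_cases h : j ≤ m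
  · rw [p_apply, p_apply, D.q_ι_self j h]
  · rw [D.p_of_lt (by omega)]; rfl

theorem p_p_ne {j k : ℕ} (h : j ≠ k) (v : Vrep l ⊗[ℂ] Vrep m) : D.p j (D.p k v) = 0 := by
  rw [p_apply, p_apply, D.q_ι_ne j k _ h, map_zero]

theorem p_hv_self (j : ℕ) : D.p j (D.hv j) = D.hv j := by
  by_cases h : j ≤ m
  · rw [p_apply, hv, D.q_ι_self j h]
  · rw [D.p_of_lt (by omega), D.hv_of_lt (by omega)]; rfl

theorem p_hv_ne {j k : ℕ} (h : j ≠ k) : D.p j (D.hv k) = 0 := by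
  rw [p_apply, hv, D.q_ι_ne j k _ h, map_zero]

theorem sum_p {n : ℕ} (hn : m < n) (v : Vrep l ⊗[ℂ] Vrep m) : ∑ j ∈ Finset.range n, D.p j v = v := by
  conv_rhs => rw [← D.sum_ι_q v]
  refine (Finset.sum_subset (Finset.range_mono hn) fun j _ hj => ?_).symm
  rw [D.p_of_lt (by rw [Finset.mem_range] at hj; omega)]; rfl

theorem p_eq_zero_of_mem {i k : ℕ} {v : Vrep l ⊗[ℂ] Vrep m} (hv : v ∈ tensorFil l m i) (h : i < k) :
    D.p k v = 0 := by
  rw [p_apply, (D.mem_tensorFil i v).mp hv k h, map_zero]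

theorem p_mem (j : ℕ) (v : Vrep l ⊗[ℂ] Vrep m) : D.p j v ∈ tensorFil l m j := by
  rw [D.mem_tensorFil]
  intro k hk
  rw [p_apply, D.q_ι_ne k j _ hk.ne']

theorem hv_mem (j : ℕ) : D.hv j ∈ tensorFil l m j := by
  rw [← p_hv_self]; exact D.p_mem j _

/-- Because `id ⊗ x` raises the filtration by at most one, components of `v` below the top one
cannot reach index `j + 1`, and nothing reaches further. -/
theorem p_sndAct {j n : ℕ} {v : Vrep l ⊗[ℂ] Vrep m} (hv : v ∈ tensorFil l m j) (h : j < n) (x : sl2) :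
    D.p n (sndAct l m x v) = if n = j + 1 then D.p n (sndAct l m x (D.p j v)) else 0 := by
  split_ifs with h1
  · subst h1
    conv_lhs => rw [← D.sum_p (lt_max_of_lt_left (Nat.lt_succ_self m) : m < max (m + 1) (j + 1)) v]
    rw [map_sum, map_sum, Finset.sum_eq_single_of_mem j (by simp)]
    intro k _ hk
    rcases lt_or_gt_of_ne hk with h2 | h2
    · exact D.p_eq_zero_of_mem (sndAct_mem_tensorFil (D.p_mem k v) x) (by omega)
    · rw [D.p_eq_zero_of_mem hv h2, map_zero, map_zero]
  · exact D.p_eq_zero_of_mem (sndAct_mem_tensorFil hv x) (by omega)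

/-- The degree one part of the action on the second factor. -/
def θ : sl2 →ₗ[ℂ] Module.End ℂ (Vrep l ⊗[ℂ] Vrep m) where
  toFun x := ∑ j ∈ Finset.range (m + 1), D.p (j + 1) ∘ₗ sndAct l m x ∘ₗ D.p j
  map_add' x y := by
    rw [← Finset.sum_add_distrib]
    exact Finset.sum_congr rfl fun j _ => by rw [map_add, LinearMap.add_comp, LinearMap.comp_add]
  map_smul' c x := by
    rw [RingHom.id_apply, Finset.smul_sum]
    exact Finset.sum_congr rfl fun j _ => by rw [map_smul, LinearMap.smul_comp, LinearMap.comp_smul]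

theorem θ_apply (x : sl2) (v : Vrep l ⊗[ℂ] Vrep m) :
    D.θ x v = ∑ j ∈ Finset.range (m + 1), D.p (j + 1) (sndAct l m x (D.p j v)) := by
  change (∑ j ∈ Finset.range (m + 1), D.p (j + 1) ∘ₗ sndAct l m x ∘ₗ D.p j) v = _
  rw [LinearMap.sum_apply]; rfl

theorem lie_θ (x y : sl2) (v : Vrep l ⊗[ℂ] Vrep m) : ⁅y, D.θ x v⁆ = D.θ x ⁅y, v⁆ + D.θ ⁅y, x⁆ v := by
  rw [θ_apply, θ_apply, θ_apply, lie_sum, ← Finset.sum_add_distrib]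
  refine Finset.sum_congr rfl fun j _ => ?_
  rw [← D.lie_p, lie_sndAct, D.lie_p, map_add]

theorem e_hv (j : ℕ) : ⁅sl2e, D.hv j⁆ = 0 := by rw [hv, ← D.lie_ι, e_hwVec, map_zero]

theorem h_hv (j : ℕ) : ⁅sl2h, D.hv j⁆ = ((l + m - 2 * j : ℕ) : ℂ) • D.hv j := by
  rw [hv, ← D.lie_ι, h_hwVec, map_smul]

theorem θ_hv (x : sl2) (j : ℕ) : D.θ x (D.hv j) = D.p (j + 1) (sndAct l m x (D.hv j)) := by
  rw [θ_apply]
  by_cases h : j ≤ m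
  · rw [Finset.sum_eq_single_of_mem j (Finset.mem_range.mpr (by omega)), p_hv_self]
    intro k _ hk
    rw [D.p_hv_ne hk, map_zero, map_zero]
  · rw [D.hv_of_lt (by omega)]; simp

theorem exists_eq_smul_hv {j : ℕ} {v : Vrep l ⊗[ℂ] Vrep m} (hv : D.p j v = v) (he : ⁅sl2e, v⁆ = 0) :
    ∃ c : ℂ, v = c • D.hv j := by
  obtain ⟨c, hc⟩ := eq_smul_hwVec (v := D.q j v) (by rw [← D.lie_q, he, map_zero])
  exact ⟨c, by rw [← hv, p_apply, hc, map_smul]; rfl⟩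

theorem p_θ_hv (x : sl2) (j : ℕ) : D.p (j + 1) (D.θ x (D.hv j)) = D.θ x (D.hv j) := by
  rw [θ_hv, p_p_self]

/-- In the component of index `j + 1` the kernel of `e` is a line of a single weight. This forces `θ
e` and `θ h` to vanish on the highest weight vectors. -/
theorem weight_aux (hml : m ≤ l) {j : ℕ} {v : Vrep l ⊗[ℂ] Vrep m} (hv : D.p (j + 1) v = v)
    (he : ⁅sl2e, v⁆ = 0) {c : ℂ} (hh : ⁅sl2h, v⁆ = c • v) (hc : c ≠ (l : ℂ) + m - 2 * (j + 1)) : v = 0 := by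
  by_cases hj : j + 1 ≤ m
  · obtain ⟨b, rfl⟩ := D.exists_eq_smul_hv hv he
    rw [lie_smul, h_hv, Nat.cast_sub (by omega), smul_smul, smul_smul, ← sub_eq_zero, ← sub_smul,
      smul_eq_zero] at hh
    rcases hh with hh | hh
    · push_cast at hh
      have h2 : b * ((l : ℂ) + m - 2 * (j + 1) - c) = 0 := by rw [← hh]; ring
      rcases mul_eq_zero.mp h2 with h3 | h3
      · rw [h3, zero_smul]
      · exact absurd (sub_eq_zero.mp h3).symm hc
    · rw [hh, smul_zero]
  · rw [← hv, D.p_of_lt (by omega)]; rfl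

theorem h_hv' (hml : m ≤ l) (j : ℕ) : ⁅sl2h, D.hv j⁆ = ((l : ℂ) + m - 2 * j) • D.hv j := by
  by_cases hj : j ≤ m
  · rw [h_hv, Nat.cast_sub (by omega)]; push_cast; rfl
  · rw [D.hv_of_lt (by omega)]; simp

/-- The image would have weight two above that of `hv j`, while the component it lies in has highest
weight two below. -/
theorem θ_e_hv (hml : m ≤ l) (j : ℕ) : D.θ sl2e (D.hv j) = 0 := by
  refine D.weight_aux hml (D.p_θ_hv _ j) (c := (l : ℂ) + m - 2 * j + 2) ?_ ?_ ?_
  · rw [lie_θ, e_hv, map_zero, lie_self, map_zero]; simp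
  · rw [lie_θ, D.h_hv' hml, lie_h_e, map_smul, map_smul, LinearMap.smul_apply, ← add_smul]
  · intro h
    have : (4 : ℂ) = 0 := by linear_combination h
    norm_num at this

theorem θ_h_hv (hml : m ≤ l) (j : ℕ) : D.θ sl2h (D.hv j) = 0 := by
  refine D.weight_aux hml (D.p_θ_hv _ j) (c := (l : ℂ) + m - 2 * j) ?_ ?_ ?_
  · rw [lie_θ, e_hv, map_zero, lie_e_h, map_smul, LinearMap.smul_apply, D.θ_e_hv hml]; simp
  · rw [lie_θ, D.h_hv' hml, lie_self, map_smul, map_zero]; simp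
  · intro h
    have : (2 : ℂ) = 0 := by linear_combination h
    norm_num at this

/-- `e` kills `θ f (hv j)`, because the commutator term is `θ h (hv j) = 0`. So `θ` is governed by
one scalar per component. -/
theorem exists_θ_f_hv (hml : m ≤ l) (j : ℕ) : ∃ γ : ℂ, D.θ sl2f (D.hv j) = γ • D.hv (j + 1) := by
  refine D.exists_eq_smul_hv (D.p_θ_hv _ j) ?_
  rw [lie_θ, e_hv, map_zero, lie_e_f, D.θ_h_hv hml, add_zero]

include D in
-- Each component is generated by its highest weight vector under `f`; this reduces identities on
-- the whole tensor product to highest weight vectors.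
theorem eq_top_of_hv_mem (N : Submodule ℂ (Vrep l ⊗[ℂ] Vrep m)) (h0 : ∀ j, D.hv j ∈ N)
    (hf : ∀ v ∈ N, ⁅sl2f, v⁆ ∈ N) : N = ⊤ := by
  rw [eq_top_iff]
  intro v _
  rw [← D.sum_ι_q v]
  refine sum_mem fun j _ => ?_
  have h : N.comap (D.ι j) = ⊤ := vrep_submodule_eq_top _ (h0 j) fun w hw => by
    rw [Submodule.mem_comap, D.lie_ι]; exact hf _ hw
  have h2 : D.q j v ∈ N.comap (D.ι j) := by rw [h]; trivial
  exact h2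

variable {Z : Type} [AddCommGroup Z] [Module ℂ Z]

include D in
/-- An equivariant map on `V^l ⊗ V^m` is determined by arbitrary highest weight vectors of the right weights. -/
theorem exists_hom (π : sl2 →ₗ⁅ℂ⁆ Module.End ℂ Z) (y : ℕ → Z) (he : ∀ j ≤ m, π sl2e (y j) = 0)
    (hh : ∀ j ≤ m, π sl2h (y j) = ((l + m - 2 * j : ℕ) : ℂ) • y j)
    (hf : ∀ j ≤ m, (π sl2f ^ (l + m - 2 * j + 1)) (y j) = 0) :
    ∃ ψ : Vrep l ⊗[ℂ] Vrep m →ₗ[ℂ] Z, (∀ j ≤ m, ψ (D.hv j) = y j) ∧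
      ∀ (x : sl2) v, ψ ⁅x, v⁆ = π x (ψ v) := by
  have key : ∀ j, ∃ φ : Vrep (l + m - 2 * j) →ₗ[ℂ] Z, (j ≤ m → φ (hwVec _) = y j) ∧
      ∀ (x : sl2) v, φ ⁅x, v⁆ = π x (φ v) := by
    intro j
    by_cases hj : j ≤ m
    · obtain ⟨φ, h1, h2⟩ := exists_hom_of_hw π (he j hj) (hh j hj) (hf j hj)
      exact ⟨φ, fun _ => h1, h2⟩
    · exact ⟨0, fun h => absurd h hj, fun x v => by simp⟩
  choose φ hφ hφl using key
  refine ⟨∑ j ∈ Finset.range (m + 1), φ j ∘ₗ D.q j, fun j hj => ?_, fun x v => ?_⟩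
  · rw [LinearMap.sum_apply, Finset.sum_eq_single_of_mem j (Finset.mem_range.mpr (by omega))]
    · rw [LinearMap.comp_apply, hv, D.q_ι_self j hj, hφ j hj]
    · intro k _ hk
      rw [LinearMap.comp_apply, hv, D.q_ι_ne _ _ _ hk, map_zero]
  · rw [LinearMap.sum_apply, LinearMap.sum_apply, map_sum]
    refine Finset.sum_congr rfl fun j _ => ?_
    rw [LinearMap.comp_apply, LinearMap.comp_apply, D.lie_q, hφl]

end TensorDecomp
end
end TwoPoint

namespace TwoPoint
noncomputable section

attribute [local instance 100] LieRing.ofAssociativeRing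

/-! ### Currents of `ĝ₁`, their brackets, and the constant `sl(2)`. -/

section LevelOne

/-- The function `tⁿ` on the punctured disc. -/
def tp (n : ℕ) : Punctured (Polynomial.X : ℂ[X]) :=
  algebraMap ℂ[X] (Punctured (Polynomial.X : ℂ[X])) (Polynomial.X ^ n)

/-- The element `f x` of `U(ĝ₁)`. -/
def cur (f : Punctured (Polynomial.X : ℂ[X])) (x : sl2) : U₁ :=
  UniversalEnvelopingAlgebra.ι ℂ (Affine.loop (resCocycle _ Polynomial.monic_X) f x)

/-- The element `C₁` of `U(ĝ₁)`. -/
def cent₁ : U₁ :=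
  UniversalEnvelopingAlgebra.ι ℂ (Affine.central (g := sl2) (resCocycle _ (Polynomial.monic_X (R := ℂ))))

theorem tp_zero : tp 0 = 1 := by rw [tp, pow_zero, map_one]

theorem tp_succ_mul_τ₁ (n : ℕ) : tp (n + 1) * τ₁ 0 = tp n := by
  rw [tp, tp, τ₁, pow_succ, map_mul, zero_add, pow_one, mul_assoc, IsLocalization.Away.mul_invSelf,
    mul_one]

theorem ddt_one {k : Type} [CommRing k] : ddt (1 : LaurentSeries k) = 0 := by
  have := ddt_polyInfty (1 : k[X])
  simpa using this

theorem residuePairing_one_left {k : Type} [CommRing k] (q : k[X]) (hq : q.Monic) (f : Punctured q) :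
    residuePairing q hq 1 f = 0 := by
  rw [residuePairing_apply, map_one, ddt_one, mul_zero, HahnSeries.coeff_zero]

theorem residuePairing_tp_one : residuePairing _ Polynomial.monic_X (tp 1) (τ₁ 0) = 1 := by
  rw [residuePairing_apply, tp, pow_one, expandInfty_poly, ddt_polyInfty, Polynomial.derivative_X,
    map_one, mul_one]
  have := (polarBasis₁.lead 0).coeff_self
  simpa using this

theorem residuePairing_tp_add_two (n : ℕ) :
    residuePairing _ Polynomial.monic_X (tp (n + 2)) (τ₁ 0) = 0 := by
  have h : Polynomial.derivative (Polynomial.X ^ (n + 2) : ℂ[X]) =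
      Polynomial.X * (Polynomial.C ((n : ℂ) + 2) * Polynomial.X ^ n) := by
    rw [Polynomial.derivative_X_pow]
    simp only [Nat.add_succ_sub_one]
    push_cast
    ring
  have h2 : expandInfty _ Polynomial.monic_X (τ₁ 0) * polyInfty Polynomial.X = 1 := by
    rw [← expandInfty_poly _ Polynomial.monic_X, ← map_mul, τ₁, zero_add, pow_one, mul_comm,
      IsLocalization.Away.mul_invSelf, map_one]
  rw [residuePairing_apply, tp, expandInfty_poly, ddt_polyInfty, h, map_mul, ← mul_assoc, h2, one_mul]
  exact polyInfty_coeff_one _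

theorem loop_lie {k K : Type} [CommRing k] [CommRing K] [Algebra k K] [Algebra ℂ k] [Algebra ℂ K]
    [IsScalarTower ℂ k K] {g : Type} [LieRing g] [LieAlgebra ℂ g] (c : LoopCocycle k K) (f f' : K)
    (x y : g) : ⁅Affine.loop c f x, Affine.loop c f' y⁆ =
      Affine.loop c (f * f') ⁅x, y⁆ + (killingForm ℂ g x y • c.form f f') • Affine.central c := by
  rw [Affine.lie_def]
  refine Prod.ext ?_ ?_
  · change ⁅f ⊗ₜ[ℂ] x, f' ⊗ₜ[ℂ] y⁆ = (f * f') ⊗ₜ[ℂ] ⁅x, y⁆ + _ • (0 : K ⊗[ℂ] g)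
    rw [smul_zero, add_zero, LieAlgebra.ExtendScalars.bracket_tmul]
  · change loopForm g c (f ⊗ₜ[ℂ] x) (f' ⊗ₜ[ℂ] y) = 0 + _ • (1 : k)
    rw [loopForm_tmul, smul_eq_mul, mul_one, zero_add]

theorem cur_add_right (f : Punctured (Polynomial.X : ℂ[X])) (x y : sl2) :
    cur f (x + y) = cur f x + cur f y := by rw [cur, loop_add_right, map_add]; rfl

theorem cur_smul_right (c : ℂ) (f : Punctured (Polynomial.X : ℂ[X])) (x : sl2) :
    cur f (c • x) = c • cur f x := by rw [cur, loop_smul_right, map_smul]; rfl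

theorem cur_add_left (f f' : Punctured (Polynomial.X : ℂ[X])) (x : sl2) :
    cur (f + f') x = cur f x + cur f' x := by rw [cur, loop_add_left, map_add]; rfl

theorem cur_smul_left (c : ℂ) (f : Punctured (Polynomial.X : ℂ[X])) (x : sl2) :
    cur (c • f) x = c • cur f x := by rw [cur, loop_smul_left, map_smul]; rfl

theorem cur_zero_right (f : Punctured (Polynomial.X : ℂ[X])) : cur f 0 = 0 := by
  have := cur_smul_right 0 f 0
  rwa [zero_smul, zero_smul] at this

theorem ι_comm {k L : Type} [CommRing k] [LieRing L] [LieAlgebra k L] {Z : Type} [AddCommGroup Z]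
    [Module (UniversalEnvelopingAlgebra k L) Z] (X Y : L) (z : Z) :
    UniversalEnvelopingAlgebra.ι k X • UniversalEnvelopingAlgebra.ι k Y • z =
      UniversalEnvelopingAlgebra.ι k Y • UniversalEnvelopingAlgebra.ι k X • z +
        UniversalEnvelopingAlgebra.ι k ⁅X, Y⁆ • z := by
  rw [LieHom.map_lie, LieRing.of_associative_ring_bracket, sub_smul, mul_smul, mul_smul]
  abel

variable {Z : Type} [AddCommGroup Z] [Module ℂ Z] [Module U₁ Z] [IsScalarTower ℂ U₁ Z]

theorem cur_comm (f f' : Punctured (Polynomial.X : ℂ[X])) (x y : sl2) (z : Z) :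
    cur f x • cur f' y • z = cur f' y • cur f x • z + cur (f * f') ⁅x, y⁆ • z +
      (killingForm ℂ sl2 x y * residuePairing _ Polynomial.monic_X f f') • cent₁ • z := by
  rw [cur, cur, ι_comm, loop_lie, map_add, map_smul, add_smul, smul_assoc, ← add_assoc]
  rfl

theorem cur_one_comm (f : Punctured (Polynomial.X : ℂ[X])) (x y : sl2) (z : Z) :
    cur 1 x • cur f y • z = cur f y • cur 1 x • z + cur f ⁅x, y⁆ • z := by
  rw [cur_comm, residuePairing_one_left, mul_zero, zero_smul, add_zero, one_mul]

theorem cur_tp_comm (n : ℕ) (x y : sl2) (z : Z) :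
    cur (tp n) x • cur 1 y • z = cur 1 y • cur (tp n) x • z + cur (tp n) ⁅x, y⁆ • z := by
  rw [cur_one_comm, add_assoc, ← add_smul, ← cur_add_right, ← lie_skew x y, add_neg_cancel,
    cur_zero_right, zero_smul, add_zero]

variable (Z) in
/-- The action of `sl(2) ⊂ ĝ₁`. -/
def zeroModes : sl2 →ₗ⁅ℂ⁆ Module.End ℂ Z where
  toFun x := Algebra.lsmul ℂ ℂ Z (cur 1 x)
  map_add' x y := by rw [cur_add_right, map_add]
  map_smul' c x := by rw [cur_smul_right, map_smul]; rfl
  map_lie' {x y} := by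
    ext z
    rw [LieRing.of_associative_ring_bracket]
    change cur 1 ⁅x, y⁆ • z = cur 1 x • cur 1 y • z - cur 1 y • cur 1 x • z
    rw [cur_one_comm]; abel

theorem zeroModes_apply (x : sl2) (z : Z) : zeroModes Z x z = cur 1 x • z := rfl

theorem zeroModes_pow_succ (n : ℕ) (z : Z) :
    (zeroModes Z sl2f ^ (n + 1)) z = (zeroModes Z sl2f ^ n) (cur 1 sl2f • z) := by
  rw [pow_succ, Module.End.mul_apply]; rfl

/-- By the Leibniz rule, powers of the constant `f` distribute over the current, through `ad f`, and
over `z`; with `d + N` factors one of the two always vanishes. -/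
theorem f_pow_cur (s : ℕ) : ∀ (d N : ℕ), d + N ≤ s → ∀ (f : Punctured (Polynomial.X : ℂ[X])) (x : sl2)
    (z : Z), (LieAlgebra.ad ℂ sl2 sl2f ^ d) x = 0 → (zeroModes Z sl2f ^ N) z = 0 →
      (zeroModes Z sl2f ^ s) (cur f x • z) = 0 := by
  induction s with
  | zero =>
    intro d N h f x z hx hz
    obtain ⟨rfl, rfl⟩ : d = 0 ∧ N = 0 := by omega
    rw [pow_zero, Module.End.one_apply] at hz
    rw [hz, smul_zero, map_zero]
  | succ s ih =>
    intro d N h f x z hx hz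
    rcases d with _ | d
    · rw [pow_zero, Module.End.one_apply] at hx
      rw [hx, cur_zero_right, zero_smul, map_zero]
    rcases N with _ | N
    · rw [pow_zero, Module.End.one_apply] at hz
      rw [hz, smul_zero, map_zero]
    rw [zeroModes_pow_succ, cur_one_comm, map_add, ih (d + 1) N (by omega) f x _ hx (by
      rwa [zeroModes_pow_succ] at hz), zero_add]
    refine ih d (N + 1) (by omega) f _ z ?_ hz
    rwa [pow_succ, Module.End.mul_apply, LieAlgebra.ad_apply] at hx

theorem ad_f_pow_three (x : sl2) : (LieAlgebra.ad ℂ sl2 sl2f ^ 3) x = 0 := by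
  rw [pow_succ, pow_two, Module.End.mul_apply, Module.End.mul_apply, LieAlgebra.ad_apply,
    LieAlgebra.ad_apply, LieAlgebra.ad_apply, sl2_decomp x]
  simp only [lie_add, lie_smul, lie_self, lie_f_e, lie_f_h, smul_zero, add_zero]

end LevelOne
end
end TwoPoint

namespace TwoPoint
noncomputable section

attribute [local instance 100] LieRing.ofAssociativeRing

/-! ### Modules induced at `C = -1/2` and the vectors `(t⁻¹ e)^k v`. -/

section WeylOne
variable (V : Type) [AddCommGroup V] [Module ℂ V] [LieRingModule sl2 V] [LieModule ℂ sl2 V]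

/-- The vector `1 ⊗ v` of the induced module. -/
def wIncl : V →ₗ[ℂ] Weyl₁Of V := indIncl _ _

variable {V}

theorem cur_poly_wIncl (P : ℂ[X]) (x : sl2) (v : V) :
    cur (algebraMap ℂ[X] _ P) x • wIncl V v = P.coeff 0 • wIncl V ⁅x, v⁆ := by
  have h := ι_smul_indMk (plusIncl sl2 (Polynomial.X : ℂ[X]) Polynomial.monic_X)
    (onePointRep (0 : ℂ) (LieModule.toEnd ℂ sl2 V)) (Affine.loop (zeroCocycle ℂ) P x) v
  refine h.trans ?_
  change wIncl V (Polynomial.aeval (0 : ℂ) P • ⁅x, v⁆ + (0 : ℂ) • ((-1 / 2 : ℂ) • v)) = _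
  rw [zero_smul, add_zero, map_smul, Polynomial.coeff_zero_eq_aeval_zero]

theorem cur_one_wIncl (x : sl2) (v : V) : cur 1 x • wIncl V v = wIncl V ⁅x, v⁆ := by
  have := cur_poly_wIncl 1 x v
  rwa [map_one, Polynomial.coeff_one_zero, one_smul] at this

theorem cur_tp_wIncl (n : ℕ) (x : sl2) (v : V) : cur (tp (n + 1)) x • wIncl V v = 0 := by
  rw [tp, cur_poly_wIncl, Polynomial.coeff_X_pow, if_neg (by omega), zero_smul]

theorem cent₁_wIncl (v : V) : cent₁ • wIncl V v = (-1 / 2 : ℂ) • wIncl V v := by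
  have h := ι_smul_indMk (plusIncl sl2 (Polynomial.X : ℂ[X]) Polynomial.monic_X)
    (onePointRep (0 : ℂ) (LieModule.toEnd ℂ sl2 V)) (Affine.central (zeroCocycle ℂ)) v
  have h2 : plusIncl sl2 (Polynomial.X : ℂ[X]) Polynomial.monic_X (Affine.central (zeroCocycle ℂ)) =
      Affine.central (resCocycle _ Polynomial.monic_X) := Prod.ext (map_zero (loopMap sl2 _)) rfl
  rw [h2] at h
  refine h.trans ?_
  change wIncl V (evalMap _ _ (0 : ℂ[X] ⊗[ℂ] sl2) v + (1 : ℂ) • ((-1 / 2 : ℂ) • v)) = _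
  rw [map_zero, LinearMap.zero_apply, zero_add, one_smul, map_smul]

theorem central_lie {k K : Type} [CommRing k] [CommRing K] [Algebra k K] [Algebra ℂ k] [Algebra ℂ K]
    [IsScalarTower ℂ k K] {g : Type} [LieRing g] [LieAlgebra ℂ g] (c : LoopCocycle k K)
    (X : Affine g c) : ⁅Affine.central (g := g) c, X⁆ = 0 := by
  rw [Affine.lie_def]
  refine Prod.ext ?_ ?_
  · change ⁅(0 : K ⊗[ℂ] g), X.1⁆ = 0
    rw [zero_lie]
  · change loopForm g c (0 : K ⊗[ℂ] g) X.1 = 0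
    rw [map_zero, LinearMap.zero_apply]

theorem cent₁_mul (w : U₁) : cent₁ * w = w * cent₁ := by
  refine uea_induction (P := fun w => cent₁ * w = w * cent₁) (fun x => ?_) (fun c => ?_)
    (fun w w' h h' => ?_) (fun w w' h h' => ?_) w
  · have h : ⁅cent₁, UniversalEnvelopingAlgebra.ι ℂ x⁆ = 0 := by
      rw [cent₁, ← LieHom.map_lie, central_lie, map_zero]
    rwa [LieRing.of_associative_ring_bracket, sub_eq_zero] at h
  · exact (Algebra.commutes c cent₁).symm
  · rw [mul_add, add_mul, h, h']
  · rw [← mul_assoc, h, mul_assoc, h', mul_assoc]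

theorem cent₁_smul (z : Weyl₁Of V) : cent₁ • z = (-1 / 2 : ℂ) • z := by
  induction z using ind_induction with
  | hmk v => exact cent₁_wIncl v
  | hadd z w hz hw => rw [smul_add, smul_add, hz, hw]
  | hsmul w z hz => rw [← mul_smul, cent₁_mul, mul_smul, hz, smul_algebra_smul_comm]

/-- Nilpotency on the inducing module spreads to the induced one because `ad f` is nilpotent. It
allows `pow_f_eq_zero` to be applied to any highest weight vector for the constant `sl(2)`. -/
theorem f_locally_nilpotent (hV : IsNilpotent (LieModule.toEnd ℂ sl2 V sl2f)) (z : Weyl₁Of V) :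
    ∃ N, (zeroModes (Weyl₁Of V) sl2f ^ N) z = 0 := by
  have hmono : ∀ {N N' : ℕ} {z : Weyl₁Of V}, N ≤ N' → (zeroModes (Weyl₁Of V) sl2f ^ N) z = 0 →
      (zeroModes (Weyl₁Of V) sl2f ^ N') z = 0 := fun h hz => by
    rw [← Nat.sub_add_cancel h, pow_add, Module.End.mul_apply, hz, map_zero]
  let S : Submodule ℂ (Weyl₁Of V) :=
    { carrier := {z | ∃ N, (zeroModes (Weyl₁Of V) sl2f ^ N) z = 0}
      add_mem' := by
        rintro z w ⟨N, hN⟩ ⟨N', hN'⟩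
        refine ⟨max N N', ?_⟩
        rw [map_add, hmono (le_max_left _ _) hN, hmono (le_max_right _ _) hN', add_zero]
      zero_mem' := ⟨0, by simp⟩
      smul_mem' := by
        rintro c z ⟨N, hN⟩
        exact ⟨N, by rw [map_smul, hN, smul_zero]⟩ }
  have hS : ∀ (ξ : g₁) (z : Weyl₁Of V), z ∈ S → UniversalEnvelopingAlgebra.ι ℂ ξ • z ∈ S := by
    intro ξ
    refine affine_induction _ (P := fun ξ : g₁ => ∀ z ∈ S, UniversalEnvelopingAlgebra.ι ℂ ξ • z ∈ S)
      (fun X Y hX hY z hz => ?_) (fun f x z hz => ?_) (fun v z hz => ?_) ξ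
    · rw [map_add, add_smul]; exact add_mem (hX z hz) (hY z hz)
    · obtain ⟨N, hN⟩ := hz
      exact ⟨3 + N, f_pow_cur (3 + N) 3 N le_rfl f x z (ad_f_pow_three x) hN⟩
    · rw [map_smul, smul_assoc]
      refine S.smul_mem v ?_
      have h : UniversalEnvelopingAlgebra.ι ℂ (Affine.central (g := sl2)
        (resCocycle _ (Polynomial.monic_X (R := ℂ)))) • z = (-1 / 2 : ℂ) • z := cent₁_smul z
      rw [h]
      exact S.smul_mem _ hz
  have key : z ∈ S := by
    induction z using ind_induction with
    | hmk v =>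
      obtain ⟨N, hN⟩ := hV
      refine ⟨N, ?_⟩
      have h : ∀ n, (zeroModes (Weyl₁Of V) sl2f ^ n) (wIncl V v) =
          wIncl V ((LieModule.toEnd ℂ sl2 V sl2f ^ n) v) := by
        intro n
        induction n with
        | zero => rfl
        | succ n ih =>
          rw [pow_succ', Module.End.mul_apply, ih, zeroModes_apply, cur_one_wIncl, pow_succ',
            Module.End.mul_apply]; rfl
      refine (h N).trans ?_
      rw [hN, LinearMap.zero_apply, map_zero]
    | hadd z w hz hw => exact add_mem hz hw
    | hsmul w z hz => exact uea_smul_mem S hS w hz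
  exact key

section HighestWeight
variable {v : V} {ν : ℂ}

/-- The vector `(t⁻¹ e)^k v`. -/
def eVec (v : V) (k : ℕ) : Weyl₁Of V := cur (τ₁ 0) sl2e ^ k • wIncl V v

theorem eVec_succ (v : V) (k : ℕ) : eVec v (k + 1) = cur (τ₁ 0) sl2e • eVec v k := by
  rw [eVec, pow_succ', mul_smul]; rfl

theorem eVec_zero (v : V) : eVec v 0 = wIncl V v := by rw [eVec, pow_zero, one_smul]

theorem tp_e_eVec (he : ⁅sl2e, v⁆ = 0) (n k : ℕ) : cur (tp n) sl2e • eVec v k = 0 := by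
  induction k with
  | zero =>
    rw [eVec_zero]
    rcases n with _ | n
    · rw [tp_zero, cur_one_wIncl, he, map_zero]
    · exact cur_tp_wIncl n _ _
  | succ k ih =>
    rw [eVec_succ, cur_comm, ih, killing_e_e, zero_mul, zero_smul, lie_self, cur_zero_right, smul_zero,
      zero_smul, add_zero, add_zero]

theorem tp_h_eVec (he : ⁅sl2e, v⁆ = 0) (n k : ℕ) : cur (tp (n + 1)) sl2h • eVec v k = 0 := by
  induction k with
  | zero => rw [eVec_zero]; exact cur_tp_wIncl n _ _
  | succ k ih =>
    rw [eVec_succ, cur_comm, ih, killing_h_e, zero_mul, zero_smul, lie_h_e, cur_smul_right, smul_assoc,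
      tp_succ_mul_τ₁, tp_e_eVec he, smul_zero, smul_zero, add_zero, add_zero]

theorem h_eVec (hh : ⁅sl2h, v⁆ = ν • v) (k : ℕ) :
    cur 1 sl2h • eVec v k = (ν + 2 * k) • eVec v k := by
  induction k with
  | zero => rw [eVec_zero, cur_one_wIncl, hh, map_smul]; simp
  | succ k ih =>
    rw [eVec_succ, cur_one_comm, ih, lie_h_e, cur_smul_right, smul_assoc, smul_algebra_smul_comm,
      ← add_smul]
    congr 1; push_cast; ring

/-- Commuting past `t⁻¹ e` produces only `t^{n+1} h`, which kills the vector; there is no central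
term because `t⁻¹ d(t^{n+2})` has no residue. -/
theorem tp_f_eVec (he : ⁅sl2e, v⁆ = 0) (n k : ℕ) : cur (tp (n + 2)) sl2f • eVec v k = 0 := by
  induction k with
  | zero => rw [eVec_zero]; exact cur_tp_wIncl (n + 1) _ _
  | succ k ih =>
    rw [eVec_succ, cur_comm, ih, residuePairing_tp_add_two, mul_zero, zero_smul, lie_f_e, cur_smul_right,
      smul_assoc, tp_succ_mul_τ₁, tp_h_eVec he, smul_zero, smul_zero, add_zero, add_zero]

/-- Passing `t f` across one factor `t⁻¹ e` contributes `-h`, of eigenvalue `-(ν + 2k)`, and the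
central term `4 · (-1/2) = -2`. Summing `ν + 2i + 2` over `i ≤ k` gives `(k+1)(ν+k+2)`. -/
theorem tp_one_f_eVec (hh : ⁅sl2h, v⁆ = ν • v) (k : ℕ) :
    cur (tp 1) sl2f • eVec v (k + 1) = (-((k + 1) * (ν + k + 2))) • eVec v k := by
  have hs : ∀ k, cur (tp 1) sl2f • eVec v (k + 1) =
      cur (τ₁ 0) sl2e • cur (tp 1) sl2f • eVec v k - (ν + 2 * k + 2) • eVec v k := by
    intro k
    rw [eVec_succ, cur_comm, residuePairing_tp_one, killing_f_e, lie_f_e, cur_smul_right, smul_assoc,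
      tp_succ_mul_τ₁, tp_zero, h_eVec hh, cent₁_smul, smul_smul (-1 : ℂ), smul_smul (4 * 1 : ℂ), add_assoc, ← add_smul,
      sub_eq_add_neg, ← neg_smul]
    congr 2; ring
  induction k with
  | zero =>
    rw [hs, eVec_zero, cur_tp_wIncl, smul_zero, zero_sub, ← neg_smul]
    congr 1; push_cast; ring
  | succ k ih =>
    rw [hs, ih, smul_algebra_smul_comm, ← eVec_succ, ← sub_smul]
    congr 1; push_cast; ring

end HighestWeight
end WeylOne
end
end TwoPoint

namespace TwoPoint
noncomputable section

attribute [local instance 100] LieRing.ofAssociativeRing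

/-! ### The deformed embedding `ψ` of the tensor product in `𝕎₁`. -/

namespace TensorDecomp
variable {l m : ℕ} {u : ℕ → Vrep l ⊗[ℂ] Vrep m} (D : TensorDecomp l m u)

/-- The sum of the components with index at least `i`. -/
def ge (i : ℕ) : Submodule ℂ (Vrep l ⊗[ℂ] Vrep m) := ⨅ k : Fin i, LinearMap.ker (D.p k)

theorem mem_ge {i : ℕ} {v : Vrep l ⊗[ℂ] Vrep m} : v ∈ D.ge i ↔ ∀ k < i, D.p k v = 0 := by
  simp only [ge, Submodule.mem_iInf, LinearMap.mem_ker]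
  exact ⟨fun h k hk => h ⟨k, hk⟩, fun h k => h k k.2⟩

theorem ge_antitone : Antitone D.ge := fun i j h v hv => by
  rw [mem_ge] at hv ⊢
  exact fun k hk => hv k (hk.trans_le h)

theorem ι_mem_ge {i j : ℕ} (h : i ≤ j) (w : Vrep (l + m - 2 * j)) : D.ι j w ∈ D.ge i := by
  rw [mem_ge]
  intro k hk
  rw [p_apply, D.q_ι_ne k j _ (by omega), map_zero]

theorem sum_p_of_mem_ge {i : ℕ} {v : Vrep l ⊗[ℂ] Vrep m} (hv : v ∈ D.ge i) :
    v = ∑ j ∈ Finset.Icc i m, D.p j v := by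
  conv_lhs => rw [← D.sum_p (Nat.lt_succ_self m) v]
  refine (Finset.sum_subset (fun j hj => ?_) fun j hj hj' => ?_).symm
  · rw [Finset.mem_Icc] at hj; rw [Finset.mem_range]; omega
  · refine (D.mem_ge.mp hv) j ?_
    rw [Finset.mem_Icc] at hj'; rw [Finset.mem_range] at hj; omega

theorem ge_zero : D.ge 0 = ⊤ := by
  rw [eq_top_iff]
  intro v _
  rw [mem_ge]
  intro k hk; omega

/-- The `U(ĝ₁)`-submodule generated by the components with index at least `i`. -/
def geSpan (i : ℕ) : Submodule U₁ (W₁ l m) := Submodule.span U₁ (wIncl _ '' (D.ge i : Set _))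

theorem geSpan_antitone : Antitone D.geSpan := fun _ _ h =>
  Submodule.span_mono (Set.image_mono (D.ge_antitone h))

theorem wIncl_mem_geSpan {i : ℕ} {v : Vrep l ⊗[ℂ] Vrep m} (hv : v ∈ D.ge i) :
    wIncl _ v ∈ D.geSpan i := Submodule.subset_span ⟨v, hv, rfl⟩

theorem eVec_mem_geSpan {i : ℕ} {v : Vrep l ⊗[ℂ] Vrep m} (hv : v ∈ D.ge i) (k : ℕ) :
    eVec v k ∈ D.geSpan i := (D.geSpan i).smul_mem _ (D.wIncl_mem_geSpan hv)

/-- The coefficients of the vectors `∑ c_{jk} (t⁻¹ e)^k u_{j+k}` -/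
def psiCoeff (l m : ℕ) (γ : ℕ → ℂ) : ℕ → ℕ → ℂ
  | _, 0 => 1
  -- This solves the requirement that `t f` carry the `j`-th vector to `γ j` times the next,
  -- compared at `(t⁻¹ e)^k u_{j+k+1}`; the denominator is the scalar of `tp_one_f_eVec` up to sign.
  | j, k + 1 => -(γ j * psiCoeff l m γ (j + 1) k) /
      ((k + 1) * ((l : ℂ) + m - 2 * (j + k + 1 : ℕ) + k + 2))

/-- The vector `∑ c_{jk} (t⁻¹ e)^k u_{j+k}`. -/
def psiVec (γ : ℕ → ℂ) (j : ℕ) : W₁ l m :=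
  ∑ k ∈ Finset.range (m + 1), psiCoeff l m γ j k • eVec (D.hv (j + k)) k

theorem psiCoeff_mul (hml : m ≤ l) (γ : ℕ → ℂ) (j k : ℕ) :
    (psiCoeff l m γ j (k + 1) * -((k + 1) * ((l : ℂ) + m - 2 * (j + k + 1 : ℕ) + k + 2))) •
      eVec (D.hv (j + k + 1)) k = (γ j * psiCoeff l m γ (j + 1) k) • eVec (D.hv (j + k + 1)) k := by
  by_cases h : j + k + 1 ≤ m
  · have h1 : ((l : ℂ) + m - 2 * (j + k + 1 : ℕ) + k + 2) ≠ 0 := by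
      have : ((l : ℂ) + m - 2 * (j + k + 1 : ℕ) + k + 2) = ((l + m - 2 * (j + k + 1) + k + 2 : ℕ) : ℂ) := by
        obtain ⟨d, hd⟩ := Nat.exists_eq_add_of_le (by omega : 2 * (j + k + 1) ≤ l + m)
        have e := congrArg (Nat.cast : ℕ → ℂ) hd
        rw [show l + m - 2 * (j + k + 1) = d by omega]
        push_cast at e ⊢
        linear_combination e
      rw [this]
      exact_mod_cast (by omega : l + m - 2 * (j + k + 1) + k + 2 ≠ 0)
    have h2 : ((k : ℂ) + 1) ≠ 0 := by exact_mod_cast k.succ_ne_zero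
    congr 1
    rw [psiCoeff]
    field_simp
  -- Past index `m` the vector itself is zero, so the coefficient and a possibly vanishing
  -- denominator are irrelevant.
  · rw [D.hv_of_lt (by omega), eVec, map_zero, smul_zero, smul_zero, smul_zero]

theorem tp_one_f_psiVec (hml : m ≤ l) (γ : ℕ → ℂ) (j : ℕ) :
    cur (tp 1) sl2f • D.psiVec γ j = γ j • D.psiVec γ (j + 1) := by
  -- On the left the term `k = 0` disappears since `t f` kills the inducing space; on the right the
  -- last term disappears since its highest weight vector has index above `m`. The remaining sums
  -- match after a shift.
  rw [psiVec, psiVec, Finset.smul_sum, Finset.smul_sum, Finset.sum_range_succ', Finset.sum_range_succ,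
    eVec_zero, smul_algebra_smul_comm, cur_tp_wIncl, smul_zero, add_zero,
    D.hv_of_lt (by omega : m < j + 1 + m), eVec, map_zero, smul_zero, smul_zero, smul_zero, add_zero]
  refine Finset.sum_congr rfl fun k _ => ?_
  rw [smul_algebra_smul_comm, tp_one_f_eVec (D.h_hv' hml _), smul_smul, smul_smul,
    show j + 1 + k = j + k + 1 by omega]
  exact D.psiCoeff_mul hml γ j k

theorem psiVec_sub_mem (γ : ℕ → ℂ) (j : ℕ) : D.psiVec γ j - wIncl _ (D.hv j) ∈ D.geSpan (j + 1) := by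
  rw [psiVec, Finset.sum_range_succ', eVec_zero, psiCoeff, one_smul, add_zero, add_sub_cancel_right]
  refine sum_mem fun k _ => ?_
  rw [← algebraMap_smul U₁]
  refine (D.geSpan (j + 1)).smul_mem _ (D.eVec_mem_geSpan ?_ _)
  exact D.ι_mem_ge (by omega) _

theorem smul_geSpan_mem {i : ℕ} (c : ℂ) {z : W₁ l m} (hz : z ∈ D.geSpan i) : c • z ∈ D.geSpan i := by
  rw [← algebraMap_smul U₁]; exact (D.geSpan i).smul_mem _ hz

/-- The deformed embedding of `V^l ⊗ V^m` in `𝕎₁`, on which `t x` acts by the operator `θ`. -/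
theorem exists_psi (hml : m ≤ l) : ∃ ψ : Vrep l ⊗[ℂ] Vrep m →ₗ[ℂ] W₁ l m,
    (∀ (P : ℂ[X]) (x : sl2) v, cur (algebraMap ℂ[X] _ P) x • ψ v =
      P.coeff 0 • ψ ⁅x, v⁆ + P.coeff 1 • ψ (D.θ x v)) ∧
    ∀ j w, ψ (D.ι j w) - wIncl _ (D.ι j w) ∈ D.geSpan (j + 1) := by
  choose γ hγ using D.exists_θ_f_hv hml
  -- Each summand `(t⁻¹ e)^k u_{j+k}` has weight `l + m - 2j` and the same annihilation properties
  -- as `u_j`, except under `t f`, so these relations are checked term by term.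
  have hlow : ∀ (n : ℕ) (x : sl2) (c : ℂ) j, (∀ k, cur (tp n) x • eVec (D.hv (j + k)) k = 
      c • eVec (D.hv (j + k)) k) → cur (tp n) x • D.psiVec γ j = c • D.psiVec γ j := by
    intro n x c j h
    rw [psiVec, Finset.smul_sum, Finset.smul_sum]
    refine Finset.sum_congr rfl fun k _ => ?_
    rw [smul_algebra_smul_comm, h, smul_comm]
  have he : ∀ n j, cur (tp n) sl2e • D.psiVec γ j = 0 := fun n j => by
    rw [hlow n sl2e 0 j fun k => by rw [tp_e_eVec (D.e_hv _), zero_smul], zero_smul]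
  have hh : ∀ n j, cur (tp (n + 1)) sl2h • D.psiVec γ j = 0 := fun n j => by
    rw [hlow (n + 1) sl2h 0 j fun k => by rw [tp_h_eVec (D.e_hv _), zero_smul], zero_smul]
  have hf : ∀ n j, cur (tp (n + 2)) sl2f • D.psiVec γ j = 0 := fun n j => by
    rw [hlow (n + 2) sl2f 0 j fun k => by rw [tp_f_eVec (D.e_hv _), zero_smul], zero_smul]
  have he0 : ∀ j, zeroModes (W₁ l m) sl2e (D.psiVec γ j) = 0 := fun j => by
    rw [zeroModes_apply, ← tp_zero, he]
  have hh0 : ∀ j ≤ m, zeroModes (W₁ l m) sl2h (D.psiVec γ j) =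
      ((l + m - 2 * j : ℕ) : ℂ) • D.psiVec γ j := fun j hj => by
    rw [zeroModes_apply, ← tp_zero]
    refine hlow 0 sl2h _ j fun k => ?_
    rw [tp_zero, h_eVec (D.h_hv' hml _), Nat.cast_sub (by omega)]
    congr 1; push_cast; ring
  obtain ⟨ψ, hψ, hψl⟩ := D.exists_hom (zeroModes (W₁ l m)) (D.psiVec γ) (fun j _ => he0 j) hh0
    fun j hj => by
      obtain ⟨N, hN⟩ := f_locally_nilpotent (tensor_f_nilpotent (l := l) (m := m)) (D.psiVec γ j)
      exact pow_f_eq_zero (he0 j) (hh0 j hj) hN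
  have hψ' : ∀ j, ψ (D.hv j) = D.psiVec γ j := by
    intro j
    by_cases hj : j ≤ m
    · exact hψ j hj
    · rw [D.hv_of_lt (by omega), map_zero, psiVec]
      refine (Finset.sum_eq_zero fun k _ => ?_).symm
      rw [D.hv_of_lt (by omega), eVec, map_zero, smul_zero, smul_zero]
  have hlin : ∀ (f : Punctured (Polynomial.X : ℂ[X])) (x : sl2) (z : W₁ l m), cur f x • z =
      x.1 0 1 • cur f sl2e • z + x.1 0 0 • cur f sl2h • z + x.1 1 0 • cur f sl2f • z := by
    intro f x z
    conv_lhs => rw [sl2_decomp x]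
    rw [cur_add_right, cur_add_right, cur_smul_right, cur_smul_right, cur_smul_right, add_smul, add_smul,
      smul_assoc, smul_assoc, smul_assoc]
  have hzero : ∀ (x : sl2) v, cur 1 x • ψ v = ψ ⁅x, v⁆ := fun x v => (hψl x v).symm
  -- The vectors for which the relation holds with every `x` are stable under the constant `f`, so
  -- highest weight vectors suffice. The same reduction is used for `t x`.
  have htwo : ∀ n (x : sl2) v, cur (tp (n + 2)) x • ψ v = 0 := by
    intro n x v
    let N : Submodule ℂ (Vrep l ⊗[ℂ] Vrep m) :=
      { carrier := {v | ∀ x : sl2, cur (tp (n + 2)) x • ψ v = 0}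
        add_mem' := fun {v w} hv hw x => by rw [map_add, smul_add, hv x, hw x, add_zero]
        zero_mem' := fun x => by rw [map_zero, smul_zero]
        smul_mem' := fun c v hv x => by rw [map_smul, smul_algebra_smul_comm, hv x, smul_zero] }
    have hN : N = ⊤ := D.eq_top_of_hv_mem N (fun j x => by
        rw [hψ', hlin, he, hh (n + 1), hf]; simp) fun v hv x => by
      rw [← hzero, cur_tp_comm, hv x, hv _, smul_zero, add_zero]
    have hv : v ∈ N := by rw [hN]; trivial
    exact hv x
  have hone : ∀ (x : sl2) v, cur (tp 1) x • ψ v = ψ (D.θ x v) := by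
    intro x v
    let N : Submodule ℂ (Vrep l ⊗[ℂ] Vrep m) :=
      { carrier := {v | ∀ x : sl2, cur (tp 1) x • ψ v = ψ (D.θ x v)}
        add_mem' := fun {v w} hv hw x => by rw [map_add, smul_add, hv x, hw x, map_add, map_add]
        zero_mem' := fun x => by simp
        smul_mem' := fun c v hv x => by
          rw [map_smul, smul_algebra_smul_comm, hv x, map_smul, map_smul] }
    have hN : N = ⊤ := D.eq_top_of_hv_mem N (fun j x => by
        rw [hψ', hlin, he, hh 0, D.tp_one_f_psiVec hml]
        conv_rhs => rw [sl2_decomp x]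
        rw [map_add, map_add, map_smul, map_smul, map_smul, LinearMap.add_apply, LinearMap.add_apply,
          LinearMap.smul_apply, LinearMap.smul_apply, LinearMap.smul_apply, D.θ_e_hv hml, D.θ_h_hv hml,
          hγ, smul_zero, smul_zero, smul_zero, smul_zero, add_zero, zero_add, zero_add, zero_add, map_smul,
          map_smul, hψ']) fun v hv x => by
      rw [← hzero, cur_tp_comm, hv x, hv _, hzero, lie_θ, map_add, add_assoc,
        ← lie_skew x sl2f, map_neg, LinearMap.neg_apply, map_neg, add_neg_cancel, add_zero]
    have hv : v ∈ N := by rw [hN]; trivial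
    exact hv x
  refine ⟨ψ, fun P x v => ?_, fun j w => ?_⟩
  · induction P using Polynomial.induction_on' with
    | add P Q hP hQ =>
      rw [map_add, cur_add_left, add_smul, hP, hQ, Polynomial.coeff_add, Polynomial.coeff_add, add_smul,
        add_smul]
      abel
    | monomial n c =>
      have h : algebraMap ℂ[X] (Punctured (Polynomial.X : ℂ[X])) (Polynomial.monomial n c) = c • tp n := by
        rw [tp, ← Polynomial.C_mul_X_pow_eq_monomial, ← Polynomial.smul_eq_C_mul]
        exact map_smul (IsScalarTower.toAlgHom ℂ ℂ[X] (Punctured (Polynomial.X : ℂ[X]))) c _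
      rw [h, cur_smul_left, smul_assoc, Polynomial.coeff_monomial, Polynomial.coeff_monomial]
      rcases n with _ | _ | n
      · rw [tp_zero, hzero]; simp
      · rw [hone]; simp
      · rw [htwo]; simp
  -- On the highest weight vector the difference consists of the terms with `k ≥ 1`, which have
  -- higher index; both maps are equivariant, so this propagates along the component.
  · by_cases hj : j ≤ m
    · let N : Submodule ℂ (Vrep (l + m - 2 * j)) :=
        { carrier := {w | ψ (D.ι j w) - wIncl _ (D.ι j w) ∈ D.geSpan (j + 1)}
          add_mem' := fun {v w} hv hw => by
            change ψ (D.ι j (v + w)) - wIncl _ (D.ι j (v + w)) ∈ D.geSpan (j + 1)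
            rw [map_add, map_add, map_add, add_sub_add_comm]; exact add_mem hv hw
          zero_mem' := by
            change ψ (D.ι j 0) - wIncl _ (D.ι j 0) ∈ D.geSpan (j + 1)
            rw [map_zero, map_zero, map_zero, sub_zero]; exact zero_mem _
          smul_mem' := fun c v hv => by
            change ψ (D.ι j (c • v)) - wIncl _ (D.ι j (c • v)) ∈ D.geSpan (j + 1)
            rw [map_smul, map_smul, map_smul, ← smul_sub]; exact D.smul_geSpan_mem c hv }
      have hN : N = ⊤ := vrep_submodule_eq_top N (by
          change ψ (D.hv j) - wIncl _ (D.hv j) ∈ D.geSpan (j + 1)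
          rw [hψ']; exact D.psiVec_sub_mem γ j) fun v hv => by
        change ψ (D.ι j _) - wIncl _ (D.ι j _) ∈ D.geSpan (j + 1)
        rw [D.lie_ι, ← hzero, ← cur_one_wIncl, ← smul_sub]
        exact (D.geSpan (j + 1)).smul_mem _ hv
      have hw : w ∈ N := by rw [hN]; trivial
      exact hw
    · rw [D.ι_eq_zero j (by omega), LinearMap.zero_apply, map_zero, map_zero, sub_zero]
      exact zero_mem _

end TensorDecomp
end
end TwoPoint

namespace TwoPoint
noncomputable section

attribute [local instance 100] LieRing.ofAssociativeRing

/-! ### PBW coordinates, functoriality and the filtration of `𝕎₁` by components. -/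

section PBWMap
variable {k L L' M M' I : Type} [CommRing k] [LieRing L] [LieAlgebra k L] [LieRing L'] [LieAlgebra k L']
  [AddCommGroup M] [Module k M] [AddCommGroup M'] [Module k M'] [LinearOrder I]
  (dec : L ≃ₗ[k] L' × (I →₀ k))
  {Z Z' : Type} [AddCommGroup Z] [Module k Z] [Module (UniversalEnvelopingAlgebra k L) Z]
  [IsScalarTower k (UniversalEnvelopingAlgebra k L) Z] [AddCommGroup Z'] [Module k Z']
  [Module (UniversalEnvelopingAlgebra k L) Z'] [IsScalarTower k (UniversalEnvelopingAlgebra k L) Z']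

theorem pbwMap_apply (φ : M →ₗ[k] Z) (z : Multiset I →₀ M) :
    pbwMap dec φ z = z.sum fun s v => pbwMonomial dec s • φ v := by
  simp [pbwMap]; rfl

theorem pbwMap_mem {φ : M →ₗ[k] Z} {P : Submodule (UniversalEnvelopingAlgebra k L) Z}
    {z : Multiset I →₀ M} (h : ∀ s, φ (z s) ∈ P) : pbwMap dec φ z ∈ P := by
  rw [pbwMap_apply]
  exact sum_mem fun s _ => P.smul_mem _ (h s)

theorem map_pbwMap (φ : M →ₗ[k] Z) (φ' : M' →ₗ[k] Z') (g : M →ₗ[k] M')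
    (Φ : Z →ₗ[UniversalEnvelopingAlgebra k L] Z') (h : ∀ v, Φ (φ v) = φ' (g v)) (z : Multiset I →₀ M) :
    Φ (pbwMap dec φ z) = pbwMap dec φ' (z.mapRange g (map_zero g)) := by
  rw [pbwMap_apply, pbwMap_apply, Finsupp.sum_mapRange_index (by simp), Finsupp.sum, Finsupp.sum, map_sum]
  exact Finset.sum_congr rfl fun s _ => by rw [map_smul, h]

theorem pbwMap_sub (φ ψ : M →ₗ[k] Z) (z : Multiset I →₀ M) :
    pbwMap dec (φ - ψ) z = pbwMap dec φ z - pbwMap dec ψ z := by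
  rw [pbwMap_apply, pbwMap_apply, pbwMap_apply, ← Finsupp.sum_sub]
  simp only [LinearMap.sub_apply, smul_sub]

end PBWMap

section WeylMap
variable {V V' : Type} [AddCommGroup V] [Module ℂ V] [LieRingModule sl2 V] [LieModule ℂ sl2 V]
  [AddCommGroup V'] [Module ℂ V'] [LieRingModule sl2 V'] [LieModule ℂ sl2 V']

/-- Functoriality of induction. -/
theorem exists_weylMap (φ : V →ₗ[ℂ] V') (hφ : ∀ (x : sl2) v, φ ⁅x, v⁆ = ⁅x, φ v⁆) :
    ∃ Φ : Weyl₁Of V →ₗ[U₁] Weyl₁Of V', ∀ v, Φ (wIncl V v) = wIncl V' (φ v) := by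
  refine exists_indLift (RingHom.id U₁) _ _ ((wIncl V').toAddMonoidHom.comp φ.toAddMonoidHom)
    (fun c v => ?_) (fun y v => ?_)
  · change wIncl V' (φ (c • v)) = algebraMap ℂ U₁ c • wIncl V' (φ v)
    rw [map_smul, map_smul, algebraMap_smul]
  · change wIncl V' (φ (onePointRep (0 : ℂ) (LieModule.toEnd ℂ sl2 V) y v)) =
      UniversalEnvelopingAlgebra.ι ℂ (plusIncl sl2 _ Polynomial.monic_X y) • indMk _ _ (φ v)
    rw [ι_smul_indMk]
    refine congrArg (wIncl V') ?_
    refine affine_induction _ (P := fun y : HatPlus sl2 ℂ =>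
      φ (onePointRep (0 : ℂ) (LieModule.toEnd ℂ sl2 V) y v) =
        onePointRep (0 : ℂ) (LieModule.toEnd ℂ sl2 V') y (φ v)) (fun X Y hX hY => ?_) (fun f x => ?_)
      (fun c => ?_) y
    · rw [map_add, LinearMap.add_apply, map_add, hX, hY, map_add, LinearMap.add_apply]
    · change φ (Polynomial.aeval (0 : ℂ) f • ⁅x, v⁆ + (0 : ℂ) • ((-1 / 2 : ℂ) • v)) =
        Polynomial.aeval (0 : ℂ) f • ⁅x, φ v⁆ + (0 : ℂ) • ((-1 / 2 : ℂ) • φ v)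
      rw [zero_smul, zero_smul, add_zero, add_zero, map_smul, hφ]
    · have h : ∀ {V : Type} [AddCommGroup V] [Module ℂ V] [LieRingModule sl2 V] [LieModule ℂ sl2 V]
          (v : V), onePointRep (0 : ℂ) (LieModule.toEnd ℂ sl2 V) (Affine.central (zeroCocycle ℂ)) v =
            (-1 / 2 : ℂ) • v := by
        intro V _ _ _ _ v
        change evalMap _ _ (0 : ℂ[X] ⊗[ℂ] sl2) v + (1 : ℂ) • ((-1 / 2 : ℂ) • v) = _
        rw [map_zero, LinearMap.zero_apply, zero_add, one_smul]
      rw [map_smul, map_smul, LinearMap.smul_apply, LinearMap.smul_apply, h, h, map_smul, map_smul]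

/-- The decomposition of `ĝ₁` used for ordered monomials. -/
def dec₁ : g₁ ≃ₗ[ℂ] HatPlus sl2 ℂ × (ℕ →₀ ℂ) := hatDec sl2Basis (Nat.divModEquiv 3) polarBasis₁

theorem pbw₁_bijective : Function.Bijective (pbwMap dec₁ (wIncl V)) :=
  pbwMap_bijective dec₁ _ _ (hatDec_plusIncl sl2Basis (Nat.divModEquiv 3) polarBasis₁)

end WeylMap

namespace TensorDecomp
variable {l m : ℕ} {u : ℕ → Vrep l ⊗[ℂ] Vrep m} (D : TensorDecomp l m u)

theorem sum_p_range_eq_zero_iff {i : ℕ} {v : Vrep l ⊗[ℂ] Vrep m} :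
    (∑ k ∈ Finset.range i, D.p k) v = 0 ↔ v ∈ D.ge i := by
  rw [mem_ge, LinearMap.sum_apply]
  refine ⟨fun h k hk => ?_, fun h => Finset.sum_eq_zero fun k hk => h k (Finset.mem_range.mp hk)⟩
  have h2 := congrArg (D.p k) h
  rwa [map_sum, map_zero, Finset.sum_eq_single_of_mem k (Finset.mem_range.mpr hk) fun j _ hj =>
    D.p_p_ne hj.symm v, p_p_self] at h2

/-- The projection to the components of index below `i` is equivariant, so it induces an
endomorphism of `𝕎₁` killing `geSpan i`. It acts coordinatewise, and uniqueness of PBW coordinates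
gives the forward direction. -/
theorem pbw₁_mem_geSpan {i : ℕ} {z : Multiset ℕ →₀ Vrep l ⊗[ℂ] Vrep m} :
    pbwMap dec₁ (wIncl _) z ∈ D.geSpan i ↔ ∀ s, z s ∈ D.ge i := by
  refine ⟨fun h s => ?_, fun h => pbwMap_mem _ fun s => D.wIncl_mem_geSpan (h s)⟩
  obtain ⟨Φ, hΦ⟩ := exists_weylMap (∑ k ∈ Finset.range i, D.p k) fun x v => by
    rw [LinearMap.sum_apply, LinearMap.sum_apply, lie_sum]
    exact Finset.sum_congr rfl fun k _ => D.lie_p k x v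
  have h1 : D.geSpan i ≤ LinearMap.ker Φ := by
    rw [geSpan, Submodule.span_le]
    rintro _ ⟨v, hv, rfl⟩
    rw [SetLike.mem_coe, LinearMap.mem_ker, hΦ, D.sum_p_range_eq_zero_iff.mpr hv, map_zero]
  have h2 := h1 h
  rw [LinearMap.mem_ker, map_pbwMap dec₁ _ (wIncl _) _ Φ hΦ] at h2
  have h3 := pbw₁_bijective.1 (h2.trans (map_zero _).symm)
  have h4 := DFunLike.congr_fun h3 s
  rw [Finsupp.mapRange_apply] at h4
  exact D.sum_p_range_eq_zero_iff.mp h4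

theorem geSpan_zero : D.geSpan 0 = ⊤ := by
  rw [eq_top_iff]
  intro w _
  obtain ⟨z, rfl⟩ := pbw₁_bijective.2 w
  rw [pbw₁_mem_geSpan, ge_zero]
  exact fun _ => trivial

theorem ge_of_lt {i : ℕ} (h : m < i) : D.ge i = ⊥ := by
  rw [eq_bot_iff]
  intro v hv
  rw [D.sum_p_of_mem_ge hv, Finset.Icc_eq_empty (by omega), Finset.sum_empty]
  exact zero_mem _

theorem geSpan_of_lt {i : ℕ} (h : m < i) : D.geSpan i = ⊥ := by
  rw [geSpan, D.ge_of_lt h, Submodule.span_eq_bot]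
  rintro _ ⟨v, hv, rfl⟩
  rw [(Submodule.mem_bot ℂ).mp hv, map_zero]

/-! ### Unitriangularity of `ψ` in PBW coordinates. -/

section Psi
variable {ψ : Vrep l ⊗[ℂ] Vrep m →ₗ[ℂ] W₁ l m}
  (hψ : ∀ j w, ψ (D.ι j w) - wIncl _ (D.ι j w) ∈ D.geSpan (j + 1))
include hψ

theorem psi_sub_mem {i : ℕ} {v : Vrep l ⊗[ℂ] Vrep m} (hv : v ∈ D.ge i) :
    ψ v - wIncl _ v ∈ D.geSpan (i + 1) := by
  rw [D.sum_p_of_mem_ge hv, map_sum, map_sum, ← Finset.sum_sub_distrib]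
  refine sum_mem fun j hj => D.geSpan_antitone ?_ (hψ j _)
  have := (Finset.mem_Icc.mp hj).1
  omega

theorem psi_mem {i : ℕ} {v : Vrep l ⊗[ℂ] Vrep m} (hv : v ∈ D.ge i) : ψ v ∈ D.geSpan i := by
  rw [← sub_add_cancel (ψ v) (wIncl _ v)]
  exact add_mem (D.geSpan_antitone (Nat.le_succ i) (D.psi_sub_mem hψ hv)) (D.wIncl_mem_geSpan hv)

theorem pbw_psi_sub_mem {i : ℕ} {z : Multiset ℕ →₀ Vrep l ⊗[ℂ] Vrep m} (hz : ∀ s, z s ∈ D.ge i) :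
    pbwMap dec₁ ψ z - pbwMap dec₁ (wIncl _) z ∈ D.geSpan (i + 1) := by
  rw [← pbwMap_sub]
  exact pbwMap_mem _ fun s => D.psi_sub_mem hψ (hz s)

/-- On coordinates in `ge k` the maps built from `ψ` and from the inclusion agree modulo `geSpan (k
+ 1)`; hence membership of the coordinates improves one step at a time, up to `i`. -/
theorem pbw_psi_mem_geSpan {i : ℕ} {z : Multiset ℕ →₀ Vrep l ⊗[ℂ] Vrep m} :
    pbwMap dec₁ ψ z ∈ D.geSpan i ↔ ∀ s, z s ∈ D.ge i := by
  refine ⟨fun h => ?_, fun h => pbwMap_mem _ fun s => D.psi_mem hψ (h s)⟩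
  have key : ∀ k ≤ i, ∀ s, z s ∈ D.ge k := by
    intro k
    induction k with
    | zero => intro _ s; rw [ge_zero]; trivial
    | succ k ih =>
      intro hk
      rw [← pbw₁_mem_geSpan, ← sub_sub_cancel (pbwMap dec₁ ψ z) (pbwMap dec₁ (wIncl _) z)]
      exact sub_mem (D.geSpan_antitone hk h) (D.pbw_psi_sub_mem hψ (ih (by omega)))
  exact key i le_rfl

theorem pbw_psi_injective : Function.Injective (pbwMap dec₁ ψ) := by
  rw [injective_iff_map_eq_zero]
  intro z hz
  have h : pbwMap dec₁ ψ z ∈ D.geSpan (m + 1) := by rw [hz]; exact zero_mem _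
  rw [D.pbw_psi_mem_geSpan hψ, D.ge_of_lt (Nat.lt_succ_self m)] at h
  ext1 s
  exact (Submodule.mem_bot ℂ).mp (h s)

/-- Successive approximation: the ordinary PBW coordinates give a preimage up to an error one step
deeper, and the filtration vanishes after `m + 1` steps. -/
theorem pbw_psi_surjective : Function.Surjective (pbwMap dec₁ ψ) := by
  have key : ∀ n, ∀ w ∈ D.geSpan (m + 1 - n), ∃ z, pbwMap dec₁ ψ z = w := by
    intro n
    induction n with
    | zero =>
      intro w hw
      rw [Nat.sub_zero, D.geSpan_of_lt (Nat.lt_succ_self m), Submodule.mem_bot] at hw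
      exact ⟨0, by rw [map_zero, hw]⟩
    | succ n ih =>
      intro w hw
      rcases Nat.lt_or_ge n (m + 1) with h | h
      · obtain ⟨z, rfl⟩ := pbw₁_bijective.2 w
        rw [pbw₁_mem_geSpan] at hw
        have h1 := D.pbw_psi_sub_mem hψ hw
        rw [show m + 1 - (n + 1) + 1 = m + 1 - n by omega] at h1
        obtain ⟨z', hz'⟩ := ih _ h1
        exact ⟨z - z', by rw [map_sub, hz', sub_sub_cancel]⟩
      · rw [show m + 1 - (n + 1) = m + 1 - n by omega] at hw
        exact ih w hw
  intro w
  refine key (m + 1) w ?_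
  rw [Nat.sub_self, geSpan_zero]; trivial

end Psi
end TensorDecomp
end
end TwoPoint

namespace TwoPoint
noncomputable section

attribute [local instance 100] LieRing.ofAssociativeRing

/-! ### Power series coefficients in `A ⊗ V`. -/

section Coefficients
variable {V : Type} [AddCommGroup V] [Module ℂ V]

/-- The coefficient of `aⁿ` of an element of `A ⊗ V`. -/
def cf (n : ℕ) : A ⊗[ℂ] V →ₗ[ℂ] V :=
  (TensorProduct.lid ℂ V).toLinearMap ∘ₗ (PowerSeries.coeff (R := ℂ) n).rTensor V

theorem cf_tmul (n : ℕ) (f : A) (v : V) : cf n (f ⊗ₜ[ℂ] v) = PowerSeries.coeff n f • v := rfl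

theorem cf_smul (n : ℕ) (f : A) (z : A ⊗[ℂ] V) :
    cf n (f • z) = ∑ ij ∈ Finset.HasAntidiagonal.antidiagonal n, PowerSeries.coeff ij.1 f • cf ij.2 z := by
  induction z using TensorProduct.induction_on with
  | zero => simp
  | add z w hz hw => simp only [smul_add, map_add, hz, hw, Finset.sum_add_distrib]
  | tmul g v =>
    rw [TensorProduct.smul_tmul', cf_tmul, smul_eq_mul, PowerSeries.coeff_mul, Finset.sum_smul]
    exact Finset.sum_congr rfl fun ij _ => by rw [cf_tmul, smul_smul]

theorem cf_a_pow_smul (i n : ℕ) (z : A ⊗[ℂ] V) :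
    cf n (a ^ i • z) = if i ≤ n then cf (n - i) z else 0 := by
  induction z using TensorProduct.induction_on with
  | zero => simp
  | add z w hz hw =>
    rw [smul_add, map_add, hz, hw, map_add]
    split_ifs <;> simp
  | tmul g v =>
    rw [TensorProduct.smul_tmul', cf_tmul, cf_tmul, smul_eq_mul, a, PowerSeries.coeff_X_pow_mul']
    split_ifs <;> simp

theorem cf_a_pow_tmul (i n : ℕ) (v : V) : cf n ((a ^ i : A) ⊗ₜ[ℂ] v) = if n = i then v else 0 := by
  rw [cf_tmul, a, PowerSeries.coeff_X_pow]
  split_ifs <;> simp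

variable {ι : Type} (b : Module.Basis ι ℂ V)

theorem coeff_repr (n : ℕ) (z : A ⊗[ℂ] V) (r : ι) :
    PowerSeries.coeff n ((Algebra.TensorProduct.basis A b).repr z r) = b.repr (cf n z) r := by
  induction z using TensorProduct.induction_on with
  | zero => simp
  | add z w hz hw => simp only [map_add, Finsupp.add_apply, hz, hw]
  | tmul f v =>
    rw [cf_tmul, Algebra.TensorProduct.basis_repr_tmul, map_smul]
    simp [mul_comm]

include b in
theorem eq_zero_of_cf {z : A ⊗[ℂ] V} (h : ∀ n, cf n z = 0) : z = 0 := by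
  rw [← (Algebra.TensorProduct.basis A b).repr.map_eq_zero_iff]
  ext r n
  rw [coeff_repr, h, map_zero]
  simp

include b in
theorem exists_eq_a_pow_smul [Fintype ι] {i : ℕ} {z : A ⊗[ℂ] V} (h : ∀ n < i, cf n z = 0) :
    ∃ w, z = a ^ i • w := by
  have h1 : ∀ r, ∃ g : A, (Algebra.TensorProduct.basis A b).repr z r = a ^ i * g := fun r => by
    refine PowerSeries.X_pow_dvd_iff.mpr fun n hn => ?_
    rw [coeff_repr, h n hn]; simp
  choose g hg using h1
  refine ⟨∑ r, g r • Algebra.TensorProduct.basis A b r, ?_⟩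
  conv_lhs => rw [← (Algebra.TensorProduct.basis A b).sum_repr z]
  rw [Finset.smul_sum]
  exact Finset.sum_congr rfl fun r _ => by rw [hg, mul_smul]

end Coefficients

/-! ### The lattice attached to the filtration, and its fibre at `a = 0`. -/

section Lattice
variable {l m : ℕ}

theorem cf_actFst_add_actSnd (n : ℕ) (x : sl2) (z : A ⊗[ℂ] (Vrep l ⊗[ℂ] Vrep m)) :
    cf n (actFst A sl2 (Vrep l) (Vrep m) x z + actSnd A sl2 (Vrep l) (Vrep m) x z) = ⁅x, cf n z⁆ := by
  induction z using TensorProduct.induction_on with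
  | zero => simp
  | add z w hz hw =>
    rw [map_add (cf n) z w, lie_add, ← hz, ← hw, ← map_add,
      map_add (actFst A sl2 (Vrep l) (Vrep m) x), map_add (actSnd A sl2 (Vrep l) (Vrep m) x)]
    congr 1; abel
  | tmul f v =>
    have h : ∀ v : Vrep l ⊗[ℂ] Vrep m, ((LieModule.toEnd ℂ sl2 (Vrep l) x).rTensor (Vrep m)) v +
        ((LieModule.toEnd ℂ sl2 (Vrep m) x).lTensor (Vrep l)) v = ⁅x, v⁆ := by
      intro v
      induction v using TensorProduct.induction_on with
      | zero => simp
      | add z w hz hw => rw [map_add, map_add, lie_add, ← hz, ← hw]; abel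
      | tmul v w => rw [TensorProduct.LieModule.lie_tmul_right]; rfl
    change cf n (f ⊗ₜ[ℂ] _ + f ⊗ₜ[ℂ] _) = _
    rw [← TensorProduct.tmul_add, cf_tmul, cf_tmul, lie_smul, h]

theorem cf_actSnd (n : ℕ) (x : sl2) (z : A ⊗[ℂ] (Vrep l ⊗[ℂ] Vrep m)) :
    cf n (actSnd A sl2 (Vrep l) (Vrep m) x z) = sndAct l m x (cf n z) := by
  induction z using TensorProduct.induction_on with
  | zero => simp
  | add z w hz hw => rw [map_add, map_add, map_add, map_add, hz, hw]
  | tmul f v =>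
    change cf n (f ⊗ₜ[ℂ] sndAct l m x v) = _
    rw [cf_tmul, cf_tmul, map_smul]

variable (l m) in
/-- The representation of `A[t] ⊗ sl(2) ⊕ A C₂` on `A ⊗ V^l ⊗ V^m`. -/
abbrev rep₂ : HatPlus sl2 A →ₗ⁅A⁆ Module.End A (A ⊗[ℂ] (Vrep l ⊗[ℂ] Vrep m)) :=
  twoPointRep (0 : A) a (actFst A sl2 (Vrep l) (Vrep m)) (actSnd A sl2 (Vrep l) (Vrep m))
    (actFst_actSnd A sl2 (Vrep l) (Vrep m))

/-- Writing `P(a) = P(0) + a · P.divX(a)` separates the diagonal action from a multiple of `a (id ⊗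
x)`, the two operations that respect the lattice. -/
theorem rep₂_loop (P : A[X]) (x : sl2) (z : A ⊗[ℂ] (Vrep l ⊗[ℂ] Vrep m)) :
    rep₂ l m (Affine.loop (zeroCocycle A) P x) z = P.coeff 0 •
      (actFst A sl2 (Vrep l) (Vrep m) x z + actSnd A sl2 (Vrep l) (Vrep m) x z) +
      P.divX.eval a • a • actSnd A sl2 (Vrep l) (Vrep m) x z := by
  have h1 : rep₂ l m (Affine.loop (zeroCocycle A) P x) z =
      Polynomial.aeval (0 : A) P • actFst A sl2 (Vrep l) (Vrep m) x z +
        Polynomial.aeval a P • actSnd A sl2 (Vrep l) (Vrep m) x z +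
      (0 : A) • ((-1 / 2 : ℂ) • z) := rfl
  have h2 : Polynomial.aeval a P = P.divX.eval a * a + P.coeff 0 := by
    conv_lhs => rw [← P.divX_mul_X_add]
    rw [Polynomial.coe_aeval_eq_eval, Polynomial.eval_add, Polynomial.eval_mul_X, Polynomial.eval_C]
  rw [h1, h2, ← Polynomial.coeff_zero_eq_aeval_zero, zero_smul, add_zero, add_smul, mul_smul, smul_add]
  abel

theorem rep₂_central (c : A) (z : A ⊗[ℂ] (Vrep l ⊗[ℂ] Vrep m)) :
    rep₂ l m (c • Affine.central (zeroCocycle A)) z = c • ((-1 / 2 : ℂ) • z) := by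
  rw [map_smul, LinearMap.smul_apply]
  congr 1
  have h1 : rep₂ l m (Affine.central (zeroCocycle A)) z =
      evalMap (Polynomial.aeval (0 : A)) (actFst A sl2 (Vrep l) (Vrep m) : sl2 →ₗ[ℂ] _)
          (0 : A[X] ⊗[ℂ] sl2) z +
        evalMap (Polynomial.aeval a) (actSnd A sl2 (Vrep l) (Vrep m) : sl2 →ₗ[ℂ] _)
          (0 : A[X] ⊗[ℂ] sl2) z +
      (1 : A) • ((-1 / 2 : ℂ) • z) := rfl
  rw [h1, map_zero, map_zero, LinearMap.zero_apply, one_smul, add_zero, zero_add]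

variable (l m) in
/-- The lattice of the elements of `A ⊗ V^l ⊗ V^m` with coefficient of `aⁿ` in `Fⁿ`. -/
def lattice : Submodule A (A ⊗[ℂ] (Vrep l ⊗[ℂ] Vrep m)) where
  carrier := {z | ∀ n, cf n z ∈ tensorFil l m n}
  add_mem' hz hw n := by rw [map_add]; exact add_mem (hz n) (hw n)
  zero_mem' n := by rw [map_zero]; exact zero_mem _
  smul_mem' f z hz n := by
    rw [cf_smul]
    refine sum_mem fun ij hij => (tensorFil l m n).smul_mem _ (tensorFil_mono ?_ (hz ij.2))
    have := Finset.HasAntidiagonal.mem_antidiagonal.mp hij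
    omega

theorem actTotal_mem_lattice {z : A ⊗[ℂ] (Vrep l ⊗[ℂ] Vrep m)} (hz : z ∈ lattice l m) (x : sl2) :
    actFst A sl2 (Vrep l) (Vrep m) x z + actSnd A sl2 (Vrep l) (Vrep m) x z ∈ lattice l m := fun n => by
  rw [cf_actFst_add_actSnd]; exact (tensorFil l m n).lie_mem (hz n)

theorem a_smul_actSnd_mem_lattice {z : A ⊗[ℂ] (Vrep l ⊗[ℂ] Vrep m)} (hz : z ∈ lattice l m) (x : sl2) :
    a • actSnd A sl2 (Vrep l) (Vrep m) x z ∈ lattice l m := fun n => by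
  have h := cf_a_pow_smul 1 n (actSnd A sl2 (Vrep l) (Vrep m) x z)
  rw [pow_one] at h
  rw [h]
  split_ifs with hn
  · rw [cf_actSnd]
    have := sndAct_mem_tensorFil (hz (n - 1)) x
    rwa [Nat.sub_add_cancel hn] at this
  · exact zero_mem _

theorem complex_smul_mem_lattice {z : A ⊗[ℂ] (Vrep l ⊗[ℂ] Vrep m)} (hz : z ∈ lattice l m) (c : ℂ) :
    c • z ∈ lattice l m := fun n => by
  rw [map_smul]; exact (tensorFil l m n).smul_mem c (hz n)

/-- The diagonal action preserves every `Fⁿ`, while `a (id ⊗ x)` raises the power of `a` and the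
filtration index together. -/
theorem rep₂_mem_lattice (y : HatPlus sl2 A) {z : A ⊗[ℂ] (Vrep l ⊗[ℂ] Vrep m)} (hz : z ∈ lattice l m) :
    rep₂ l m y z ∈ lattice l m := by
  refine affine_induction _ (P := fun y : HatPlus sl2 A => rep₂ l m y z ∈ lattice l m)
    (fun X Y hX hY => ?_) (fun P x => ?_) (fun c => ?_) y
  · rw [map_add, LinearMap.add_apply]; exact add_mem hX hY
  · rw [rep₂_loop]
    exact add_mem ((lattice l m).smul_mem _ (actTotal_mem_lattice hz x))
      ((lattice l m).smul_mem _ (a_smul_actSnd_mem_lattice hz x))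
  · rw [rep₂_central]
    exact (lattice l m).smul_mem _ (complex_smul_mem_lattice hz _)

namespace TensorDecomp
variable {u : ℕ → Vrep l ⊗[ℂ] Vrep m} (D : TensorDecomp l m u)

/-- The map `∑ aⁿ v_n ↦ ∑ p_n v_n`. -/
def sym : A ⊗[ℂ] (Vrep l ⊗[ℂ] Vrep m) →ₗ[ℂ] Vrep l ⊗[ℂ] Vrep m :=
  ∑ k ∈ Finset.range (m + 1), D.p k ∘ₗ cf k

theorem sym_apply (z : A ⊗[ℂ] (Vrep l ⊗[ℂ] Vrep m)) :
    D.sym z = ∑ k ∈ Finset.range (m + 1), D.p k (cf k z) := by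
  rw [sym, LinearMap.sum_apply]; rfl

theorem p_sym (k : ℕ) (z : A ⊗[ℂ] (Vrep l ⊗[ℂ] Vrep m)) : D.p k (D.sym z) = D.p k (cf k z) := by
  by_cases hk : k ≤ m
  · rw [sym_apply, map_sum, Finset.sum_eq_single_of_mem k (Finset.mem_range.mpr (by omega)), p_p_self]
    intro j _ hj
    exact D.p_p_ne hj.symm _
  · rw [D.p_of_lt (by omega)]; rfl

/-- In the coefficient of `a^k` of `f z`, a positive power from `f` multiplies some `z_j ∈ F^j` with
`j < k`, which `p k` annihilates. -/
theorem sym_smul {z : A ⊗[ℂ] (Vrep l ⊗[ℂ] Vrep m)} (hz : z ∈ lattice l m) (f : A) :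
    D.sym (f • z) = PowerSeries.constantCoeff f • D.sym z := by
  rw [sym_apply, sym_apply, Finset.smul_sum]
  refine Finset.sum_congr rfl fun k _ => ?_
  rw [cf_smul, map_sum, Finset.sum_eq_single_of_mem (0, k) (by simp)]
  · rw [map_smul, PowerSeries.coeff_zero_eq_constantCoeff_apply]
  · rintro ⟨i, j⟩ hij hne
    have h := Finset.HasAntidiagonal.mem_antidiagonal.mp hij
    simp only at h
    have hj : j < k := by
      rcases Nat.eq_zero_or_pos i with rfl | hi
      · exact absurd (by simp at h; rw [h]) hne
      · omega
    rw [map_smul, D.p_eq_zero_of_mem (hz j) hj, smul_zero]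

theorem sym_actTotal (x : sl2) (z : A ⊗[ℂ] (Vrep l ⊗[ℂ] Vrep m)) :
    D.sym (actFst A sl2 (Vrep l) (Vrep m) x z + actSnd A sl2 (Vrep l) (Vrep m) x z) = ⁅x, D.sym z⁆ := by
  rw [sym_apply, sym_apply, lie_sum]
  exact Finset.sum_congr rfl fun k _ => by rw [cf_actFst_add_actSnd, lie_p]

theorem sym_a_smul_actSnd {z : A ⊗[ℂ] (Vrep l ⊗[ℂ] Vrep m)} (hz : z ∈ lattice l m) (x : sl2) :
    D.sym (a • actSnd A sl2 (Vrep l) (Vrep m) x z) = D.θ x (D.sym z) := by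
  rw [sym_apply, θ_apply, Finset.sum_range_succ', Finset.sum_range_succ _ m,
    D.p_of_lt (Nat.lt_succ_self m)]
  have h := fun n => cf_a_pow_smul 1 n (actSnd A sl2 (Vrep l) (Vrep m) x z)
  simp only [pow_one] at h
  rw [h 0, if_neg (by omega), map_zero, LinearMap.zero_apply]
  congr 1
  refine Finset.sum_congr rfl fun k _ => ?_
  rw [h, if_pos (by omega), Nat.add_sub_cancel, cf_actSnd, D.p_sndAct (hz k) (Nat.lt_succ_self k),
    if_pos rfl, p_sym]

/-- On the fibre only the coefficients of `1` and `t` in `P` survive, and `t x` acts by `θ x`: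
multiplication by `a` shifts coefficients by one, as `θ` shifts components. -/
theorem sym_rep₂_loop {z : A ⊗[ℂ] (Vrep l ⊗[ℂ] Vrep m)} (hz : z ∈ lattice l m) (P : A[X]) (x : sl2) :
    D.sym (rep₂ l m (Affine.loop (zeroCocycle A) P x) z) =
      (spPoly P).coeff 0 • ⁅x, D.sym z⁆ + (spPoly P).coeff 1 • D.θ x (D.sym z) := by
  have h1 : PowerSeries.constantCoeff (P.divX.eval a) = (spPoly P).coeff 1 := by
    rw [← Polynomial.coe_evalRingHom, ← RingHom.comp_apply]
    have : (PowerSeries.constantCoeff (R := ℂ)).comp (Polynomial.evalRingHom a) =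
        (Polynomial.constantCoeff).comp spPoly := by
      refine Polynomial.ringHom_ext (fun c => ?_) ?_
      · simp [spPoly]
      · simp [spPoly, a]
    rw [this]
    simp [spPoly, Polynomial.coeff_divX]
  rw [rep₂_loop, map_add, D.sym_smul (actTotal_mem_lattice hz x), sym_actTotal,
    D.sym_smul (a_smul_actSnd_mem_lattice hz x), D.sym_a_smul_actSnd hz, h1]
  simp [spPoly]

theorem mem_prevFil_of_p_eq_zero {n : ℕ} {v : Vrep l ⊗[ℂ] Vrep m} (hv : v ∈ tensorFil l m n)
    (h : D.p n v = 0) : ∀ k, n ≤ k → D.p k v = 0 := by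
  intro k hk
  rcases hk.eq_or_lt with rfl | hk
  · exact h
  · exact D.p_eq_zero_of_mem hv hk

theorem mem_tensorFil_of_p {n : ℕ} {v : Vrep l ⊗[ℂ] Vrep m} (h : ∀ k, n < k → D.p k v = 0) :
    v ∈ tensorFil l m n := by
  rw [← D.sum_p (Nat.lt_succ_self m) v]
  refine sum_mem fun k _ => ?_
  by_cases hk : n < k
  · rw [h k hk]; exact zero_mem _
  · exact tensorFil_mono (by omega : k ≤ n) (D.p_mem k v)

/-- If every `z_n ∈ Fⁿ` has vanishing `n`-th component, then `z_0 = 0` and `z_{n+1} ∈ Fⁿ`, which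
says that `z / a` is again in the lattice. -/
theorem sym_eq_zero_iff {z : A ⊗[ℂ] (Vrep l ⊗[ℂ] Vrep m)} (hz : z ∈ lattice l m) :
    D.sym z = 0 ↔ ∃ w ∈ lattice l m, z = a • w := by
  constructor
  · intro h
    have h1 : ∀ n, D.p n (cf n z) = 0 := fun n => by rw [← p_sym, h, map_zero]
    have h2 := fun n => D.mem_prevFil_of_p_eq_zero (hz n) (h1 n)
    have h3 : cf 0 z = 0 := by
      rw [← D.sum_p (Nat.lt_succ_self m) (cf 0 z)]
      exact Finset.sum_eq_zero fun k _ => h2 0 k (Nat.zero_le k)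
    obtain ⟨w, rfl⟩ := exists_eq_a_pow_smul ((wBasis l).tensorProduct (wBasis m)) (i := 1) (z := z)
      fun n hn => by rwa [Nat.lt_one_iff.mp hn]
    refine ⟨w, fun n => D.mem_tensorFil_of_p fun k hk => ?_, by rw [pow_one]⟩
    have := h2 (n + 1) k hk
    rwa [cf_a_pow_smul, if_pos (by omega), Nat.add_sub_cancel] at this
  · rintro ⟨w, hw, rfl⟩
    rw [D.sym_smul hw, a, PowerSeries.constantCoeff_X, zero_smul]

theorem sym_mem_ge {i : ℕ} (w : A ⊗[ℂ] (Vrep l ⊗[ℂ] Vrep m)) : D.sym (a ^ i • w) ∈ D.ge i := by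
  rw [mem_ge]
  intro k hk
  rw [p_sym, cf_a_pow_smul, if_neg (by omega), map_zero]

/-- The witness is `∑ a^j p_j v` over `i ≤ j ≤ m`: divisible by `aⁱ` because the lower components of
`v` vanish. -/
theorem exists_lift {i : ℕ} {v : Vrep l ⊗[ℂ] Vrep m} (hv : v ∈ D.ge i) :
    ∃ z ∈ lattice l m, D.sym z = v ∧ ∃ w, z = a ^ i • w := by
  have hcf : ∀ n, cf n (∑ j ∈ Finset.Icc i m, (a ^ j : A) ⊗ₜ[ℂ] D.p j v) = D.p n v := by
    intro n
    simp only [map_sum, cf_a_pow_tmul]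
    rw [Finset.sum_ite_eq (Finset.Icc i m) n fun j => D.p j v]
    split_ifs with h
    · rfl
    · by_cases hn : n < i
      · rw [D.mem_ge.mp hv n hn]
      · rw [D.p_of_lt (by rw [Finset.mem_Icc] at h; omega)]; rfl
  refine ⟨∑ j ∈ Finset.Icc i m, (a ^ j : A) ⊗ₜ[ℂ] D.p j v, fun n => ?_, ?_, ?_⟩
  · rw [hcf]; exact D.p_mem n v
  · rw [sym_apply]
    simp only [hcf, p_p_self]
    exact D.sum_p (Nat.lt_succ_self m) v
  · refine exists_eq_a_pow_smul ((wBasis l).tensorProduct (wBasis m)) fun n hn => ?_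
    rw [hcf, D.mem_ge.mp hv n hn]

theorem a_pow_tmul_mem_lattice {j : ℕ} {v : Vrep l ⊗[ℂ] Vrep m} (hv : v ∈ tensorFil l m j) :
    (a ^ j : A) ⊗ₜ[ℂ] v ∈ lattice l m := fun n => by
  rw [cf_a_pow_tmul]
  split_ifs with h
  · subst h; exact hv
  · exact zero_mem _

theorem sym_a_pow_tmul (j : ℕ) (v : Vrep l ⊗[ℂ] Vrep m) :
    D.sym ((a ^ j : A) ⊗ₜ[ℂ] v) = D.p j v := by
  rw [← D.sum_p (Nat.lt_succ_self m) (D.sym _)]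
  simp only [p_sym, cf_a_pow_tmul]
  by_cases hj : j ≤ m
  · rw [Finset.sum_eq_single_of_mem j (Finset.mem_range.mpr (by omega)), if_pos rfl]
    intro k _ hk
    rw [if_neg hk, map_zero]
  · rw [D.p_of_lt (by omega)]
    refine Finset.sum_eq_zero fun k hk => ?_
    rw [if_neg (by rw [Finset.mem_range] at hk; omega), map_zero]

end TensorDecomp
end Lattice
end
end TwoPoint

namespace TwoPoint
noncomputable section

attribute [local instance 100] LieRing.ofAssociativeRing

theorem exists_mapRange_subtype {S R M : Type} [Ring R] [AddCommGroup M] [Module R M]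
    {N : Submodule R M} {z : S →₀ M} (hz : ∀ s, z s ∈ N) :
    ∃ w : S →₀ N, w.mapRange N.subtype (map_zero _) = z :=
  ⟨⟨z.support, fun s => ⟨z s, hz s⟩, fun s => by simp [Subtype.ext_iff]⟩, by ext s; rfl⟩

theorem mapRange_subtype_apply_mem {S R M : Type} [Ring R] [AddCommGroup M] [Module R M]
    {N : Submodule R M} (w : S →₀ N) (s : S) :
    w.mapRange N.subtype (map_zero _) s ∈ N := by
  rw [Finsupp.mapRange_apply]; exact (w s).2

/-! ### Submodules of an induced module generated by a stable submodule. -/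

section SubInduction
variable {k L L' M I : Type} [CommRing k] [LieRing L] [LieAlgebra k L] [LieRing L'] [LieAlgebra k L']
  [AddCommGroup M] [Module k M] [LinearOrder I] (dec : L ≃ₗ[k] L' × (I →₀ k))
  (j : L' →ₗ⁅k⁆ L) (ρ : L' →ₗ⁅k⁆ Module.End k M) (N : Submodule k M) (hN : ∀ y, ∀ v ∈ N, ρ y v ∈ N)

/-- The restriction of a representation to a stable submodule. -/
def restrictRep : L' →ₗ⁅k⁆ Module.End k N where
  toFun y := (ρ y).restrict (hN y)
  map_add' y y' := LinearMap.ext fun z => Subtype.ext (LinearMap.congr_fun (map_add ρ y y') z.1)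
  map_smul' c y := LinearMap.ext fun z => Subtype.ext (LinearMap.congr_fun (map_smul ρ c y) z.1)
  map_lie' {y y'} := LinearMap.ext fun z => Subtype.ext (LinearMap.congr_fun (ρ.map_lie y y') z.1)

theorem exists_subIncl : ∃ Φ : Ind j (restrictRep ρ N hN) →ₗ[UniversalEnvelopingAlgebra k L] Ind j ρ,
    ∀ v, Φ (indIncl _ _ v) = indIncl _ _ v.1 :=
  exists_indLift (RingHom.id _) _ _ ((indIncl j ρ).toAddMonoidHom.comp N.subtype.toAddMonoidHom)
    (fun c v => by
      change indIncl j ρ (c • v.1) = algebraMap k (UniversalEnvelopingAlgebra k L) c • indIncl j ρ v.1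
      rw [map_smul, algebraMap_smul])
    (fun y v => (ι_smul_indMk j ρ y v.1).symm)

/-- The submodule of the induced module generated by a submodule of the inducing module. -/
def subSpan : Submodule (UniversalEnvelopingAlgebra k L) (Ind j ρ) :=
  Submodule.span _ (indIncl j ρ '' (N : Set M))

variable {N}

theorem indIncl_mem_subSpan {v : M} (hv : v ∈ N) : indIncl j ρ v ∈ subSpan j ρ N :=
  Submodule.subset_span ⟨v, hv, rfl⟩

theorem pbwMap_mem_subSpan {z : Multiset I →₀ M} (hz : ∀ s, z s ∈ N) :
    pbwMap dec (indIncl j ρ) z ∈ subSpan j ρ N :=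
  pbwMap_mem dec fun s => indIncl_mem_subSpan j ρ (hz s)

theorem range_subIncl {Φ : Ind j (restrictRep ρ N hN) →ₗ[UniversalEnvelopingAlgebra k L] Ind j ρ}
    (hΦ : ∀ v, Φ (indIncl _ _ v) = indIncl _ _ v.1) : LinearMap.range Φ = subSpan j ρ N := by
  apply le_antisymm
  · rintro _ ⟨z, rfl⟩
    induction z using ind_induction with
    | hmk v =>
      have := hΦ v
      rw [show Φ (indMk _ _ v) = indIncl _ _ v.1 from this]
      exact indIncl_mem_subSpan j ρ v.2
    | hadd z w hz hw => rw [map_add]; exact add_mem hz hw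
    | hsmul u z hz => rw [map_smul]; exact (subSpan j ρ N).smul_mem u hz
  · rw [subSpan, Submodule.span_le]
    rintro _ ⟨v, hv, rfl⟩
    exact ⟨indIncl _ _ ⟨v, hv⟩, hΦ ⟨v, hv⟩⟩

variable (hj : ∀ y, dec (j y) = (y, 0))
include hN hj

/-- PBW holds for the module induced from `N` as well, and in PBW coordinates the map induced by `N
⊆ M` is the inclusion in each coordinate. -/
theorem pbwMap_mem_subSpan_iff {z : Multiset I →₀ M} :
    pbwMap dec (indIncl j ρ) z ∈ subSpan j ρ N ↔ ∀ s, z s ∈ N := by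
  refine ⟨fun h => ?_, pbwMap_mem_subSpan dec j ρ⟩
  obtain ⟨Φ, hΦ⟩ := exists_subIncl j ρ N hN
  rw [← range_subIncl j ρ hN hΦ] at h
  obtain ⟨x, hx⟩ := h
  obtain ⟨w, rfl⟩ := (pbwMap_bijective dec (restrictRep ρ N hN) j hj).2 x
  rw [map_pbwMap dec _ (indIncl j ρ) N.subtype Φ hΦ] at hx
  rw [← (pbwMap_bijective dec ρ j hj).1 hx]
  exact mapRange_subtype_apply_mem w

/-- Semilinear maps on the submodule generated by `N ⊂ M` are determined by suitable maps on `N`. -/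
theorem exists_subLift {R' Z : Type} [Ring R'] [AddCommGroup Z] [Module R' Z]
    (σ : UniversalEnvelopingAlgebra k L →+* R') (φ : M →+ Z)
    (hc : ∀ (c : k), ∀ v ∈ N, φ (c • v) = σ (algebraMap k _ c) • φ v)
    (hy : ∀ y, ∀ v ∈ N, φ (ρ y v) = σ (UniversalEnvelopingAlgebra.ι k (j y)) • φ v) :
    ∃ Θ : subSpan j ρ N →ₛₗ[σ] Z, ∀ (z : Multiset I →₀ M) (hz : ∀ s, z s ∈ N),
      Θ ⟨pbwMap dec (indIncl j ρ) z, pbwMap_mem_subSpan dec j ρ hz⟩ =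
        z.sum fun s v => σ (pbwMonomial dec s) • φ v := by
  obtain ⟨Φ, hΦ⟩ := exists_subIncl j ρ N hN
  obtain ⟨Ψ, hΨ⟩ := exists_indLift σ j (restrictRep ρ N hN) (φ.comp N.subtype.toAddMonoidHom)
    (fun c v => hc c v.1 v.2) (fun y v => hy y v.1 v.2)
  have hpbw : ∀ w, Φ (pbwMap dec (indIncl _ _) w) =
      pbwMap dec (indIncl j ρ) (w.mapRange N.subtype (map_zero _)) :=
    map_pbwMap dec _ (indIncl j ρ) N.subtype Φ hΦ
  -- Thanks to PBW on both sides, induction preserves this injection.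
  have hinj : Function.Injective Φ := by
    intro x y hxy
    obtain ⟨w, rfl⟩ := (pbwMap_bijective dec (restrictRep ρ N hN) j hj).2 x
    obtain ⟨w', rfl⟩ := (pbwMap_bijective dec (restrictRep ρ N hN) j hj).2 y
    rw [hpbw, hpbw] at hxy
    have := (pbwMap_bijective dec ρ j hj).1 hxy
    rw [Finsupp.mapRange_injective _ _ N.subtype_injective this]
  let e : Ind j (restrictRep ρ N hN) ≃ₗ[UniversalEnvelopingAlgebra k L] subSpan j ρ N :=
    (LinearEquiv.ofInjective Φ hinj).trans (LinearEquiv.ofEq _ _ (range_subIncl j ρ hN hΦ))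
  refine ⟨Ψ.comp e.symm.toLinearMap, fun z hz => ?_⟩
  obtain ⟨w, rfl⟩ := exists_mapRange_subtype hz
  have he : e (pbwMap dec (indIncl _ _) w) = ⟨pbwMap dec (indIncl j ρ)
      (w.mapRange N.subtype (map_zero _)), pbwMap_mem_subSpan dec j ρ hz⟩ := Subtype.ext (hpbw w)
  rw [← he, LinearMap.comp_apply, LinearEquiv.coe_coe, LinearEquiv.symm_apply_apply, pbwMap_apply,
    Finsupp.sum_mapRange_index (by simp), Finsupp.sum, Finsupp.sum, map_sum]
  refine Finset.sum_congr rfl fun s _ => ?_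
  rw [LinearMap.map_smulₛₗ]
  exact congrArg _ (hΨ (w s))

end SubInduction

end
end TwoPoint

namespace TwoPoint
noncomputable section

attribute [local instance 100] LieRing.ofAssociativeRing

/-! ### Reduction from the completed to the ordinary enveloping algebra. -/

section CompletedAction
variable {k : Type} [CommRing k] [Algebra ℂ k] {g : Type} [LieRing g] [LieAlgebra ℂ g]
  {q : k[X]} {hq : q.Monic} {N N' : Type} [AddCommGroup N] [Module (U g q hq) N]
  [AddCommGroup N'] [Module (U g q hq) N']

/-- On one vector a completed element acts by a representative of one of its truncations, or by
zero. So submodules are automatically stable under the completion, and the two notions of generation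
coincide. -/
theorem exists_act_eq_smul (x : UHat g q hq) (v : N) : ∃ w : U g q hq, x.act v = w • v := by
  unfold UHat.act
  split_ifs with h
  · obtain ⟨w, hw⟩ := Submodule.Quotient.mk_surjective _ (x.1 h.choose)
    exact ⟨w, by rw [← hw]; rfl⟩
  · exact ⟨0, (zero_smul _ _).symm⟩

theorem hatSpan_eq_span (S : Set N) : (hatSpan S : Submodule (U g q hq) N) = Submodule.span _ S := by
  apply le_antisymm
  · refine sInf_le ⟨Submodule.subset_span, fun x v hv => ?_⟩
    obtain ⟨w, hw⟩ := exists_act_eq_smul x v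
    rw [hw]; exact Submodule.smul_mem _ w hv
  · rw [Submodule.span_le]
    intro v hv
    simp only [hatSpan, SetLike.mem_coe, Submodule.mem_sInf]
    exact fun P hP => hP.1 hv

theorem map_act (e : N ≃ₗ[U g q hq] N') (x : UHat g q hq) (v : N) : e (x.act v) = x.act (e v) := by
  have hker : LinearMap.ker (LinearMap.toSpanSingleton (U g q hq) N' (e v)) =
      LinearMap.ker (LinearMap.toSpanSingleton (U g q hq) N v) := by
    ext w
    rw [LinearMap.mem_ker, LinearMap.mem_ker, LinearMap.toSpanSingleton_apply,
      LinearMap.toSpanSingleton_apply, ← map_smul, LinearEquiv.map_eq_zero_iff]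
  unfold UHat.act
  by_cases h : ∃ n, critIdeal g q hq n ≤ LinearMap.ker (LinearMap.toSpanSingleton (U g q hq) N v)
  · have h' : ∃ n, critIdeal g q hq n ≤ LinearMap.ker (LinearMap.toSpanSingleton (U g q hq) N' (e v)) := by
      rwa [hker]
    rw [dif_pos h, dif_pos h']
    -- The truncation level chosen in the action depends only on the annihilator of the vector,
    -- which the isomorphism preserves.
    have hc : h'.choose = h.choose := by
      congr 1; ext n; rw [hker]
    have hgen : ∀ n n' (hn : critIdeal g q hq n ≤ LinearMap.ker (LinearMap.toSpanSingleton (U g q hq) N v))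
        (hn' : critIdeal g q hq n' ≤ LinearMap.ker (LinearMap.toSpanSingleton (U g q hq) N' (e v))),
        n' = n → e ((critIdeal g q hq n).liftQ _ hn (x.1 n)) = (critIdeal g q hq n').liftQ _ hn' (x.1 n') := by
      rintro n n' hn hn' rfl
      obtain ⟨w, hw⟩ := Submodule.Quotient.mk_surjective _ (x.1 n')
      rw [← hw]
      exact e.map_smul w v
    exact hgen _ _ h.choose_spec h'.choose_spec hc
  · have h' : ¬ ∃ n, critIdeal g q hq n ≤ LinearMap.ker (LinearMap.toSpanSingleton (U g q hq) N' (e v)) := by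
      rwa [hker]
    rw [dif_neg h, dif_neg h', map_zero]

end CompletedAction

theorem exists_mapRange {S M V : Type} [AddCommGroup M] [AddCommGroup V] (f : M →+ V) {P : M → Prop}
    (h0 : P 0) {ζ : S →₀ V} (h : ∀ s, ∃ v, P v ∧ f v = ζ s) :
    ∃ z : S →₀ M, (∀ s, P (z s)) ∧ z.mapRange f (map_zero f) = ζ := by
  classical
  choose g hg hfg using h
  -- A zero coordinate is lifted by zero, to keep the support finite.
  refine ⟨Finsupp.onFinset ζ.support (fun s => if ζ s = 0 then 0 else g s) fun s hs => ?_,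
    fun s => ?_, ?_⟩
  · rw [Finsupp.mem_support_iff]
    intro h; exact hs (if_pos h)
  · rw [Finsupp.onFinset_apply]
    split_ifs
    · exact h0
    · exact hg s
  · ext s
    rw [Finsupp.mapRange_apply, Finsupp.onFinset_apply]
    split_ifs with hs
    · rw [map_zero, hs]
    · exact hfg s

/-! ### `Ṽ` is induced from the lattice. -/

section LevelTwo
variable (l m : ℕ)

/-- The decomposition of `ĝ₂` used for ordered monomials. -/
def dec₂ : g₂ ≃ₗ[A] HatPlus sl2 A × (ℕ →₀ A) := hatDec sl2Basis (Nat.divModEquiv 3) polarBasis₂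

theorem spLie_loop (f : Punctured ts) (x : sl2) : spLie (Affine.loop (resCocycle ts ts_monic) f x) =
    Affine.loop (resCocycle _ Polynomial.monic_X) (spK f) x :=
  Prod.ext rfl (map_zero _)

theorem spU_pbwMonomial (s : Multiset ℕ) : spU (pbwMonomial dec₂ s) = pbwMonomial dec₁ s := by
  rw [pbwMonomial, pbwMonomial, map_list_prod, List.map_map]
  congr 1
  refine List.map_congr_left fun i _ => ?_
  rw [Function.comp_apply, spU_ι, dec₁, dec₂, bvec_hatDec, bvec_hatDec, spLie_loop, spK_τ₂]

/-- The inclusion of `A ⊗ V^l ⊗ V^m` in `𝕍₂`. -/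
def wIncl₂ : A ⊗[ℂ] (Vrep l ⊗[ℂ] Vrep m) →ₗ[A] Weyl₂ l m := indIncl _ _

variable {l m}

theorem pbw₂_bijective : Function.Bijective (pbwMap dec₂ (wIncl₂ l m)) :=
  pbwMap_bijective dec₂ _ _ (hatDec_plusIncl sl2Basis (Nat.divModEquiv 3) polarBasis₂)

theorem a_pow_smul_vec (i : ℕ) (v : Vrep l ⊗[ℂ] Vrep m) :
    a ^ i • vec l m v = wIncl₂ l m ((a ^ i : A) ⊗ₜ[ℂ] v) := by
  have h : (a ^ i : A) ⊗ₜ[ℂ] v = a ^ i • ((1 : A) ⊗ₜ[ℂ] v) := by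
    rw [TensorProduct.smul_tmul', smul_eq_mul, mul_one]
  rw [h, map_smul]; rfl

theorem ι_smul_wIncl₂ (y : HatPlus sl2 A) (z : A ⊗[ℂ] (Vrep l ⊗[ℂ] Vrep m)) :
    UniversalEnvelopingAlgebra.ι A (plusIncl sl2 ts ts_monic y) • wIncl₂ l m z =
      wIncl₂ l m (rep₂ l m y z) := ι_smul_indMk _ _ y z

theorem tWeyl_eq_span : tWeyl l m = Submodule.span U₂ {vec l m (hwVec l ⊗ₜ hwVec m)} :=
  hatSpan_eq_span _

theorem smul_mem_tWeyl (c : A) {w : Weyl₂ l m} (hw : w ∈ tWeyl l m) : c • w ∈ tWeyl l m := by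
  rw [← algebraMap_smul U₂]; exact (tWeyl l m).smul_mem _ hw

theorem wIncl₂_rep₂_mem {z : A ⊗[ℂ] (Vrep l ⊗[ℂ] Vrep m)} (hz : wIncl₂ l m z ∈ tWeyl l m)
    (y : HatPlus sl2 A) : wIncl₂ l m (rep₂ l m y z) ∈ tWeyl l m := by
  rw [← ι_smul_wIncl₂]; exact (tWeyl l m).smul_mem _ hz

theorem rep₂_loop_one (x : sl2) (f : A) (v : Vrep l ⊗[ℂ] Vrep m) :
    rep₂ l m (Affine.loop (zeroCocycle A) 1 x) (f ⊗ₜ[ℂ] v) = f ⊗ₜ[ℂ] ⁅x, v⁆ := by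
  rw [rep₂_loop, Polynomial.coeff_one_zero, one_smul, ← Polynomial.C_1, Polynomial.divX_C,
    Polynomial.eval_zero, zero_smul, add_zero]
  refine eq_of_sub_eq_zero (eq_zero_of_cf ((wBasis l).tensorProduct (wBasis m)) fun n => ?_)
  rw [map_sub, cf_actFst_add_actSnd, cf_tmul, cf_tmul, lie_smul, sub_self]

theorem rep₂_loop_X (x : sl2) (f : A) (v : Vrep l ⊗[ℂ] Vrep m) :
    rep₂ l m (Affine.loop (zeroCocycle A) Polynomial.X x) (f ⊗ₜ[ℂ] v) = (a * f) ⊗ₜ[ℂ] sndAct l m x v := by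
  have h : (Polynomial.X : A[X]).divX = 1 := by
    ext1 n
    rw [Polynomial.coeff_divX, Polynomial.coeff_X, Polynomial.coeff_one]
    simp
  rw [rep₂_loop, Polynomial.coeff_X_zero, zero_smul, zero_add, h, Polynomial.eval_one,
    one_smul]
  rfl

/-- The current `t f` acts on the inducing space as `a (id ⊗ f)`, and `f w_k = (m - k) w_{k+1}` with
nonzero scalar for `k < m`. -/
theorem a_pow_rootVec_mem_tWeyl (k : ℕ) :
    wIncl₂ l m ((a ^ k : A) ⊗ₜ[ℂ] rootVec l m k) ∈ tWeyl l m := by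
  induction k with
  | zero =>
    rw [tWeyl_eq_span, rootVec, wvec_zero, ← a_pow_smul_vec, pow_zero, one_smul]
    exact Submodule.mem_span_singleton_self _
  | succ k ih =>
    rcases Nat.lt_or_ge k m with h | h
    · have h1 := wIncl₂_rep₂_mem ih (Affine.loop (zeroCocycle A) Polynomial.X sl2f)
      rw [rep₂_loop_X, ← pow_succ', rootVec, sndAct_tmul, f_wvec h.le] at h1
      have h2 : (m : ℂ) - k ≠ 0 := by
        rw [sub_ne_zero]; exact_mod_cast (by omega : m ≠ k)
      have h3 := smul_mem_tWeyl (algebraMap ℂ A ((m : ℂ) - k)⁻¹) h1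
      rw [← map_smul, algebraMap_smul, TensorProduct.tmul_smul, TensorProduct.tmul_smul, smul_smul,
        inv_mul_cancel₀ h2, one_smul] at h3
      exact h3
    · rw [rootVec_of_lt (by omega), TensorProduct.tmul_zero, map_zero]; exact zero_mem _

/-- The `v` with `aⁱ v ∈ Ṽ` form an `sl(2)`-submodule, thanks to the constant currents, so only the
generators `v_l ⊗ w_k` with `k ≤ i` need checking. -/
theorem a_pow_tmul_mem_tWeyl {i : ℕ} {v : Vrep l ⊗[ℂ] Vrep m} (hv : v ∈ tensorFil l m i) :
    wIncl₂ l m ((a ^ i : A) ⊗ₜ[ℂ] v) ∈ tWeyl l m := by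
  let K : LieSubmodule ℂ sl2 (Vrep l ⊗[ℂ] Vrep m) :=
    { carrier := {v | wIncl₂ l m ((a ^ i : A) ⊗ₜ[ℂ] v) ∈ tWeyl l m}
      add_mem' := fun {v w} hv hw => by
        change wIncl₂ l m ((a ^ i : A) ⊗ₜ[ℂ] (v + w)) ∈ tWeyl l m
        rw [TensorProduct.tmul_add, map_add]; exact add_mem hv hw
      zero_mem' := by
        change wIncl₂ l m ((a ^ i : A) ⊗ₜ[ℂ] 0) ∈ tWeyl l m
        rw [TensorProduct.tmul_zero, map_zero]; exact zero_mem _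
      smul_mem' := fun c v hv => by
        change wIncl₂ l m ((a ^ i : A) ⊗ₜ[ℂ] (c • v)) ∈ tWeyl l m
        rw [TensorProduct.tmul_smul, ← algebraMap_smul A c, map_smul]; exact smul_mem_tWeyl _ hv
      lie_mem := fun {x v} hv => by
        change wIncl₂ l m ((a ^ i : A) ⊗ₜ[ℂ] ⁅x, v⁆) ∈ tWeyl l m
        rw [← rep₂_loop_one]; exact wIncl₂_rep₂_mem hv _ }
  refine tensorFil_le (N := K) (fun k hk => ?_) hv
  change wIncl₂ l m ((a ^ i : A) ⊗ₜ[ℂ] rootVec l m k) ∈ tWeyl l m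
  rw [← Nat.sub_add_cancel hk, pow_add, ← smul_eq_mul, ← TensorProduct.smul_tmul', map_smul]
  exact smul_mem_tWeyl _ (a_pow_rootVec_mem_tWeyl k)

theorem a_pow_top_mem_tWeyl (z : A ⊗[ℂ] (Vrep l ⊗[ℂ] Vrep m)) : wIncl₂ l m (a ^ m • z) ∈ tWeyl l m := by
  induction z using TensorProduct.induction_on with
  | zero => rw [smul_zero, map_zero]; exact zero_mem _
  | add z w hz hw => rw [smul_add, map_add]; exact add_mem hz hw
  | tmul f v =>
    have h : a ^ m • (f ⊗ₜ[ℂ] v) = f • ((a ^ m : A) ⊗ₜ[ℂ] v) := by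
      rw [TensorProduct.smul_tmul', TensorProduct.smul_tmul', smul_eq_mul, smul_eq_mul, mul_comm]
    rw [h, map_smul]
    exact smul_mem_tWeyl f (a_pow_tmul_mem_tWeyl (by rw [tensorFil_eq_top]; trivial))

/-- A series may have infinitely many terms, but its tail is divisible by `a^m`, and `a^m` times
everything lies in `Ṽ` because `F^m` is the whole tensor product. -/
theorem wIncl₂_mem_tWeyl {z : A ⊗[ℂ] (Vrep l ⊗[ℂ] Vrep m)} (hz : z ∈ lattice l m) :
    wIncl₂ l m z ∈ tWeyl l m := by
  obtain ⟨w, hw⟩ := exists_eq_a_pow_smul ((wBasis l).tensorProduct (wBasis m)) (i := m)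
    (z := z - ∑ j ∈ Finset.range m, (a ^ j : A) ⊗ₜ[ℂ] cf j z) fun n hn => by
      rw [map_sub, map_sum]
      simp only [cf_a_pow_tmul]
      rw [Finset.sum_ite_eq (Finset.range m) n fun j => cf j z, if_pos (Finset.mem_range.mpr hn),
        sub_self]
  rw [sub_eq_iff_eq_add] at hw
  rw [hw, map_add, map_sum]
  exact add_mem (a_pow_top_mem_tWeyl w) (sum_mem fun j _ => a_pow_tmul_mem_tWeyl (hz j))

variable (l m) in
/-- The submodule of `𝕍₂` generated by the lattice. -/
abbrev latticeSpan : Submodule U₂ (Weyl₂ l m) :=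
  subSpan (plusIncl sl2 ts ts_monic) (rep₂ l m) (lattice l m)

theorem tWeyl_eq_latticeSpan : tWeyl l m = latticeSpan l m := by
  apply le_antisymm
  · rw [tWeyl_eq_span, Submodule.span_le, Set.singleton_subset_iff]
    have h := a_pow_smul_vec 0 (hwVec l ⊗ₜ[ℂ] hwVec m)
    rw [pow_zero, one_smul] at h
    rw [h]
    refine indIncl_mem_subSpan _ _ fun n => ?_
    have h2 := cf_a_pow_tmul 0 n (hwVec l ⊗ₜ[ℂ] hwVec m)
    rw [pow_zero] at h2
    rw [h2]
    split_ifs with h3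
    · subst h3
      have := rootVec_mem (l := l) (m := m) 0
      rwa [rootVec, wvec_zero] at this
    · exact zero_mem _
  · refine Submodule.span_le.mpr ?_
    rintro _ ⟨z, hz, rfl⟩
    exact wIncl₂_mem_tWeyl hz

theorem pbw₂_mem_tWeyl_iff {z : Multiset ℕ →₀ A ⊗[ℂ] (Vrep l ⊗[ℂ] Vrep m)} :
    pbwMap dec₂ (wIncl₂ l m) z ∈ tWeyl l m ↔ ∀ s, z s ∈ lattice l m := by
  rw [tWeyl_eq_latticeSpan]
  exact pbwMap_mem_subSpan_iff dec₂ _ _ (fun y _ hz => rep₂_mem_lattice y hz)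
    (hatDec_plusIncl sl2Basis (Nat.divModEquiv 3) polarBasis₂)

theorem pbw₂_mem_a_pow_top_iff {i : ℕ} {z : Multiset ℕ →₀ A ⊗[ℂ] (Vrep l ⊗[ℂ] Vrep m)} :
    pbwMap dec₂ (wIncl₂ l m) z ∈ (a ^ i • ⊤ : Submodule U₂ (Weyl₂ l m)) ↔ ∀ s, ∃ w, z s = a ^ i • w := by
  constructor
  · intro h s
    obtain ⟨w, _, hw⟩ := (Submodule.mem_smul_pointwise_iff_exists _ _ _).mp h
    obtain ⟨z', rfl⟩ := pbw₂_bijective.2 w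
    rw [← map_smul] at hw
    rw [← pbw₂_bijective.1 hw]
    exact ⟨z' s, rfl⟩
  · intro h
    refine pbwMap_mem dec₂ fun s => ?_
    obtain ⟨w, hw⟩ := h s
    rw [hw, map_smul]
    exact Submodule.smul_mem_pointwise_smul _ _ _ trivial

end LevelTwo

end
end TwoPoint

namespace TwoPoint
noncomputable section

attribute [local instance 100] LieRing.ofAssociativeRing

/-! ### The specialisation map `Θ : Ṽ → 𝕎₁`. -/

section Specialise
variable {l m : ℕ} {u : ℕ → Vrep l ⊗[ℂ] Vrep m} (D : TensorDecomp l m u)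
  {ψ : Vrep l ⊗[ℂ] Vrep m →ₗ[ℂ] W₁ l m}

theorem spLie_plusIncl_central (c : A) :
    spLie (plusIncl sl2 ts ts_monic (c • Affine.central (zeroCocycle A))) =
      PowerSeries.constantCoeff c • Affine.central (resCocycle _ Polynomial.monic_X) := by
  refine Prod.ext ?_ ?_
  · change spLoop (loopMap sl2 _ (c • (0 : A[X] ⊗[ℂ] sl2))) =
      PowerSeries.constantCoeff c • (0 : Punctured (Polynomial.X : ℂ[X]) ⊗[ℂ] sl2)
    rw [smul_zero, smul_zero, map_zero, map_zero]
  · change PowerSeries.constantCoeff (c • (1 : A)) = PowerSeries.constantCoeff c • (1 : ℂ)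
    rw [smul_eq_mul, mul_one, smul_eq_mul, mul_one]

/-- This is the compatibility needed to extend `ψ ∘ sym` to the induced module: the fibre of the
lattice and the image of `ψ` carry the same action of polynomial currents. -/
theorem psi_sym_rep₂ (hψ : ∀ (P : ℂ[X]) (x : sl2) v, cur (algebraMap ℂ[X] _ P) x • ψ v =
      P.coeff 0 • ψ ⁅x, v⁆ + P.coeff 1 • ψ (D.θ x v)) (y : HatPlus sl2 A)
    {z : A ⊗[ℂ] (Vrep l ⊗[ℂ] Vrep m)} (hz : z ∈ lattice l m) :
    ψ (D.sym (rep₂ l m y z)) =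
      spU (UniversalEnvelopingAlgebra.ι A (plusIncl sl2 ts ts_monic y)) • ψ (D.sym z) := by
  refine affine_induction _ (P := fun y : HatPlus sl2 A => ψ (D.sym (rep₂ l m y z)) =
      spU (UniversalEnvelopingAlgebra.ι A (plusIncl sl2 ts ts_monic y)) • ψ (D.sym z))
    (fun X Y hX hY => ?_) (fun P x => ?_) (fun c => ?_) y
  · rw [map_add, LinearMap.add_apply, map_add, map_add, hX, hY, map_add, map_add, map_add, add_smul]
  · have h : plusIncl sl2 ts ts_monic (Affine.loop (zeroCocycle A) P x) =
        Affine.loop (resCocycle ts ts_monic) (algebraMap A[X] _ P) x := rfl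
    rw [D.sym_rep₂_loop hz, map_add, map_smul, map_smul, h, spU_ι, spLie_loop, spK_poly]
    exact (hψ _ _ _).symm
  · rw [rep₂_central, D.sym_smul (complex_smul_mem_lattice hz _), map_smul, map_smul, map_smul, spU_ι,
      spLie_plusIncl_central, map_smul, smul_assoc]
    exact congrArg _ (cent₁_smul _).symm

theorem exists_of_mem_atWeyl {w : Weyl₂ l m} (h : w ∈ atWeyl l m) :
    ∃ w' ∈ tWeyl l m, algebraMap A U₂ a • w' = w := by
  obtain ⟨w', hw', hw⟩ := (Submodule.mem_smul_pointwise_iff_exists _ _ _).mp h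
  exact ⟨w', hw', by rw [algebraMap_smul]; exact hw⟩

theorem map_a_smul_eq_zero {N Z : Type} [AddCommGroup N] [Module U₂ N] [AddCommGroup Z] [Module U₁ Z]
    (Θ : N →ₛₗ[spU] Z) (w : N) : Θ (algebraMap A U₂ a • w) = 0 := by
  rw [LinearMap.map_smulₛₗ, spU_algebraMap, a, PowerSeries.constantCoeff_X, map_zero, zero_smul]

/-- The specialisation map from `Ṽ` to `𝕎₁`. -/
theorem exists_specialisation (hψ : ∀ (P : ℂ[X]) (x : sl2) v, cur (algebraMap ℂ[X] _ P) x • ψ v =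
      P.coeff 0 • ψ ⁅x, v⁆ + P.coeff 1 • ψ (D.θ x v))
    (hψ' : ∀ j w, ψ (D.ι j w) - wIncl _ (D.ι j w) ∈ D.geSpan (j + 1)) :
    ∃ Θ : tWeyl l m →ₛₗ[spU] W₁ l m, (∀ w, Θ w = 0 ↔ w.1 ∈ atWeyl l m) ∧
      (∀ i w, w.1 ∈ fil l m i → Θ w ∈ D.geSpan i) ∧
      (∀ i, ∀ y ∈ D.geSpan i, ∃ w, w.1 ∈ fil l m i ∧ Θ w = y) ∧
      ∀ j, ∀ v ∈ tensorFil l m j, ∀ h : a ^ j • vec l m v ∈ tWeyl l m,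
        Θ ⟨a ^ j • vec l m v, h⟩ = ψ (D.p j v) := by
  have hlat : ∀ y, ∀ z ∈ lattice l m, rep₂ l m y z ∈ lattice l m := fun y _ hz => rep₂_mem_lattice y hz
  have hj := hatDec_plusIncl sl2Basis (Nat.divModEquiv 3) polarBasis₂
  obtain ⟨Θ₀, hΘ₀⟩ := exists_subLift dec₂ (plusIncl sl2 ts ts_monic) (rep₂ l m) hlat hj spU
    (ψ.comp D.sym).toAddMonoidHom
    (fun c z hz => by
      change ψ (D.sym (c • z)) = spU (algebraMap A U₂ c) • ψ (D.sym z)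
      rw [D.sym_smul hz, map_smul, spU_algebraMap, algebraMap_smul])
    (fun y z hz => psi_sym_rep₂ D hψ y hz)
  let e := LinearEquiv.ofEq _ _ (tWeyl_eq_latticeSpan (l := l) (m := m))
  -- Ordered monomials specialise to ordered monomials, so in PBW coordinates `Θ` applies `sym` to
  -- each coordinate and then uses `ψ`.
  have hΘ : ∀ (z : Multiset ℕ →₀ A ⊗[ℂ] (Vrep l ⊗[ℂ] Vrep m)) (hz : ∀ s, z s ∈ lattice l m)
      (h : pbwMap dec₂ (wIncl₂ l m) z ∈ tWeyl l m), Θ₀ (e ⟨_, h⟩) =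
        pbwMap dec₁ ψ (z.mapRange D.sym (map_zero _)) := by
    intro z hz h
    rw [pbwMap_apply dec₁ ψ, Finsupp.sum_mapRange_index (by simp)]
    refine (hΘ₀ z hz).trans ?_
    simp only [spU_pbwMonomial]
    rfl
  refine ⟨Θ₀.comp e.toLinearMap, ?_, ?_, ?_, ?_⟩
  · rintro ⟨w, hw⟩
    constructor
    · intro h
      obtain ⟨z, rfl⟩ := pbw₂_bijective.2 w
      have hz := pbw₂_mem_tWeyl_iff.mp hw
      have h2 : Θ₀ (e ⟨_, hw⟩) = 0 := h
      rw [hΘ z hz] at h2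
      -- Hence `sym` kills every coordinate, so each is `a` times a lattice element.
      have h3 := D.pbw_psi_injective hψ' (h2.trans (map_zero _).symm)
      refine pbwMap_mem dec₂ fun s => ?_
      have h4 := DFunLike.congr_fun h3 s
      rw [Finsupp.mapRange_apply] at h4
      obtain ⟨v, hv, hzv⟩ := (D.sym_eq_zero_iff (hz s)).mp h4
      rw [hzv, map_smul]
      exact Submodule.smul_mem_pointwise_smul _ _ _ (wIncl₂_mem_tWeyl hv)
    · intro h
      obtain ⟨w', hw', rfl⟩ := exists_of_mem_atWeyl h
      exact map_a_smul_eq_zero (Θ₀.comp e.toLinearMap) (⟨w', hw'⟩ : tWeyl l m)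
  · rintro i ⟨w, hw⟩ hwi
    obtain ⟨z, rfl⟩ := pbw₂_bijective.2 w
    have h2 := pbw₂_mem_a_pow_top_iff.mp hwi.2
    have h3 : Θ₀ (e ⟨_, hw⟩) ∈ D.geSpan i := by
      rw [hΘ z (pbw₂_mem_tWeyl_iff.mp hw), D.pbw_psi_mem_geSpan hψ']
      intro s
      obtain ⟨v, hv⟩ := h2 s
      rw [Finsupp.mapRange_apply, hv]
      exact D.sym_mem_ge v
    exact h3
  · intro i y hy
    obtain ⟨ζ, rfl⟩ := D.pbw_psi_surjective hψ' y
    rw [D.pbw_psi_mem_geSpan hψ'] at hy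
    -- Each coordinate lies in `ge i`, so it lifts to a lattice element divisible by `aⁱ`, which
    -- keeps the lift inside `𝓕_i`.
    obtain ⟨z, hz, hzζ⟩ := exists_mapRange D.sym.toAddMonoidHom
      (P := fun z => z ∈ lattice l m ∧ ∃ w, z = a ^ i • w) ⟨zero_mem _, 0, (smul_zero _).symm⟩
      (ζ := ζ) fun s => by
        obtain ⟨z, h1, h2, h3⟩ := D.exists_lift (hy s)
        exact ⟨z, ⟨h1, h3⟩, h2⟩
    have hw := pbw₂_mem_tWeyl_iff.mpr fun s => (hz s).1
    refine ⟨⟨_, hw⟩, ⟨hw, pbw₂_mem_a_pow_top_iff.mpr fun s => (hz s).2⟩, ?_⟩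
    refine (hΘ z (fun s => (hz s).1) hw).trans ?_
    exact congrArg _ hzζ
  · intro j v hv h
    have h1 : (⟨a ^ j • vec l m v, h⟩ : tWeyl l m) =
        ⟨pbwMap dec₂ (wIncl₂ l m) (Finsupp.single 0 ((a ^ j : A) ⊗ₜ[ℂ] v)), by
          rw [pbwMap_zero, ← a_pow_smul_vec]; exact h⟩ :=
      Subtype.ext ((a_pow_smul_vec j v).trans (pbwMap_zero dec₂ _ _).symm)
    rw [h1]
    refine (hΘ _ (fun s => ?_) _).trans ?_
    · classical
      rw [Finsupp.single_apply]
      split_ifs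
      · exact TensorDecomp.a_pow_tmul_mem_lattice hv
      · exact zero_mem _
    · rw [Finsupp.mapRange_single, pbwMap_zero, D.sym_a_pow_tmul]

end Specialise

end
end TwoPoint

/-! ### From semilinear maps to isomorphisms of quotients; the direct sum decomposition. -/

namespace TwoPoint
noncomputable section

attribute [local instance 100] LieRing.ofAssociativeRing

/-- A quotient of submodules with an `Sp`-semilinear isomorphism to a `U(ĝ₁)`-module. -/
theorem isoAndGenerated_of_semilinear {X W N : Type} [AddCommGroup X] [Module U₂ X] [AddCommGroup W]
    [Module U₁ W] [AddCommGroup N] [Module U₁ N] {P B : Submodule U₂ X} (Θ : P →ₛₗ[spU] W)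
    {Y : Submodule U₁ W} (hker : ∀ w, Θ w = 0 ↔ w.1 ∈ B) (hY : ∀ w, Θ w ∈ Y)
    (hsurj : ∀ y ∈ Y, ∃ w, Θ w = y) (eY : Y ≃ₗ[U₁] N) {S : Set (P ⧸ B.submoduleOf P)}
    (hS : ∀ T : Submodule U₁ W, (∀ w : P, Submodule.Quotient.mk w ∈ S → Θ w ∈ T) → Y ≤ T) :
    IsoAndGenerated (P ⧸ B.submoduleOf P) N S := by
  let f : (P ⧸ B.submoduleOf P) →ₛₗ[spU] Y := (B.submoduleOf P).liftQ (Θ.codRestrict Y hY)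
    fun w hw => LinearMap.mem_ker.mpr (Subtype.ext ((hker w).mpr hw))
  have hf : ∀ w : P, (f (Submodule.Quotient.mk w)).1 = Θ w := fun w => rfl
  have hinj : Function.Injective f := by
    rw [injective_iff_map_eq_zero]
    intro z hz
    obtain ⟨w, rfl⟩ := Submodule.Quotient.mk_surjective _ z
    rw [Submodule.Quotient.mk_eq_zero]
    refine (hker w).mp ?_
    rw [← hf, hz]; rfl
  have hsur : Function.Surjective f := by
    rintro ⟨y, hy⟩
    obtain ⟨w, rfl⟩ := hsurj y hy
    exact ⟨Submodule.Quotient.mk w, Subtype.ext (hf w)⟩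
  let E : (P ⧸ B.submoduleOf P) ≃+ Y := AddEquiv.ofBijective f.toAddMonoidHom ⟨hinj, hsur⟩
  have hE : ∀ z, E z = f z := fun z => rfl
  -- The `U(ĝ₁)`-structure is transported from `Y` along the additive bijection; semilinearity of
  -- `Θ` makes it compatible with the given structure through `Sp`.
  let _ : SMul U₁ (P ⧸ B.submoduleOf P) := ⟨fun x z => E.symm (x • E z)⟩
  have hsmul : ∀ (x : U₁) z, E (x • z) = x • E z := fun x z => E.apply_symm_apply _
  let inst : Module U₁ (P ⧸ B.submoduleOf P) :=
    Function.Injective.module U₁ E.toAddMonoidHom E.injective hsmul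
  let e : (P ⧸ B.submoduleOf P) ≃ₗ[U₁] Y := { E with map_smul' := hsmul }
  have he : ∀ z, e z = f z := fun z => rfl
  refine ⟨inst, fun x z => ?_, ⟨e.trans eY, fun x z => map_act (e.trans eY) x z⟩, ?_⟩
  · apply e.injective
    rw [map_smul, he, he, LinearMap.map_smulₛₗ]
  · rw [hatSpan_eq_span, eq_top_iff]
    intro z _
    have h := hS ((Submodule.span U₁ S).map (Y.subtype ∘ₗ e.toLinearMap)) (fun w hw =>
      ⟨Submodule.Quotient.mk w, Submodule.subset_span hw, hf w⟩) (e z).2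
    obtain ⟨z', hz', hzz⟩ := h
    have : z' = z := e.injective (Subtype.ext hzz)
    rwa [← this]

namespace TensorDecomp
variable {l m : ℕ} {u : ℕ → Vrep l ⊗[ℂ] Vrep m} (D : TensorDecomp l m u)

open Classical in
-- The equivariant inclusions and projections of the components induce maps between the induced
-- modules, and the orthogonality relations survive since they can be checked on the generators `1 ⊗
-- v`.
theorem exists_geSpan_equiv (i : ℕ) :
    Nonempty (D.geSpan i ≃ₗ[U₁] ⨁ j : Finset.Icc i m, Weyl₁ (l + m - 2 * j)) := by
  choose Φ hΦ using fun j => exists_weylMap (D.ι j) (D.lie_ι j)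
  choose R hR using fun j => exists_weylMap (D.q j) (D.lie_q j)
  have hmem : ∀ j, i ≤ j → ∀ z, Φ j z ∈ D.geSpan i := by
    intro j hj z
    induction z using ind_induction with
    | hmk v =>
      have := hΦ j v
      rw [show Φ j (indMk _ _ v) = wIncl _ (D.ι j v) from this]
      exact D.wIncl_mem_geSpan (D.ι_mem_ge hj v)
    | hadd z w hz hw => rw [map_add]; exact add_mem hz hw
    | hsmul w z hz => rw [map_smul]; exact (D.geSpan i).smul_mem w hz
  have hself : ∀ j ≤ m, ∀ z, R j (Φ j z) = z := by
    intro j hj z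
    have h : (R j).comp (Φ j) = LinearMap.id := ind_hom_ext _ fun v => by
      change R j (Φ j (wIncl _ v)) = wIncl _ v
      rw [hΦ, hR, D.q_ι_self j hj]
    exact LinearMap.congr_fun h z
  have hne : ∀ j k, j ≠ k → ∀ z, R j (Φ k z) = 0 := by
    intro j k hjk z
    have h : (R j).comp (Φ k) = 0 := ind_hom_ext _ fun v => by
      change R j (Φ k (wIncl _ v)) = 0
      rw [hΦ, hR, D.q_ι_ne j k _ hjk, map_zero]
    exact LinearMap.congr_fun h z
  have hsum : ∀ y ∈ D.geSpan i, ∑ j : Finset.Icc i m, Φ j (R j y) = y := by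
    intro y hy
    have h : D.geSpan i ≤ LinearMap.eqLocus (∑ j : Finset.Icc i m, (Φ j).comp (R j)) LinearMap.id := by
      rw [geSpan, Submodule.span_le]
      rintro _ ⟨v, hv, rfl⟩
      change (∑ j : Finset.Icc i m, (Φ j).comp (R j)) (wIncl _ v) = wIncl _ v
      rw [LinearMap.sum_apply]
      conv_rhs => rw [D.sum_p_of_mem_ge hv, map_sum, ← Finset.sum_coe_sort]
      refine Finset.sum_congr rfl fun j _ => ?_
      rw [LinearMap.comp_apply, hR, hΦ]; rfl
    have h2 := h hy
    rw [LinearMap.mem_eqLocus, LinearMap.sum_apply] at h2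
    exact h2
  let F : (⨁ j : Finset.Icc i m, Weyl₁ (l + m - 2 * j)) →ₗ[U₁] D.geSpan i :=
    DirectSum.toModule U₁ _ _ fun j => (Φ j).codRestrict _ (hmem j (Finset.mem_Icc.mp j.2).1)
  let H : D.geSpan i →ₗ[U₁] ⨁ j : Finset.Icc i m, Weyl₁ (l + m - 2 * j) :=
    ∑ j : Finset.Icc i m, (DirectSum.lof U₁ _ (fun j : Finset.Icc i m => Weyl₁ (l + m - 2 * j)) j).comp
      ((R j).comp (D.geSpan i).subtype)
  have hH : ∀ y, H y = ∑ j : Finset.Icc i m,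
      DirectSum.lof U₁ _ (fun j : Finset.Icc i m => Weyl₁ (l + m - 2 * j)) j (R j y.1) := fun y => by
    rw [LinearMap.sum_apply]; rfl
  have hF : ∀ (j : Finset.Icc i m) z, F (DirectSum.lof U₁ _
      (fun j : Finset.Icc i m => Weyl₁ (l + m - 2 * j)) j z) =
      ⟨Φ j z, hmem j (Finset.mem_Icc.mp j.2).1 z⟩ := fun j z => DirectSum.toModule_lof _ _ _
  refine ⟨LinearEquiv.ofLinearMap H F ?_ ?_⟩
  · refine DirectSum.linearMap_ext _ fun j => LinearMap.ext fun z => ?_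
    rw [LinearMap.comp_apply, LinearMap.comp_apply, hF, hH, Finset.sum_eq_single j]
    · rw [hself j (Finset.mem_Icc.mp j.2).2]; rfl
    · intro k _ hk
      rw [hne k j (fun h => hk (Subtype.ext h)), map_zero]
    · intro h; exact absurd (Finset.mem_univ j) h
  · refine LinearMap.ext fun y => Subtype.ext ?_
    rw [LinearMap.comp_apply, hH, map_sum]
    simp only [hF]
    rw [AddSubmonoidClass.coe_finsetSum]
    exact hsum y.1 y.2

variable {ψ : Vrep l ⊗[ℂ] Vrep m →ₗ[ℂ] W₁ l m}

/-- Under the constant `f` the vectors `ψ (hv j)` sweep out the images of the components of index at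
least `i`, and by triangularity ordered monomials applied to these images give all of `geSpan i`. -/
theorem geSpan_le (hψ : ∀ (P : ℂ[X]) (x : sl2) v, cur (algebraMap ℂ[X] _ P) x • ψ v =
      P.coeff 0 • ψ ⁅x, v⁆ + P.coeff 1 • ψ (D.θ x v))
    (hψ' : ∀ j w, ψ (D.ι j w) - wIncl _ (D.ι j w) ∈ D.geSpan (j + 1)) {i : ℕ}
    {T : Submodule U₁ (W₁ l m)} (hT : ∀ j, i ≤ j → j ≤ m → ψ (D.hv j) ∈ T) : D.geSpan i ≤ T := by
  have hι : ∀ j, i ≤ j → j ≤ m → ∀ w, ψ (D.ι j w) ∈ T := by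
    intro j hij hj w
    let K : Submodule ℂ (Vrep (l + m - 2 * j)) :=
      { carrier := {w | ψ (D.ι j w) ∈ T}
        add_mem' := fun {v w} hv hw => by
          change ψ (D.ι j (v + w)) ∈ T
          rw [map_add, map_add]; exact add_mem hv hw
        zero_mem' := by
          change ψ (D.ι j 0) ∈ T
          rw [map_zero, map_zero]; exact zero_mem _
        smul_mem' := fun c w hw => by
          change ψ (D.ι j (c • w)) ∈ T
          rw [map_smul, map_smul, ← algebraMap_smul U₁]; exact T.smul_mem _ hw }
    have hK : K = ⊤ := vrep_submodule_eq_top K (hT j hij hj) fun w hw => by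
      change ψ (D.ι j _) ∈ T
      have h := hψ 1 sl2f (D.ι j w)
      rw [Polynomial.coeff_one_zero, one_smul, Polynomial.coeff_one, if_neg one_ne_zero, zero_smul,
        add_zero] at h
      rw [D.lie_ι, ← h]
      exact T.smul_mem _ hw
    have hw : w ∈ K := by rw [hK]; trivial
    exact hw
  intro y hy
  obtain ⟨ζ, rfl⟩ := D.pbw_psi_surjective hψ' y
  rw [D.pbw_psi_mem_geSpan hψ'] at hy
  refine pbwMap_mem _ fun s => ?_
  rw [D.sum_p_of_mem_ge (hy s), map_sum]
  refine sum_mem fun j hj => ?_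
  have := Finset.mem_Icc.mp hj
  exact hι j this.1 this.2 _

end TensorDecomp

end
end TwoPoint

/-! ### Assembly of the theorem. -/

namespace TwoPoint

theorem a_pow_smul_vec_mem_fil {l m : ℕ} {i j : ℕ} (hij : i ≤ j) {v : Vrep l ⊗[ℂ] Vrep m}
    (hv : v ∈ tensorFil l m j) : a ^ j • vec l m v ∈ fil l m i := by
  refine ⟨?_, ?_⟩
  · rw [a_pow_smul_vec]
    exact wIncl₂_mem_tWeyl (TensorDecomp.a_pow_tmul_mem_lattice hv)
  · rw [← Nat.add_sub_cancel' hij, pow_add, mul_smul]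
    exact Submodule.smul_mem_pointwise_smul _ _ _ trivial

end TwoPoint

theorem mainTheorem6 (l m : ℕ) (hml : m ≤ l)
    (G : ℕ → LieSubmodule ℂ sl2 (Vrep l ⊗[ℂ] Vrep m))
    (hG₀ : G 0 = tensorFil l m 0)
    (hG : ∀ i, tensorFil l m i ⊔ G (i + 1) = tensorFil l m (i + 1))
    (hG' : ∀ i, Disjoint (tensorFil l m i) (G (i + 1)))
    (u : ℕ → Vrep l ⊗[ℂ] Vrep m)
    (hu : ∀ i ≤ m, u i ∈ G i ∧ u i ≠ 0 ∧ ⁅sl2e, u i⁆ = 0) :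
    (∀ i ≤ m, a ^ i • vec l m (u i) ∈ tWeyl l m ∧
      a ^ i • vec l m (u i) ∉ atWeyl l m ∧
      (0 < i → a ^ (i - 1) • vec l m (u i) ∉ tWeyl l m)) ∧
    (∀ i, (∀ j, i ≤ j → j ≤ m → a ^ j • vec l m (u j) ∈ fil l m i) ∧
      IsoAndGenerated (modA l m (fil l m i ⊔ atWeyl l m))
        (⨁ j : Finset.Icc i m, Weyl₁ (l + m - 2 * j))
        (classes l m (fil l m i ⊔ atWeyl l m) u i)) ∧
    IsoAndGenerated (modA l m (tWeyl l m)) (W₁ l m) (classes l m (tWeyl l m) u 0) := by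
  obtain ⟨D⟩ := exists_tensorDecomp hml (G := G)
    (fun i => by
      rcases i with _ | i
      · rw [prevFil, bot_sup_eq, hG₀]
      · exact hG i)
    (fun i => by
      rcases i with _ | i
      · exact disjoint_bot_left
      · exact hG' i) hu
  obtain ⟨ψ, hψ, hψ'⟩ := D.exists_psi hml
  obtain ⟨Θ, hker, hfil, hsurj, hval⟩ := exists_specialisation D hψ hψ'
  have hhv : ∀ j ≤ m, D.hv j = u j := fun j hj => D.hv_eq hj
  have hmem : ∀ j ≤ m, u j ∈ tensorFil l m j := fun j hj => by rw [← hhv j hj]; exact D.hv_mem j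
  have hp : ∀ j ≤ m, D.p j (u j) = D.hv j := fun j hj => by rw [← hhv j hj, D.p_hv_self]
  have hfilu : ∀ i j, i ≤ j → j ≤ m → a ^ j • vec l m (u j) ∈ fil l m i := fun i j hij hj =>
    a_pow_smul_vec_mem_fil hij (hmem j hj)
  have haW : atWeyl l m ≤ tWeyl l m := by
    intro w hw
    obtain ⟨w', hw', rfl⟩ := exists_of_mem_atWeyl hw
    exact (tWeyl l m).smul_mem _ hw'
  refine ⟨fun i hi => ⟨(hfilu 0 i (Nat.zero_le i) hi).1, fun h => ?_, fun h0 h => ?_⟩,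
    fun i => ⟨hfilu i, ?_⟩, ?_⟩
  -- `Θ` takes `aⁱ u_i` to `ψ u_i`, which is nonzero because the PBW map of `ψ` is injective.
  · have h1 := (hker ⟨_, (hfilu 0 i (Nat.zero_le i) hi).1⟩).mpr h
    rw [hval i (u i) (hmem i hi), hp i hi, hhv i hi, ← pbwMap_zero dec₁ ψ] at h1
    have h2 := D.pbw_psi_injective hψ' (h1.trans (map_zero _).symm)
    exact (hu i hi).2.1 (Finsupp.single_eq_zero.mp h2)
  -- Membership would put `u_i`, the coefficient of `a^{i-1}`, in `F^{i-1}`, although its component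
  -- of index `i` is `u_i ≠ 0`.
  · rw [a_pow_smul_vec, ← pbwMap_zero dec₂ (wIncl₂ l m), pbw₂_mem_tWeyl_iff] at h
    have h1 := h 0 (i - 1)
    rw [Finsupp.single_eq_same, cf_a_pow_tmul, if_pos rfl] at h1
    have h2 := D.p_eq_zero_of_mem h1 (by omega : i - 1 < i)
    rw [hp i hi, hhv i hi] at h2
    exact (hu i hi).2.1 h2
  · have hle : fil l m i ⊔ atWeyl l m ≤ tWeyl l m := sup_le inf_le_left haW
    obtain ⟨eY⟩ := D.exists_geSpan_equiv i
    refine isoAndGenerated_of_semilinear (Θ.comp (Submodule.inclusion hle)) (Y := D.geSpan i)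
      (fun w => hker (Submodule.inclusion hle w)) (fun w => ?_) (fun y hy => ?_) eY (fun T hT => ?_)
    -- The summand in `a Ṽ` is killed by `Θ`, so only the part in `𝓕_i` matters.
    · obtain ⟨w₁, h₁, w₂, h₂, h⟩ := Submodule.mem_sup.mp w.2
      have h3 : Submodule.inclusion hle w = ⟨w₁, h₁.1⟩ + ⟨w₂, haW h₂⟩ := Subtype.ext h.symm
      rw [LinearMap.comp_apply, h3, map_add, (hker ⟨w₂, haW h₂⟩).mpr h₂, add_zero]
      exact hfil i _ h₁
    · obtain ⟨w, hw, hwy⟩ := hsurj i y hy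
      exact ⟨⟨w.1, Submodule.mem_sup_left hw⟩, hwy⟩
    · refine D.geSpan_le hψ hψ' fun j hij hj => ?_
      have hP : a ^ j • vec l m (u j) ∈ fil l m i ⊔ atWeyl l m := Submodule.mem_sup_left (hfilu i j hij hj)
      have h1 := hT ⟨_, hP⟩ ⟨j, hij, hj, hP, rfl⟩
      rw [← hp j hj, ← hval j (u j) (hmem j hj) (hfilu 0 j (Nat.zero_le j) hj).1]
      exact h1
  · refine isoAndGenerated_of_semilinear Θ (Y := D.geSpan 0) hker
      (fun w => by rw [D.geSpan_zero]; trivial) (fun y hy => ?_)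
      ((LinearEquiv.ofEq _ _ D.geSpan_zero).trans Submodule.topEquiv) (fun T hT => ?_)
    · obtain ⟨w, _, hwy⟩ := hsurj 0 y hy
      exact ⟨w, hwy⟩
    · refine D.geSpan_le hψ hψ' fun j hij hj => ?_
      have hP := (hfilu 0 j (Nat.zero_le j) hj).1
      have h1 := hT ⟨_, hP⟩ ⟨j, hij, hj, hP, rfl⟩
      rw [← hp j hj, ← hval j (u j) (hmem j hj) hP]
      exact h1
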